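/- **Lemma 3.4 (Three-body estimate).** Let $A\in L^3_{\rm loc}(\mathbb R^3,\mathbb R^3)$ with $\lim_{|x|\to\infty}|A(x)|e^{-b|x|}=0$ for some $b>0$, let $0\le V\in L^1_{\rm loc}(\mathbb R^3)$ with $\lim_{|x|\to\infty}V(x)=+\infty$, and assume $$\lim_{|x|\to\infty}\frac{|A(x)|^2}{V(x)}=0 .$$ Let $\theta:\mathbb R^3\to\mathbb R$ be a radial smooth function with $0\le\theta\le1$, $\theta(x)=0$ for $|x|\le1$ and $\theta(x)=1$ for $|x|\ge2$. Let $a\ge 0$ and let $U\ge0$ be a radial smooth function on $\mathbb R^3$ supported in $\{1/2\le|x|\le1\}$ with $\int_{\mathbb R^3} U=4\pi a$. For $R>0$ put $\theta_R(x)=\theta(x/R)$ and $U_R(x)=R^{-3}U(x/R)$. Write $p=-i\nabla$ and $h=(p+A)^2+V$. For $0<\varepsilon<1$ and $s>0$ let $$\tilde h=h-(1-\varepsilon)p^2\theta_s(p)-\kappa_{\varepsilon,s},\qquad \kappa_{\varepsilon,s}=\inf\sigma\big(h-(1-\varepsilon)p^2\theta_s(p)-1\big)$$ on $L^2(\mathbb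 R^3)$, and let $$\tilde H_N=\sum_{j=1}^N\tilde h_j+\frac{(1-\varepsilon)^2}{N}\sum_{i\ne j}U_R(x_i-x_j)\prod_{k\ne i,j}\theta_{2R}(x_j-x_k)$$ on the space of permutation-symmetric functions in $L^2((\mathbb R^3)^N)$, where $\tilde h_j$ is $\tilde h$ acting in the variable $x_j$. All these operators are the self-adjoint operators defined by their quadratic forms. For every $0<\varepsilon<1$ and $s>0$ there is a constant $C_{\varepsilon,s}>0$, independent of $N$ and $R$ (it may depend on $A,V,\theta,U$), such that for every $R=R(N)$ with $R(N)N^{2/3}\to\infty$ as $N\to\infty$ and all $N$ large enough, $$\sum_{i\ne j}U_R(x_i-x_j)\sum_{k\ne i,j}\big(1-\theta_{2R}(x_j-x_k)\big)\le C_{\varepsilon,s}\frac{R^2}{N}(\tilde H_N)^4,$$ and, consequently, $$\tilde H_N\ge\sum_{j=1}^N\tilde h_j+\frac{(1-\varepsilon)^2}{N}\sum_{i\ne j}U_R(x_i-x_j)-C_{\varepsilon,s}\frac{R^2}{N^2}(\tilde H_N)^4 .$$ Both are inequalities of quadratic forms on the domain of $(\tilde H_N)^2$, which is the form domain of $(\tilde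 H_N)^4$; there $\langle\Psi,(\tilde H_N)^4\Psi\rangle=\|(\tilde H_N)^2\Psi\|^2$. -/

import Mathlib

open MeasureTheory Filter Topology
open scoped ContDiff FourierTransform ENNReal

namespace DysonGas

noncomputable section

/-- The physical space `ℝ³`. -/
abbrev Space : Type := EuclideanSpace ℝ (Fin 3)

/-- The configuration space `(ℝ³)^N` with its Euclidean structure and Lebesgue measure;
`x j : Space` is the position of the `j`-th particle. -/
abbrev Config (N : ℕ) : Type := PiLp 2 (fun _ : Fin N => Space)

/-- The Hilbert space `L²(F; ℂ)`. -/
abbrev L2 (F : Type) [NormedAddCommGroup F] [InnerProductSpace ℝ F] [FiniteDimensional ℝ F]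
    [MeasurableSpace F] [BorelSpace F] : Type :=
  Lp (α := F) ℂ 2 volume

/-! ### Operators given by quadratic forms

An operator on `H` is represented by its graph, a subset of `H × H`. -/

section Abstract

variable {H : Type} [NormedAddCommGroup H] [InnerProductSpace ℂ H]

/-- The operator `T` associated with the sesquilinear form `q` (antilinear in the first argument)
on the form domain `Q`: `u ∈ D(T)` and `T u = f` iff `u ∈ Q` and `q(v, u) = ⟨v, f⟩` for all
`v ∈ Q`. -/
def formOperator (Q : Set H) (q : H → H → ℂ) : Set (H × H) :=
  {p | p.1 ∈ Q ∧ ∀ v ∈ Q, q v p.1 = inner ℂ v p.2}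

/-- The square of an operator, with its natural domain. -/
def opSq (T : Set (H × H)) : Set (H × H) :=
  {p | ∃ v, (p.1, v) ∈ T ∧ (v, p.2) ∈ T}

/-- The spectrum: the complement of the set of `z` such that `T - z` is a bijection from its
domain onto `H` with a bounded inverse `S`. -/
def opSpectrum (T : Set (H × H)) : Set ℂ :=
  {z | ¬ ∃ S : H →L[ℂ] H, ∀ u f : H, (u, f + z • u) ∈ T ↔ u = S f}

/-- The bottom `inf σ(T)` of the spectrum of a self-adjoint operator. -/
def specInf (T : Set (H × H)) : ℝ :=
  sInf {t : ℝ | (t : ℂ) ∈ opSpectrum T}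

end Abstract

/-! ### The one-body operator

To treat `L²(ℝ³)` and the `j`-th variable of `L²((ℝ³)^N)` together, the definitions below take a
map `pr : F → ℝ³` which is the identity of `ℝ³` in the first case and `x ↦ x_j` in the second. -/

section OneBody

variable {F : Type} [NormedAddCommGroup F] [InnerProductSpace ℝ F] [FiniteDimensional ℝ F]
  [MeasurableSpace F] [BorelSpace F]

open Classical in
/-- The multiplication operator by `m` on `L²(F)` with its maximal domain (`0` outside of it). -/
def mulOp (m : F → ℝ) (u : L2 F) : L2 F :=
  if h : MemLp (fun x => (m x : ℂ) * u x) 2 volume then h.toLp _ else 0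

/-- The momentum variable dual to `pr x`; with the Fourier transform
`∫ e^{-2πi⟨x, ξ⟩} u(x) dx`, the operator `-i∇` is multiplication by `2πξ`. -/
def mom (pr : F → Space) (ξ : F) : Space := (2 * Real.pi) • pr ξ

/-- The component `k` of the momentum operator `p = -i∇` in the variable `pr x`. -/
def momOp (pr : F → Space) (k : Fin 3) (u : L2 F) : L2 F :=
  𝓕⁻ (mulOp (fun ξ => mom pr ξ k) (𝓕 u))

/-- The form domain of `(p + A)² + V - (1 - ε) p² θ_s(p)` in the variable `pr x`: the functions
`u ∈ L²` with `p u`, `A u` and `√V u` in `L²`. -/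
def formDomain (A : Space → Space) (V : Space → ℝ) (pr : F → Space) : Set (L2 F) :=
  {u | (∀ k, MemLp (fun ξ => (mom pr ξ k : ℂ) * (𝓕 u : L2 F) ξ) 2 volume) ∧
    (∀ k, MemLp (fun x => (A (pr x) k : ℂ) * u x) 2 volume) ∧
    MemLp (fun x => (Real.sqrt (V (pr x)) : ℂ) * u x) 2 volume}

/-- The form of `h = (p + A)² + V`. -/
def hForm (A : Space → Space) (V : Space → ℝ) (pr : F → Space) (v u : L2 F) : ℂ :=
  (∑ k, inner ℂ (momOp pr k v + mulOp (fun x => A (pr x) k) v)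
      (momOp pr k u + mulOp (fun x => A (pr x) k) u)) +
    ∫ x, (starRingEnd ℂ) (v x) * (V (pr x) : ℂ) * u x

/-- The form of `p² θ_s(p)`, where `θ_s(p) = θ(p / s)`. -/
def highForm (θ : Space → ℝ) (s : ℝ) (pr : F → Space) (v u : L2 F) : ℂ :=
  ∫ ξ, (starRingEnd ℂ) ((𝓕 v : L2 F) ξ) *
    ((‖mom pr ξ‖ ^ 2 * θ (s⁻¹ • mom pr ξ) : ℝ) : ℂ) * (𝓕 u : L2 F) ξ

/-- The form of `h - (1 - ε) p² θ_s(p)`. -/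
def lowForm (A : Space → Space) (V θ : Space → ℝ) (ε s : ℝ) (pr : F → Space) (v u : L2 F) : ℂ :=
  hForm A V pr v u - ((1 - ε : ℝ) : ℂ) * highForm θ s pr v u

/-- `κ_{ε,s} = inf σ(h - (1 - ε) p² θ_s(p) - 1)`, the operator acting on `L²(ℝ³)`. -/
def kappa (A : Space → Space) (V θ : Space → ℝ) (ε s : ℝ) : ℝ :=
  specInf (formOperator (H := L2 Space) (formDomain A V id)
    (fun v u => lowForm A V θ ε s id v u - inner ℂ v u))

/-- The form of `h̃ = h - (1 - ε) p² θ_s(p) - κ_{ε,s}`, acting in the variable `pr x`. -/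
def hTildeForm (A : Space → Space) (V θ : Space → ℝ) (ε s : ℝ) (pr : F → Space)
    (v u : L2 F) : ℂ :=
  lowForm A V θ ε s pr v u - (kappa A V θ ε s : ℂ) * inner ℂ v u

end OneBody

/-! ### The many-body operator -/

/-- The coordinate permutation `x ↦ (x_{σ⁻¹(1)}, …, x_{σ⁻¹(N)})`. -/
def permConfig {N : ℕ} (σ : Equiv.Perm (Fin N)) : Config N ≃ₗᵢ[ℝ] Config N :=
  LinearIsometryEquiv.piLpCongrLeft 2 ℝ Space σ

/-- The bosonic space of permutation-symmetric functions in `L²((ℝ³)^N)`. -/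
def bosonSpace (N : ℕ) : Submodule ℂ (L2 (Config N)) :=
  ⨅ σ : Equiv.Perm (Fin N),
    LinearMap.eqLocus
      (Lp.compMeasurePreservingₗᵢ ℂ (permConfig σ) (permConfig σ).measurePreserving :
        L2 (Config N) →ₗᵢ[ℂ] L2 (Config N)).toLinearMap
      LinearMap.id

/-- `U_R(x) = R⁻³ U(x / R)`. -/
def scaledU (U : Space → ℝ) (R : ℝ) (x : Space) : ℝ := (R ^ 3)⁻¹ * U (R⁻¹ • x)

/-- `θ_R(x) = θ(x / R)`. -/
def scaledθ (θ : Space → ℝ) (R : ℝ) (x : Space) : ℝ := θ (R⁻¹ • x)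

/-- `∑_{i ≠ j} U_R(x_i - x_j)`. -/
def twoBody (U : Space → ℝ) (R : ℝ) {N : ℕ} (x : Config N) : ℝ :=
  ∑ i, ∑ j ∈ Finset.univ.filter (fun j => j ≠ i), scaledU U R (x i - x j)

/-- `W_N = ∑_{i ≠ j} U_R(x_i - x_j) ∏_{k ≠ i, j} θ_{2R}(x_j - x_k)`. -/
def dysonW (U θ : Space → ℝ) (R : ℝ) {N : ℕ} (x : Config N) : ℝ :=
  ∑ i, ∑ j ∈ Finset.univ.filter (fun j => j ≠ i), scaledU U R (x i - x j) *
    ∏ k ∈ Finset.univ.filter (fun k => k ≠ i ∧ k ≠ j), scaledθ θ (2 * R) (x j - x k)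

/-- `∑_{i ≠ j} U_R(x_i - x_j) ∑_{k ≠ i, j} (1 - θ_{2R}(x_j - x_k))`. -/
def threeBody (U θ : Space → ℝ) (R : ℝ) {N : ℕ} (x : Config N) : ℝ :=
  ∑ i, ∑ j ∈ Finset.univ.filter (fun j => j ≠ i), scaledU U R (x i - x j) *
    ∑ k ∈ Finset.univ.filter (fun k => k ≠ i ∧ k ≠ j), (1 - scaledθ θ (2 * R) (x j - x k))

/-- The form of the multiplication operator by a bounded continuous function `W`. -/
def potForm {N : ℕ} (W : Config N → ℝ) (v u : L2 (Config N)) : ℂ :=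
  ∫ x, (starRingEnd ℂ) (v x) * (W x : ℂ) * u x

/-- The form of `∑_j h̃_j`. -/
def kineticForm (A : Space → Space) (V θ : Space → ℝ) (ε s : ℝ) {N : ℕ}
    (v u : L2 (Config N)) : ℂ :=
  ∑ j : Fin N, hTildeForm A V θ ε s (fun x : Config N => x j) v u

/-- The effective Hamiltonian `H̃_N = ∑_j h̃_j + (1 - ε)² N⁻¹ W_N` on the bosonic space. -/
def effHamiltonian (A : Space → Space) (V θ U : Space → ℝ) (ε s R : ℝ) (N : ℕ) :
    Set (bosonSpace N × bosonSpace N) :=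
  formOperator
    {Ψ : bosonSpace N | ∀ j : Fin N,
      (Ψ : L2 (Config N)) ∈ formDomain A V (fun x : Config N => x j)}
    (fun v u => kineticForm A V θ ε s (v : L2 (Config N)) u +
      (((1 - ε) ^ 2 / N : ℝ) : ℂ) * potForm (dysonW U θ R) (v : L2 (Config N)) u)

/-! ### The cut-off functions -/

/-- A radial smooth Heaviside-like function. -/
structure IsSmoothHeaviside (θ : Space → ℝ) : Prop where
  smooth : ContDiff ℝ ∞ θ
  radial : ∀ x y, ‖x‖ = ‖y‖ → θ x = θ y
  nonneg : ∀ x, 0 ≤ θ x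
  le_one : ∀ x, θ x ≤ 1
  eq_zero : ∀ x, ‖x‖ ≤ 1 → θ x = 0
  eq_one : ∀ x, 2 ≤ ‖x‖ → θ x = 1

/-- A radial smooth nonnegative function supported in `1/2 ≤ |x| ≤ 1` with integral `4πa`. -/
structure IsSoftPotential (a : ℝ) (U : Space → ℝ) : Prop where
  smooth : ContDiff ℝ ∞ U
  radial : ∀ x y, ‖x‖ = ‖y‖ → U x = U y
  nonneg : ∀ x, 0 ≤ U x
  support : ∀ x, U x ≠ 0 → 1 / 2 ≤ ‖x‖ ∧ ‖x‖ ≤ 1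
  integral : ∫ x, U x = 4 * Real.pi * a

end

end DysonGas

open DysonGas

/-! Write H = ∑ h̃_l + μ W with μ = (1 - ε)²/N, and let Φ = H Ψ, Ξ = H Φ. Three mechanisms carry the
proof.

Gap. The cut-off at momentum s leaves ε p² at high momenta, `A` is form-small with respect to p² + V
(Sobolev on a ball, |A|² ≪ V outside it), and the shift by κ forces h̃ ≥ 1. Hence h̃ ≥ d (1 + p² +
|A|² + V) as forms, first on ℝ³ and then, by slicing, in every coordinate
(`Growth.exists_gap_coord`). In particular H ≥ d N, so ‖Φ‖ ≤ ‖Ξ‖/(d N).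

Mixed products. Since the h̃_l commute and are positive, (∑ h̃_l)² dominates ∑_{l ≠ j} h̃_l h̃_j,
hence M(Ψ), the sum over l ≠ j of the norms of products of one operator of particle l with one of
particle j (`mixed_bound`, by Yosida approximation). To replace ∑ h̃_l by H one needs a lower bound
on Re ⟨W Ψ, ∑ h̃_l Ψ⟩. For each l, W = G + D, where G does not depend on x_l and so contributes a
nonnegative term, while D and its gradient are of size R⁻³ and R⁻⁴ and live where x_l is within 4R
of another particle. Hardy's inequality gives such a region a factor R²; the undifferentiated Ψ even
gets R³ from mixed derivatives. The error is (R⁻¹ + R^(-3/2)) M(Ψ), and after multiplication by μ it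
is negligible exactly because R N^(2/3) → ∞. Thus d² M(Ψ) ≤ 2 ‖Φ‖² and likewise d² M(Φ) ≤ 2 ‖Ξ‖²
(`IsWeak.mixed`).

Three-body term. The factor 1 - θ_{2R}(x_j - x_k) lives on |x_j - x_k| ≤ 4R, and Hardy's inequality
in x_k bounds it by R² p_k², the remaining U_R(x_i - x_j) being independent of x_k. So the
three-body term is at most of order R² ∑_k ⟨Ψ, 𝒰_k h̃_k Ψ⟩, where 𝒰_k is the pair potential of the
particles other than k. By the same splitting this sum is Re ⟨𝒰 Ψ, ∑ h̃_k Ψ⟩ for the full pair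
potential 𝒰, up to an error, and 𝒰 W ≥ 0 allows ∑ h̃_k Ψ to be replaced by Φ. Finally ⟨𝒰 Ψ, Φ⟩ ≤ ⟨Ψ,
𝒰 Ψ⟩^(1/2) ⟨Φ, 𝒰 Φ⟩^(1/2), and U_R, having bounded integral, is controlled by mixed derivatives
uniformly in R, so this is of order (M(Ψ) M(Φ))^(1/2), that is ‖Φ‖ ‖Ξ‖, hence ‖Ξ‖²/N
(`IsWeak.integral_threeSum_le`).

The second inequality follows from ∏ θ ≥ 1 - ∑ (1 - θ). Bosonic symmetry serves only to extend the
equation H Ψ = Φ to nonsymmetric test functions, so that the particles can be treated one at a time.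
-/

namespace DysonGas

noncomputable section

set_option linter.unusedSectionVars false

/-! ### Multiplication operators on L², bounded and unbounded. -/

section Multiplication

variable {F : Type} [NormedAddCommGroup F] [InnerProductSpace ℝ F] [FiniteDimensional ℝ F]
  [MeasurableSpace F] [BorelSpace F]

/-- `w` is the product of `u` with the (possibly unbounded) function `m`. -/
def IsMul (m : F → ℝ) (u w : L2 F) : Prop :=
  (fun x => (m x : ℂ) * u x) =ᵐ[volume] w

theorem IsMul.memLp {m : F → ℝ} {u w : L2 F} (h : IsMul m u w) :
    MemLp (fun x => (m x : ℂ) * u x) 2 volume :=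
  (memLp_congr_ae h).2 (Lp.memLp w)

theorem IsMul.mulOp_eq {m : F → ℝ} {u w : L2 F} (h : IsMul m u w) : mulOp m u = w := by
  have h' := h.memLp
  rw [mulOp, dif_pos h']
  exact Lp.ext (h'.coeFn_toLp.trans h)

theorem isMul_mulOp {m : F → ℝ} {u : L2 F}
    (h : MemLp (fun x => (m x : ℂ) * u x) 2 volume) : IsMul m u (mulOp m u) := by
  rw [mulOp, dif_pos h]
  exact h.coeFn_toLp.symm

theorem IsMul.unique {m : F → ℝ} {u w w' : L2 F} (h : IsMul m u w) (h' : IsMul m u w') :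
    w = w' := h.mulOp_eq.symm.trans h'.mulOp_eq

theorem IsMul.add {m : F → ℝ} {u w u' w' : L2 F} (h : IsMul m u w) (h' : IsMul m u' w') :
    IsMul m (u + u') (w + w') := by
  filter_upwards [h, h', Lp.coeFn_add u u', Lp.coeFn_add w w'] with x h1 h2 h3 h4
  simp only [h3, h4, Pi.add_apply, ← h1, ← h2]
  ring

theorem IsMul.smul {m : F → ℝ} {u w : L2 F} (h : IsMul m u w) (c : ℂ) :
    IsMul m (c • u) (c • w) := by
  filter_upwards [h, Lp.coeFn_smul c u, Lp.coeFn_smul c w] with x h1 h3 h4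
  simp only [h3, h4, Pi.smul_apply, ← h1, smul_eq_mul]
  ring

theorem IsMul.zero (m : F → ℝ) : IsMul m (0 : L2 F) 0 := by
  filter_upwards [Lp.coeFn_zero (E := ℂ) (p := 2) (μ := (volume : Measure F))] with x h
  rw [h, Pi.zero_apply, mul_zero]

/-- A norm-convergent sequence in `L²` has an almost everywhere convergent subsequence. -/
theorem exists_subseq_ae_tendsto {u : ℕ → L2 F} {v : L2 F} (h : Tendsto u atTop (𝓝 v)) :
    ∃ ns : ℕ → ℕ, StrictMono ns ∧ ∀ᵐ x, Tendsto (fun n => u (ns n) x) atTop (𝓝 (v x)) := by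
  have := (tendstoInMeasure_of_tendsto_Lp (p := 2) h)
  exact this.exists_seq_tendsto_ae

/-- Multiplication operators are closed: along a common subsequence both sequences converge almost
everywhere, and the pointwise identity passes to the limit. -/
theorem IsMul.of_tendsto {m : F → ℝ} {u w : ℕ → L2 F} {u' w' : L2 F}
    (h : ∀ n, IsMul m (u n) (w n)) (hu : Tendsto u atTop (𝓝 u')) (hw : Tendsto w atTop (𝓝 w')) :
    IsMul m u' w' := by
  obtain ⟨ns, hns, h1⟩ := exists_subseq_ae_tendsto hu
  obtain ⟨ms, hms, h2⟩ := exists_subseq_ae_tendsto (hw.comp hns.tendsto_atTop)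
  have h3 : ∀ᵐ x, ∀ n, (m x : ℂ) * u n x = w n x := ae_all_iff.2 h
  filter_upwards [h1, h2, h3] with x h1 h2 h3
  have h4 := (h1.comp hms.tendsto_atTop).const_mul (m x : ℂ)
  refine tendsto_nhds_unique h4 (h2.congr fun n => ?_)
  simp [h3]

theorem inner_eq_integral (u v : L2 F) :
    inner ℂ v u = ∫ x, (starRingEnd ℂ) (v x) * u x := by
  rw [L2.inner_def]
  exact integral_congr_ae (Eventually.of_forall fun x => by simp [RCLike.inner_apply, mul_comm])

theorem integrable_norm_sq (u : L2 F) : Integrable (fun x => ‖u x‖ ^ 2) volume :=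
  (Lp.memLp u).integrable_norm_pow (by norm_num)

theorem norm_sq_eq_integral (u : L2 F) : ‖u‖ ^ 2 = ∫ x, ‖u x‖ ^ 2 := by
  have h := @inner_self_eq_norm_sq ℂ _ _ _ _ u
  rw [← h, L2.inner_def, ← integral_re (L2.integrable_inner (𝕜 := ℂ) u u)]
  congr 1
  ext x
  exact inner_self_eq_norm_sq _

/-- Dominated convergence in `L²`. -/
theorem tendsto_L2_of_dominated {α : Type*} {l : Filter α} [l.IsCountablyGenerated]
    {f : α → L2 F} {f' : L2 F} {φ : α → F → ℂ} {g : F → ℝ} (hφ : ∀ a, f a =ᵐ[volume] φ a)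
    (hg : Integrable (fun x => g x ^ 2) volume)
    (hb : ∀ᶠ a in l, ∀ᵐ x, ‖φ a x - f' x‖ ≤ g x)
    (hl : ∀ᵐ x, Tendsto (fun a => φ a x) l (𝓝 (f' x))) : Tendsto f l (𝓝 f') := by
  have key : Tendsto (fun a => ∫ x, ‖φ a x - f' x‖ ^ 2) l (𝓝 (∫ _ : F, (0 : ℝ))) := by
    refine tendsto_integral_filter_of_dominated_convergence (fun x => g x ^ 2) ?_ ?_ hg ?_
    · refine Eventually.of_forall fun a => ?_
      have h1 : AEStronglyMeasurable (fun x => φ a x - f' x) volume :=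
        ((Lp.aestronglyMeasurable (f a)).congr (hφ a)).sub (Lp.aestronglyMeasurable f')
      exact (h1.norm.pow 2)
    · filter_upwards [hb] with a ha
      filter_upwards [ha] with x hx
      rw [Real.norm_of_nonneg (by positivity)]
      gcongr
    · filter_upwards [hl] with x hx
      have := ((hx.sub_const (f' x)).norm.pow 2)
      simpa using this
  rw [integral_zero] at key
  rw [tendsto_iff_norm_sub_tendsto_zero]
  have h2 : ∀ a, ‖f a - f'‖ = Real.sqrt (∫ x, ‖φ a x - f' x‖ ^ 2) := by
    intro a
    have h3 : ∫ x, ‖φ a x - f' x‖ ^ 2 = ∫ x, ‖(f a - f' : L2 F) x‖ ^ 2 := by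
      refine integral_congr_ae ?_
      filter_upwards [hφ a, Lp.coeFn_sub (f a) f'] with x h h'
      rw [h', Pi.sub_apply, h]
    rw [h3, ← norm_sq_eq_integral, Real.sqrt_sq (norm_nonneg _)]
  simp_rw [h2]
  have h4 := (Real.continuous_sqrt.tendsto 0).comp key
  rw [Real.sqrt_zero] at h4
  exact h4

/-- Bounded measurable functions. -/
def BddMeas (m : F → ℝ) : Prop := AEStronglyMeasurable m volume ∧ ∃ C, ∀ x, |m x| ≤ C

theorem BddMeas.memLp {m : F → ℝ} (h : BddMeas m) (u : L2 F) :
    MemLp (fun x => (m x : ℂ) * u x) 2 volume := by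
  obtain ⟨h1, C, hC⟩ := h
  refine MemLp.of_le_mul (c := C) (Lp.memLp u)
    ((Complex.continuous_ofReal.comp_aestronglyMeasurable h1).mul (Lp.aestronglyMeasurable u)) ?_
  filter_upwards with x
  rw [norm_mul, Complex.norm_real, Real.norm_eq_abs]
  gcongr
  exact hC x

theorem BddMeas.isMul {m : F → ℝ} (h : BddMeas m) (u : L2 F) : IsMul m u (mulOp m u) :=
  isMul_mulOp (h.memLp u)

theorem norm_le_of_ae_le {u w : L2 F} {C : ℝ} (h : ∀ᵐ x, ‖w x‖ ≤ C * ‖u x‖) :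
    ‖w‖ ≤ C * ‖u‖ := Lp.norm_le_mul_norm_of_ae_le_mul h

theorem norm_mulOp_le {m : F → ℝ} (h : BddMeas m) {C : ℝ} (hC : ∀ x, |m x| ≤ C) (u : L2 F) :
    ‖mulOp m u‖ ≤ C * ‖u‖ := by
  refine norm_le_of_ae_le ?_
  filter_upwards [h.isMul u] with x hx
  rw [← hx, norm_mul, Complex.norm_real, Real.norm_eq_abs]
  gcongr
  exact hC x

/-- Multiplication by a bounded measurable function as a bounded operator. -/
def mulCLM (m : F → ℝ) (h : BddMeas m) : L2 F →L[ℂ] L2 F :=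
  LinearMap.mkContinuousOfExistsBound
    { toFun := mulOp m
      map_add' := fun u v => ((h.isMul u).add (h.isMul v)).mulOp_eq
      map_smul' := fun c u => ((h.isMul u).smul c).mulOp_eq }
    (by
      obtain ⟨C, hC⟩ := h.2
      exact ⟨C, fun u => norm_mulOp_le h hC u⟩)

@[simp] theorem mulCLM_apply {m : F → ℝ} (h : BddMeas m) (u : L2 F) :
    mulCLM m h u = mulOp m u := rfl

theorem IsMul.inner_comm {m : F → ℝ} {u w u' w' : L2 F} (h : IsMul m u w) (h' : IsMul m u' w') :
    inner ℂ w u' = inner ℂ u w' := by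
  rw [inner_eq_integral, inner_eq_integral]
  refine integral_congr_ae ?_
  filter_upwards [h, h'] with x h1 h2
  rw [← h1, ← h2]
  simp
  ring

theorem IsMul.inner_eq {m : F → ℝ} {u w : L2 F} (h : IsMul m u w) (v : L2 F) :
    inner ℂ v w = ∫ x, (starRingEnd ℂ) (v x) * (m x : ℂ) * u x := by
  rw [inner_eq_integral]
  refine integral_congr_ae ?_
  filter_upwards [h] with x h1
  rw [← h1]
  ring

theorem adjoint_mulCLM {m : F → ℝ} (h : BddMeas m) :
    ContinuousLinearMap.adjoint (mulCLM m h) = mulCLM m h := by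
  symm
  rw [ContinuousLinearMap.eq_adjoint_iff]
  exact fun u v => (h.isMul u).inner_comm (h.isMul v)

theorem IsMul.norm_sq {m : F → ℝ} {u w : L2 F} (h : IsMul m u w) :
    ‖w‖ ^ 2 = ∫ x, m x ^ 2 * ‖u x‖ ^ 2 := by
  rw [norm_sq_eq_integral]
  refine integral_congr_ae ?_
  filter_upwards [h] with x h1
  rw [← h1, norm_mul, mul_pow, Complex.norm_real, Real.norm_eq_abs, sq_abs]

theorem BddMeas.integrable {m : F → ℝ} (h : BddMeas m) (u : L2 F) :
    Integrable (fun x => m x * ‖u x‖ ^ 2) volume := by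
  obtain ⟨h1, C, hC⟩ := h
  exact (integrable_norm_sq u).bdd_mul h1 (Eventually.of_forall fun x => by
    simpa using hC x)

theorem BddMeas.re_inner {m : F → ℝ} (h : BddMeas m) (u : L2 F) :
    inner ℂ u (mulOp m u) = ((∫ x, m x * ‖u x‖ ^ 2 : ℝ) : ℂ) := by
  rw [(h.isMul u).inner_eq, ← integral_complex_ofReal]
  congr 1
  ext x
  have := Complex.normSq_eq_conj_mul_self (z := u x)
  rw [Complex.normSq_eq_norm_sq] at this
  push_cast at this ⊢
  rw [this]
  ring

theorem mulOp_mulOp {m m' : F → ℝ} {u w : L2 F} (h : IsMul m u w) {w' : L2 F}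
    (h' : IsMul m' w w') : IsMul (fun x => m' x * m x) u w' := by
  filter_upwards [h, h'] with x h1 h2
  rw [← h2, ← h1]
  push_cast
  ring

theorem IsMul.congr_fun {m m' : F → ℝ} {u w : L2 F} (h : IsMul m u w) (hm : ∀ x, m x = m' x) :
    IsMul m' u w := by
  rwa [show m' = m from funext fun x => (hm x).symm]

/-- The truncation of a function at height `n`. -/
def trunc {X : Type*} (m : X → ℝ) (n : ℕ) (x : X) : ℝ := if |m x| ≤ n then m x else 0

theorem abs_trunc_le {X : Type*} (m : X → ℝ) (n : ℕ) (x : X) : |trunc m n x| ≤ n := by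
  unfold trunc
  split_ifs with h
  · exact h
  · simp

theorem abs_trunc_le_abs {X : Type*} (m : X → ℝ) (n : ℕ) (x : X) : |trunc m n x| ≤ |m x| := by
  unfold trunc
  split_ifs with h
  · exact le_rfl
  · simp

theorem trunc_eventually_eq {X : Type*} (m : X → ℝ) (x : X) :
    ∀ᶠ n : ℕ in atTop, trunc m n x = m x := by
  obtain ⟨k, hk⟩ := exists_nat_ge |m x|
  filter_upwards [eventually_ge_atTop k] with n hn
  rw [trunc, if_pos (hk.trans (by exact_mod_cast hn))]

theorem aestronglyMeasurable_trunc {X : Type*} [MeasurableSpace X] {μ : Measure X} {m : X → ℝ}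
    (h : AEStronglyMeasurable m μ) (n : ℕ) : AEStronglyMeasurable (trunc m n) μ := by
  have h2 : Measurable (fun y : ℝ => if |y| ≤ n then y else 0) :=
    Measurable.ite (measurableSet_le (by fun_prop) (by fun_prop)) measurable_id measurable_const
  exact (h2.comp_aemeasurable h.aemeasurable).aestronglyMeasurable

theorem bddMeas_trunc {m : F → ℝ} (h : AEStronglyMeasurable m volume) (n : ℕ) :
    BddMeas (trunc m n) :=
  ⟨aestronglyMeasurable_trunc h n, n, abs_trunc_le m n⟩

theorem tendsto_mulOp_trunc {m : F → ℝ} (hm : AEStronglyMeasurable m volume) {u w : L2 F}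
    (h : IsMul m u w) : Tendsto (fun n => mulOp (trunc m n) u) atTop (𝓝 w) := by
  refine tendsto_L2_of_dominated (φ := fun n x => (trunc m n x : ℂ) * u x)
    (g := fun x => 2 * ‖w x‖) (fun n => ((bddMeas_trunc hm n).isMul u).symm) ?_ ?_ ?_
  · simpa [mul_pow] using (integrable_norm_sq w).const_mul 4 |>.congr
      (Eventually.of_forall fun x => by norm_num)
  · refine Eventually.of_forall fun n => ?_
    filter_upwards [h] with x hx
    refine (norm_sub_le _ _).trans ?_
    have : ‖(trunc m n x : ℂ) * u x‖ ≤ ‖w x‖ := by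
      rw [← hx, norm_mul, norm_mul, Complex.norm_real, Complex.norm_real]
      gcongr
      exact abs_trunc_le_abs m n x
    linarith
  · filter_upwards [h] with x hx
    refine tendsto_nhds_of_eventually_eq ?_
    filter_upwards [trunc_eventually_eq m x] with n hn
    rw [hn, hx]

/-- With `tendsto_mulOp_trunc` this characterizes an unbounded multiplication operator through
bounded ones, so that an operator commuting with bounded multiplications also respects `A` and √V.
-/
theorem IsMul.of_tendsto_trunc {m : F → ℝ} (hm : AEStronglyMeasurable m volume) {u w : L2 F}
    (h : Tendsto (fun n => mulOp (trunc m n) u) atTop (𝓝 w)) : IsMul m u w := by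
  obtain ⟨ns, hns, h1⟩ := exists_subseq_ae_tendsto h
  have h3 : ∀ᵐ x, ∀ n, (trunc m n x : ℂ) * u x = mulOp (trunc m n) u x :=
    ae_all_iff.2 fun n => (bddMeas_trunc hm n).isMul u
  filter_upwards [h1, h3] with x h1 h3
  refine tendsto_nhds_unique (tendsto_nhds_of_eventually_eq ?_) h1
  filter_upwards [hns.tendsto_atTop.eventually (trunc_eventually_eq m x)] with n hn
  rw [← h3, hn]

end Multiplication

/-! ### Translations, the Fourier transform and the momentum as a limit of difference quotients. -/

section Translation

variable {F : Type} [NormedAddCommGroup F] [InnerProductSpace ℝ F] [FiniteDimensional ℝ F]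
  [MeasurableSpace F] [BorelSpace F]

/-- The translation `u ↦ u(· + v)`. -/
def tr (v : F) : L2 F →L[ℂ] L2 F :=
  (Lp.compMeasurePreservingₗᵢ ℂ (fun x => x + v)
    (measurePreserving_add_right volume v)).toContinuousLinearMap

theorem coeFn_tr (v : F) (u : L2 F) : tr v u =ᵐ[volume] fun x => u (x + v) :=
  Lp.coeFn_compMeasurePreserving u (measurePreserving_add_right volume v)

theorem ae_add {p : F → Prop} (v : F) (h : ∀ᵐ x, p x) : ∀ᵐ x, p (x + v) :=
  (measurePreserving_add_right volume v).quasiMeasurePreserving.ae h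

theorem inner_tr_tr (v : F) (u w : L2 F) : inner ℂ (tr v u) (tr v w) = inner ℂ u w :=
  LinearIsometry.inner_map_map _ _ _

theorem tr_tr (v w : F) (u : L2 F) : tr v (tr w u) = tr (v + w) u := by
  refine Lp.ext ?_
  filter_upwards [coeFn_tr v (tr w u), ae_add v (coeFn_tr w u), coeFn_tr (v + w) u] with x h1 h2 h3
  rw [h1, h2, h3, add_assoc]

theorem tr_zero (u : L2 F) : tr 0 u = u := by
  refine Lp.ext ?_
  filter_upwards [coeFn_tr 0 u] with x h1
  rw [h1, add_zero]

theorem inner_tr_left (v : F) (u w : L2 F) : inner ℂ (tr v u) w = inner ℂ u (tr (-v) w) := by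
  rw [← inner_tr_tr v u, tr_tr, add_neg_cancel, tr_zero]

/-- Multiplication by the character `e^{2πi⟨v, ξ⟩}` as a function. -/
def chr (v ξ : F) : ℂ := Complex.exp ((2 * Real.pi * inner ℝ v ξ : ℝ) * Complex.I)

theorem norm_chr (v ξ : F) : ‖chr v ξ‖ = 1 := Complex.norm_exp_ofReal_mul_I _

theorem continuous_chr (v : F) : Continuous (chr v) := by unfold chr; fun_prop

/-- Both sides are continuous in `u`, because the character has modulus one, so Schwartz functions
suffice; for them it is a change of variables in the Fourier integral. -/
theorem fourier_tr (v : F) (u : L2 F) :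
    (𝓕 (tr v u) : L2 F) =ᵐ[volume] fun ξ => chr v ξ * (𝓕 u : L2 F) ξ := by
  have hm : ∀ w : L2 F, MemLp (fun ξ => chr v ξ * w ξ) 2 volume := by
    intro w
    refine MemLp.of_le_mul (c := 1) (Lp.memLp w)
      ((continuous_chr v).aestronglyMeasurable.mul (Lp.aestronglyMeasurable w)) ?_
    filter_upwards with x
    rw [norm_mul, norm_chr]
  have hz : ∀ w : L2 F, (𝓕 (tr v w) : L2 F) = (hm (𝓕 w)).toLp _ := by
    intro w
    have hd : DenseRange (SchwartzMap.toLpCLM ℝ ℂ 2 (volume : Measure F)) :=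
      SchwartzMap.denseRange_toLpCLM (by simp)
    refine hd.induction_on w ?_ ?_
    · refine isClosed_eq ?_ ?_
      · exact (Lp.fourierTransformₗᵢ F ℂ).continuous.comp (tr v).continuous
      · have : ∀ w w' : L2 F, dist ((hm (𝓕 w)).toLp _) ((hm (𝓕 w')).toLp _) = dist w w' := by
          intro w w'
          rw [dist_eq_norm, dist_eq_norm, ← Lp.norm_fourier_eq (w - w')]
          have e : (𝓕 (w - w') : L2 F) = 𝓕 w - 𝓕 w' := map_sub (Lp.fourierTransformₗᵢ F ℂ) w w'
          rw [e]
          rw [← sq_eq_sq₀ (norm_nonneg _) (norm_nonneg _), norm_sq_eq_integral,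
            norm_sq_eq_integral]
          refine integral_congr_ae ?_
          filter_upwards [Lp.coeFn_sub ((hm (𝓕 w)).toLp _) ((hm (𝓕 w')).toLp _),
            (hm (𝓕 w)).coeFn_toLp, (hm (𝓕 w')).coeFn_toLp,
            Lp.coeFn_sub (𝓕 w : L2 F) (𝓕 w')] with x h1 h2 h3 h4
          rw [h1, h4, Pi.sub_apply, Pi.sub_apply, h2, h3, ← mul_sub, norm_mul, norm_chr, one_mul]
        exact (Isometry.of_dist_eq this).continuous
    · intro f
      have e1 : tr v (f.toLp 2) = (SchwartzMap.compSubConstCLM ℝ (-v) f).toLp 2 := by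
        refine Lp.ext ?_
        filter_upwards [coeFn_tr v (f.toLp 2), ae_add v (f.coeFn_toLp 2 (volume : Measure F)),
          (SchwartzMap.compSubConstCLM ℝ (-v) f).coeFn_toLp 2] with x h1 h2 h3
        rw [h1, h2, h3]
        simp
      rw [SchwartzMap.toLpCLM_apply, e1, SchwartzMap.toLp_fourier_eq]
      refine Lp.ext ?_
      filter_upwards [(hm (𝓕 (f.toLp 2))).coeFn_toLp, SchwartzMap.coeFn_toLp (𝓕 f) 2 volume,
        (𝓕 (SchwartzMap.compSubConstCLM ℝ (-v) f)).coeFn_toLp 2] with x h1 h2 h3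
      rw [h1, h3, SchwartzMap.toLp_fourier_eq, h2, SchwartzMap.fourier_coe, SchwartzMap.fourier_coe]
      have e2 : (⇑(SchwartzMap.compSubConstCLM ℝ (-v) f) : F → ℂ) = ⇑f ∘ fun x => x + v := by
        ext x; simp
      rw [e2]
      have := congrFun (VectorFourier.fourierIntegral_comp_add_right Real.fourierChar volume
        (innerₗ F) f v) x
      refine Eq.trans this ?_
      rw [Circle.smul_def, Real.fourierChar_apply, smul_eq_mul]
      simp only [chr, innerₗ_apply_apply]
      rfl
  rw [hz u]
  exact (hm (𝓕 u)).coeFn_toLp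

/-- `w = ⟨v, -i∇⟩ u`. -/
def IsP (v : F) (u w : L2 F) : Prop :=
  IsMul (fun ξ => 2 * Real.pi * inner ℝ v ξ) (𝓕 u) (𝓕 w)

theorem fourier_add' (u w : L2 F) : (𝓕 (u + w) : L2 F) = 𝓕 u + 𝓕 w :=
  map_add (Lp.fourierTransformₗᵢ F ℂ) u w

theorem fourier_sub' (u w : L2 F) : (𝓕 (u - w) : L2 F) = 𝓕 u - 𝓕 w :=
  map_sub (Lp.fourierTransformₗᵢ F ℂ) u w

theorem fourier_smul' (c : ℂ) (u : L2 F) : (𝓕 (c • u) : L2 F) = c • 𝓕 u :=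
  map_smul (Lp.fourierTransformₗᵢ F ℂ) c u

theorem fourier_zero' : (𝓕 (0 : L2 F) : L2 F) = 0 :=
  map_zero (Lp.fourierTransformₗᵢ F ℂ)

theorem tendsto_fourier_iff {α : Type*} {l : Filter α} {f : α → L2 F} {g : L2 F} :
    Tendsto (fun a => (𝓕 (f a) : L2 F)) l (𝓝 (𝓕 g)) ↔ Tendsto f l (𝓝 g) :=
  ((Lp.fourierTransformₗᵢ F ℂ).toHomeomorph.isInducing.tendsto_nhds_iff).symm

theorem IsP.add {v : F} {u w u' w' : L2 F} (h : IsP v u w) (h' : IsP v u' w') :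
    IsP v (u + u') (w + w') := by
  unfold IsP
  rw [fourier_add', fourier_add']
  exact IsMul.add h h'

theorem IsP.smul {v : F} {u w : L2 F} (h : IsP v u w) (c : ℂ) : IsP v (c • u) (c • w) := by
  unfold IsP
  rw [fourier_smul', fourier_smul']
  exact IsMul.smul h c

theorem IsP.zero (v : F) : IsP v (0 : L2 F) 0 := by
  unfold IsP
  rw [fourier_zero']
  exact IsMul.zero _

theorem IsP.of_tendsto {v : F} {u w : ℕ → L2 F} {u' w' : L2 F}
    (h : ∀ n, IsP v (u n) (w n)) (hu : Tendsto u atTop (𝓝 u')) (hw : Tendsto w atTop (𝓝 w')) :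
    IsP v u' w' :=
  IsMul.of_tendsto (m := fun ξ => 2 * Real.pi * inner ℝ v ξ) h
    (tendsto_fourier_iff.2 hu) (tendsto_fourier_iff.2 hw)

theorem IsP.inner_comm {v : F} {u w u' w' : L2 F} (h : IsP v u w) (h' : IsP v u' w') :
    inner ℂ w u' = inner ℂ u w' := by
  rw [← Lp.inner_fourier_eq, ← Lp.inner_fourier_eq u]
  exact IsMul.inner_comm h h'

/-- The difference quotient `(u(· + t v) - u) / t`. -/
def dq (v : F) (t : ℝ) (u : L2 F) : L2 F := ((t⁻¹ : ℝ) : ℂ) • (tr (t • v) u - u)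

theorem fourier_dq (v : F) (t : ℝ) (u : L2 F) :
    (𝓕 (dq v t u) : L2 F) =ᵐ[volume]
      fun ξ => ((t⁻¹ : ℝ) : ℂ) * (chr (t • v) ξ - 1) * (𝓕 u : L2 F) ξ := by
  rw [dq, fourier_smul', fourier_sub']
  filter_upwards [Lp.coeFn_smul ((t⁻¹ : ℝ) : ℂ) (𝓕 (tr (t • v) u) - 𝓕 u : L2 F),
    Lp.coeFn_sub (𝓕 (tr (t • v) u) : L2 F) (𝓕 u), fourier_tr (t • v) u] with ξ h1 h2 h3
  rw [h1, Pi.smul_apply, h2, Pi.sub_apply, h3, smul_eq_mul]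
  ring

theorem tendsto_chr_dq (v ξ : F) :
    Tendsto (fun t : ℝ => ((t⁻¹ : ℝ) : ℂ) * (chr (t • v) ξ - 1)) (𝓝[≠] 0)
      (𝓝 (((2 * Real.pi * inner ℝ v ξ : ℝ) : ℂ) * Complex.I)) := by
  have h : HasDerivAt (fun t : ℝ => chr (t • v) ξ)
      (((2 * Real.pi * inner ℝ v ξ : ℝ) : ℂ) * Complex.I) 0 := by
    have h0 : HasDerivAt (fun t : ℝ => ((t : ℂ) * (((2 * Real.pi * inner ℝ v ξ : ℝ) : ℂ)
        * Complex.I))) (((2 * Real.pi * inner ℝ v ξ : ℝ) : ℂ) * Complex.I) 0 := by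
      simpa using (Complex.ofRealCLM.hasDerivAt (x := 0)).mul_const
        (((2 * Real.pi * inner ℝ v ξ : ℝ) : ℂ) * Complex.I)
    have h1 := h0.cexp
    simp only [Complex.ofReal_zero, zero_mul, Complex.exp_zero, one_mul] at h1
    refine h1.congr_of_eventuallyEq (Eventually.of_forall fun t => ?_)
    simp only [chr, inner_smul_left]
    congr 1
    push_cast
    simp
    ring
  have h2 := hasDerivAt_iff_tendsto_slope_zero.1 h
  refine h2.congr fun t => ?_
  simp [chr]

theorem norm_chr_dq_le (v ξ : F) (t : ℝ) :
    ‖((t⁻¹ : ℝ) : ℂ) * (chr (t • v) ξ - 1)‖ ≤ |2 * Real.pi * inner ℝ v ξ| := by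
  have h := Real.norm_exp_I_mul_ofReal_sub_one_le (x := 2 * Real.pi * inner ℝ (t • v) ξ)
  rw [norm_mul, Complex.norm_real, norm_inv]
  have h2 : ‖chr (t • v) ξ - 1‖ ≤ |t| * |2 * Real.pi * inner ℝ v ξ| := by
    rw [chr, mul_comm _ Complex.I]
    refine h.trans (le_of_eq ?_)
    rw [Real.norm_eq_abs, ← abs_mul, inner_smul_left]
    congr 1
    simp
    ring
  rcases eq_or_ne t 0 with rfl | ht
  · simp
  · rw [Real.norm_eq_abs, inv_mul_le_iff₀ (abs_pos.2 ht)]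
    exact h2

/-- With its converse `IsP.of_tendsto_dq` this describes the momentum by translations alone, which
is what lets it be transported by intertwining operators and be computed on products in position
space. Dominated convergence applies on the Fourier side because |e^{ix} - 1| ≤ |x| bounds each
quotient by |𝓕 w|. -/
theorem IsP.tendsto_dq {v : F} {u w : L2 F} (h : IsP v u w) :
    Tendsto (fun t => dq v t u) (𝓝[≠] 0) (𝓝 (Complex.I • w)) := by
  rw [← tendsto_fourier_iff, fourier_smul']
  refine tendsto_L2_of_dominated
    (φ := fun t ξ => ((t⁻¹ : ℝ) : ℂ) * (chr (t • v) ξ - 1) * (𝓕 u : L2 F) ξ)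
    (g := fun ξ => 2 * ‖(𝓕 w : L2 F) ξ‖) (fun t => fourier_dq v t u) ?_ ?_ ?_
  · exact ((integrable_norm_sq (𝓕 w : L2 F)).const_mul 4).congr
      (Eventually.of_forall fun x => by ring)
  · refine Eventually.of_forall fun t => ?_
    filter_upwards [h, Lp.coeFn_smul Complex.I (𝓕 w : L2 F)] with ξ h1 h2
    rw [h2, Pi.smul_apply, smul_eq_mul]
    refine (norm_sub_le _ _).trans ?_
    have : ‖((t⁻¹ : ℝ) : ℂ) * (chr (t • v) ξ - 1) * (𝓕 u : L2 F) ξ‖ ≤ ‖(𝓕 w : L2 F) ξ‖ := by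
      rw [← h1, norm_mul _ ((𝓕 u : L2 F) ξ)]
      refine (mul_le_mul_of_nonneg_right (norm_chr_dq_le v ξ t) (norm_nonneg _)).trans ?_
      rw [norm_mul, Complex.norm_real, Real.norm_eq_abs]
    simp only [norm_mul, Complex.norm_I, one_mul] at this ⊢
    linarith
  · filter_upwards [h, Lp.coeFn_smul Complex.I (𝓕 w : L2 F)] with ξ h1 h2
    rw [h2, Pi.smul_apply, smul_eq_mul, ← h1]
    have := (tendsto_chr_dq v ξ).mul_const ((𝓕 u : L2 F) ξ)
    refine this.trans (le_of_eq ?_)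
    congr 1
    ring

theorem IsP.of_tendsto_dq {v : F} {u w : L2 F} {t : ℕ → ℝ} (ht : Tendsto t atTop (𝓝[≠] 0))
    (h : Tendsto (fun n => dq v (t n) u) atTop (𝓝 (Complex.I • w))) : IsP v u w := by
  rw [← tendsto_fourier_iff, fourier_smul'] at h
  obtain ⟨ns, hns, h1⟩ := exists_subseq_ae_tendsto h
  have h3 := ae_all_iff.2 fun n => fourier_dq v (t n) u
  filter_upwards [h1, h3, Lp.coeFn_smul Complex.I (𝓕 w : L2 F)] with ξ h1 h3 h4
  have h5 := ((tendsto_chr_dq v ξ).comp (ht.comp hns.tendsto_atTop)).mul_const ((𝓕 u : L2 F) ξ)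
  have h6 := tendsto_nhds_unique h5 (h1.congr fun n => by rw [h3]; rfl)
  rw [h4, Pi.smul_apply, smul_eq_mul] at h6
  have : Complex.I * ((2 * Real.pi * inner ℝ v ξ : ℝ) * (𝓕 u : L2 F) ξ) =
      Complex.I * (𝓕 w : L2 F) ξ := by rw [← h6]; ring
  exact mul_left_cancel₀ Complex.I_ne_zero this

/-- An operator intertwining two families of translations intertwines the momenta. -/
theorem IsP.map {F' : Type} [NormedAddCommGroup F'] [InnerProductSpace ℝ F']
    [FiniteDimensional ℝ F'] [MeasurableSpace F'] [BorelSpace F'] {v : F} {v' : F'} {u w : L2 F}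
    (B : L2 F →L[ℂ] L2 F')
    (hB : ∀ (t : ℝ) u, B (tr (t • v) u) = tr (t • v') (B u)) (h : IsP v u w) :
    IsP v' (B u) (B w) := by
  have ht : Tendsto (fun n : ℕ => (1 / ((n : ℝ) + 1))) atTop (𝓝[≠] 0) :=
    tendsto_nhdsWithin_iff.2 ⟨tendsto_one_div_add_atTop_nhds_zero_nat,
      Eventually.of_forall fun n => by simp; positivity⟩
  refine IsP.of_tendsto_dq ht ?_
  have := (B.continuous.tendsto _).comp (h.tendsto_dq.comp ht)
  rw [map_smul] at this
  refine this.congr fun n => ?_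
  simp only [Function.comp_apply, dq, map_smul, map_sub, hB]

end Translation

/-! ### Leibniz' rule and integration by parts in L². -/

section ProductRule

variable {F : Type} [NormedAddCommGroup F] [InnerProductSpace ℝ F] [FiniteDimensional ℝ F]
  [MeasurableSpace F] [BorelSpace F]

theorem BddMeas.of_continuous {m : F → ℝ} (h : Continuous m) {C : ℝ} (hC : ∀ x, |m x| ≤ C) :
    BddMeas m := ⟨h.aestronglyMeasurable, C, hC⟩

theorem BddMeas.translate {m : F → ℝ} (h : BddMeas m) (v : F) : BddMeas (fun x => m (x + v)) :=
  ⟨h.1.comp_quasiMeasurePreserving (measurePreserving_add_right volume v).quasiMeasurePreserving,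
    h.2.imp fun _ hC _ => hC _⟩

theorem BddMeas.sub {m m' : F → ℝ} (h : BddMeas m) (h' : BddMeas m') :
    BddMeas (fun x => m x - m' x) := by
  obtain ⟨h1, C, hC⟩ := h
  obtain ⟨h1', C', hC'⟩ := h'
  exact ⟨h1.sub h1', C + C', fun x => (abs_sub _ _).trans (add_le_add (hC x) (hC' x))⟩

theorem BddMeas.add {m m' : F → ℝ} (h : BddMeas m) (h' : BddMeas m') :
    BddMeas (fun x => m x + m' x) := by
  obtain ⟨h1, C, hC⟩ := h
  obtain ⟨h1', C', hC'⟩ := h'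
  exact ⟨h1.add h1', C + C', fun x => (abs_add_le _ _).trans (add_le_add (hC x) (hC' x))⟩

theorem BddMeas.mul {m m' : F → ℝ} (h : BddMeas m) (h' : BddMeas m') :
    BddMeas (fun x => m x * m' x) := by
  obtain ⟨h1, C, hC⟩ := h
  obtain ⟨h1', C', hC'⟩ := h'
  exact ⟨h1.mul h1', C * C', fun x => by
    rw [abs_mul]
    exact mul_le_mul (hC x) (hC' x) (abs_nonneg _) ((abs_nonneg _).trans (hC x))⟩

theorem BddMeas.const (c : ℝ) : BddMeas (fun _ : F => c) :=
  ⟨aestronglyMeasurable_const, |c|, fun _ => le_rfl⟩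

theorem BddMeas.sum {ι : Type*} {s : Finset ι} {m : ι → F → ℝ} (h : ∀ i ∈ s, BddMeas (m i)) :
    BddMeas (fun x => ∑ i ∈ s, m i x) := by
  classical
  induction s using Finset.induction_on with
  | empty => simpa using BddMeas.const 0
  | insert i s hi ih =>
    simp only [Finset.sum_insert hi]
    exact (h i (by simp)).add (ih fun j hj => h j (by simp [hj]))

theorem abs_sub_le_of_hasDerivAt_line {G G' : F → ℝ} {v : F} {L : ℝ} (hL : ∀ x, |G' x| ≤ L)
    (hd : ∀ x, HasDerivAt (fun t : ℝ => G (x + t • v)) (G' x) 0) (x : F) (t : ℝ) :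
    |G (x + t • v) - G x| ≤ L * |t| := by
  have h1 : ∀ s : ℝ, HasDerivAt (fun t : ℝ => G (x + t • v)) (G' (x + s • v)) s := by
    intro s
    have h2 := hd (x + s • v)
    have h3 : HasDerivAt (fun t : ℝ => t - s) 1 s := (hasDerivAt_id s).sub_const s
    have h4 := HasDerivAt.comp s (h₂ := fun t : ℝ => G (x + s • v + t • v)) (h := fun t => t - s)
      (by simpa using h2) h3
    rw [mul_one] at h4
    refine h4.congr_of_eventuallyEq (Eventually.of_forall fun t => ?_)
    simp only [Function.comp_apply]
    congr 1
    rw [add_assoc, ← add_smul]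
    congr 2
    ring
  have := Convex.norm_image_sub_le_of_norm_hasDerivWithin_le (s := Set.univ) (C := L)
    (x := (0 : ℝ)) (y := t) (fun s _ => (h1 s).hasDerivWithinAt) (fun s _ => hL _)
    convex_univ (by simp) (by simp)
  simpa using this

theorem tendsto_one_div_nhdsNE :
    Tendsto (fun n : ℕ => (1 / ((n : ℝ) + 1))) atTop (𝓝[≠] 0) :=
  tendsto_nhdsWithin_iff.2 ⟨tendsto_one_div_add_atTop_nhds_zero_nat,
    Eventually.of_forall fun n => by simp; positivity⟩

/-- Leibniz' rule for the momentum. -/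
theorem IsP.mul {v : F} {u w : L2 F} (h : IsP v u w) {G G' : F → ℝ} (hG : BddMeas G)
    (hG' : BddMeas G') (hd : ∀ x, HasDerivAt (fun t : ℝ => G (x + t • v)) (G' x) 0) :
    IsP v (mulOp G u) (mulOp G w - Complex.I • mulOp G' u) := by
  obtain ⟨C, hC⟩ := hG.2
  obtain ⟨L, hL⟩ := hG'.2
  have hC0 : 0 ≤ C := (abs_nonneg _).trans (hC 0)
  set t : ℕ → ℝ := fun n => 1 / ((n : ℝ) + 1) with ht
  have htt : Tendsto t atTop (𝓝[≠] 0) := tendsto_one_div_nhdsNE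
  have ht0 : Tendsto t atTop (𝓝 0) := (tendsto_nhdsWithin_iff.1 htt).1
  have hGt : ∀ n, BddMeas (fun x => G (x + t n • v)) := fun n => hG.translate _
  have hDt : ∀ n, BddMeas (fun x => (t n)⁻¹ * (G (x + t n • v) - G x)) := fun n =>
    (BddMeas.const _).mul ((hGt n).sub hG)
  refine IsP.of_tendsto_dq htt ?_
  -- The discrete Leibniz rule, with the limit `Complex.I • w` of the quotient of `u` split off: the
  -- first term then tends to zero because `G` is bounded, and the other two are handled by
  -- dominated convergence.
  have e : ∀ n, dq v (t n) (mulOp G u) =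
      mulOp (fun x => G (x + t n • v)) (dq v (t n) u - Complex.I • w) +
      mulOp (fun x => G (x + t n • v)) (Complex.I • w) +
      mulOp (fun x => (t n)⁻¹ * (G (x + t n • v) - G x)) u := by
    intro n
    have e1 : mulOp (fun x => G (x + t n • v)) (dq v (t n) u - Complex.I • w) +
      mulOp (fun x => G (x + t n • v)) (Complex.I • w) =
        mulOp (fun x => G (x + t n • v)) (dq v (t n) u) := by
      rw [← mulCLM_apply (hGt n), ← mulCLM_apply (hGt n), ← mulCLM_apply (hGt n), ← map_add,
        sub_add_cancel]
    rw [e1]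
    refine Lp.ext ?_
    rw [dq]
    filter_upwards [Lp.coeFn_smul (((t n)⁻¹ : ℝ) : ℂ) (tr (t n • v) (mulOp G u) - mulOp G u),
      Lp.coeFn_sub (tr (t n • v) (mulOp G u)) (mulOp G u), coeFn_tr (t n • v) (mulOp G u),
      hG.isMul u, ae_add (t n • v) (hG.isMul u),
      Lp.coeFn_add (mulOp (fun x => G (x + t n • v)) (dq v (t n) u))
        (mulOp (fun x => (t n)⁻¹ * (G (x + t n • v) - G x)) u),
      (hGt n).isMul (dq v (t n) u), (hDt n).isMul u,
      Lp.coeFn_smul (((t n)⁻¹ : ℝ) : ℂ) (tr (t n • v) u - u),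
      Lp.coeFn_sub (tr (t n • v) u) u, coeFn_tr (t n • v) u] with x h1 h2 h3 h4 h5 h6 h7 h8 h9 h10 h11
    rw [h1, Pi.smul_apply, h2, Pi.sub_apply, h3, ← h4, ← h5, h6, Pi.add_apply, ← h7, ← h8, dq, h9,
      Pi.smul_apply, h10, Pi.sub_apply, h11]
    simp only [smul_eq_mul]
    push_cast
    ring
  simp_rw [e]
  have l1 : Tendsto (fun n => mulOp (fun x => G (x + t n • v)) (dq v (t n) u - Complex.I • w))
      atTop (𝓝 0) := by
    have := (tendsto_iff_norm_sub_tendsto_zero.1 (h.tendsto_dq.comp htt)).const_mul C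
    rw [mul_zero] at this
    exact squeeze_zero_norm (fun n => norm_mulOp_le (hGt n) (fun x => hC _) _) this
  have hcont : ∀ x, Tendsto (fun n => G (x + t n • v)) atTop (𝓝 (G x)) := by
    intro x
    have h1 := (hd x).continuousAt.tendsto.comp ht0
    rw [zero_smul, add_zero] at h1
    exact h1
  have l2 : Tendsto (fun n => mulOp (fun x => G (x + t n • v)) (Complex.I • w)) atTop
      (𝓝 (mulOp G (Complex.I • w))) := by
    refine tendsto_L2_of_dominated (g := fun x => 2 * C * ‖(Complex.I • w : L2 F) x‖)
      (fun n => ((hGt n).isMul _).symm) ?_ ?_ ?_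
    · exact ((integrable_norm_sq (Complex.I • w)).const_mul (4 * C ^ 2)).congr
        (Eventually.of_forall fun x => by ring)
    · refine Eventually.of_forall fun n => ?_
      filter_upwards [hG.isMul (Complex.I • w)] with x hx
      rw [← hx, ← sub_mul, norm_mul, ← Complex.ofReal_sub, Complex.norm_real, Real.norm_eq_abs]
      gcongr
      exact (abs_sub _ _).trans (by linarith [hC (x + t n • v), hC x])
    · filter_upwards [hG.isMul (Complex.I • w)] with x hx
      rw [← hx]
      exact ((Complex.continuous_ofReal.tendsto _).comp (hcont x)).mul_const _
  have l3 : Tendsto (fun n => mulOp (fun x => (t n)⁻¹ * (G (x + t n • v) - G x)) u) atTop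
      (𝓝 (mulOp G' u)) := by
    refine tendsto_L2_of_dominated (g := fun x => 2 * L * ‖u x‖)
      (fun n => ((hDt n).isMul _).symm) ?_ ?_ ?_
    · exact ((integrable_norm_sq u).const_mul (4 * L ^ 2)).congr
        (Eventually.of_forall fun x => by ring)
    · refine Eventually.of_forall fun n => ?_
      filter_upwards [hG'.isMul u] with x hx
      rw [← hx, ← sub_mul, norm_mul, ← Complex.ofReal_sub, Complex.norm_real, Real.norm_eq_abs]
      gcongr
      have h1 := abs_sub_le_of_hasDerivAt_line hL hd x (t n)
      have h2 : 0 < t n := by positivity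
      have h3 : |(t n)⁻¹ * (G (x + t n • v) - G x)| ≤ L := by
        rw [abs_mul, abs_of_pos (inv_pos.2 h2), inv_mul_le_iff₀ h2, mul_comm]
        rwa [abs_of_pos h2] at h1
      exact (abs_sub _ _).trans (by linarith [hL x])
    · filter_upwards [hG'.isMul u] with x hx
      rw [← hx]
      refine ((Complex.continuous_ofReal.tendsto _).comp ?_).mul_const _
      have h1 := (hasDerivAt_iff_tendsto_slope_zero.1 (hd x)).comp htt
      refine h1.congr fun n => ?_
      simp
  have := (l1.add l2).add l3
  refine this.trans (le_of_eq ?_)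
  congr 1
  rw [← mulCLM_apply hG, map_smul, mulCLM_apply, zero_add, smul_sub, smul_smul, Complex.I_mul_I]
  simp

theorem integrable_mul_norm_mul_norm {G : F → ℝ} (hG : BddMeas G) (u w : L2 F) :
    Integrable (fun x => G x * (‖u x‖ * ‖w x‖)) volume := by
  obtain ⟨h1, C, hC⟩ := hG
  have h2 : Integrable (fun x => ‖u x‖ * ‖w x‖) volume :=
    (Lp.memLp u).norm.integrable_mul (Lp.memLp w).norm
  exact h2.bdd_mul h1 (Eventually.of_forall fun x => by simpa using hC x)

theorem BddMeas.abs {m : F → ℝ} (h : BddMeas m) : BddMeas (fun x => |m x|) :=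
  ⟨h.1.norm, h.2.imp fun _ hC x => by simpa using hC x⟩

/-- Integration by parts against the density `|u|²`. -/
theorem IsP.integral_deriv_le {v : F} {u w : L2 F} (h : IsP v u w) {G G' : F → ℝ} (hG : BddMeas G)
    (hG' : BddMeas G') (hd : ∀ x, HasDerivAt (fun t : ℝ => G (x + t • v)) (G' x) 0) :
    ∫ x, G' x * ‖u x‖ ^ 2 ≤ 2 * ∫ x, |G x| * (‖u x‖ * ‖w x‖) := by
  -- Symmetry of the momentum, applied to `u` and `G u`. With z = ⟨u, G w⟩ it reads z - z̄ = i ∫ G'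
  -- |u|², so the integral equals 2 Im z.
  have h1 := h.inner_comm (h.mul hG hG' hd)
  rw [inner_sub_right, inner_smul_right, hG'.re_inner, ← (hG.isMul w).inner_comm (hG.isMul u),
    ← inner_conj_symm] at h1
  set z := inner ℂ u (mulOp G w)
  have h2 : ∫ x, G' x * ‖u x‖ ^ 2 = 2 * z.im := by
    have := congrArg Complex.im h1
    simp at this
    linarith
  have h3 : ‖z‖ ≤ ∫ x, |G x| * (‖u x‖ * ‖w x‖) := by
    change ‖inner ℂ u (mulOp G w)‖ ≤ _
    rw [(hG.isMul w).inner_eq]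
    refine (norm_integral_le_integral_norm _).trans (le_of_eq ?_)
    congr 1
    ext x
    simp only [norm_mul, RCLike.norm_conj, Complex.norm_real, Real.norm_eq_abs]
    ring
  rw [h2]
  linarith [Complex.abs_im_le_norm z, le_abs_self z.im]

theorem weighted_cauchy {G : F → ℝ} (hG : BddMeas G) (u w : L2 F) :
    2 * ∫ x, |G x| * (‖u x‖ * ‖w x‖) ≤
      (∫ x, |G x| * ‖u x‖ ^ 2) + ∫ x, |G x| * ‖w x‖ ^ 2 := by
  rw [← integral_const_mul, ← integral_add (hG.abs.integrable u) (hG.abs.integrable w)]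
  refine integral_mono ((integrable_mul_norm_mul_norm hG.abs u w).const_mul 2)
    ((hG.abs.integrable u).add (hG.abs.integrable w)) fun x => ?_
  have := mul_nonneg (abs_nonneg (G x)) (sq_nonneg (‖u x‖ - ‖w x‖))
  simp only
  nlinarith

end ProductRule

/-! ### Hardy inequalities for a relative coordinate. -/

section Hardy

variable {F : Type} [NormedAddCommGroup F] [InnerProductSpace ℝ F] [FiniteDimensional ℝ F]
  [MeasurableSpace F] [BorelSpace F]

/-- The `k`-th unit vector of `ℝ³`. -/
abbrev unitVec (k : Fin 3) : Space := EuclideanSpace.single k (1 : ℝ)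

theorem norm_sq_eq_sum (z : Space) : ‖z‖ ^ 2 = ∑ k, z k ^ 2 := by
  rw [EuclideanSpace.norm_sq_eq]
  simp

theorem norm_add_smul_unitVec_sq (z : Space) (k : Fin 3) (t : ℝ) :
    ‖z + t • unitVec k‖ ^ 2 = ‖z‖ ^ 2 + 2 * t * z k + t ^ 2 := by
  rw [norm_add_sq_real, norm_smul, inner_smul_right, EuclideanSpace.inner_single_right]
  simp
  ring

theorem add_smul_unitVec_apply (z : Space) (k : Fin 3) (t : ℝ) :
    (z + t • unitVec k) k = z k + t := by simp

theorem sq_apply_le (z : Space) (k : Fin 3) : z k ^ 2 ≤ ‖z‖ ^ 2 := by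
  rw [norm_sq_eq_sum]
  exact Finset.single_le_sum (f := fun k => z k ^ 2) (fun _ _ => sq_nonneg _) (Finset.mem_univ k)

theorem abs_apply_le (z : Space) (k : Fin 3) : |z k| ≤ ‖z‖ := by
  have := EuclideanSpace.norm_eq z
  simpa using PiLp.norm_apply_le z k

/-- The Hardy weight `1 / (|z|² + R²)`. -/
def rho (R : ℝ) (z : Space) : ℝ := (‖z‖ ^ 2 + R ^ 2)⁻¹

theorem rho_pos {R : ℝ} (hR : 0 < R) (z : Space) : 0 < rho R z := by unfold rho; positivity

theorem continuous_rho {R : ℝ} (hR : 0 < R) : Continuous (rho R) := by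
  unfold rho
  exact Continuous.inv₀ (by fun_prop) fun z => by positivity

theorem rho_le {R : ℝ} (hR : 0 < R) (z : Space) : rho R z ≤ (R ^ 2)⁻¹ := by
  unfold rho
  gcongr
  nlinarith [sq_nonneg ‖z‖]

theorem bddMeas_rho {R : ℝ} (hR : 0 < R) {ζ : F → Space} (hζ : Continuous ζ) :
    BddMeas (fun x => rho R (ζ x)) :=
  .of_continuous ((continuous_rho hR).comp hζ) (C := (R ^ 2)⁻¹) fun x => by
    rw [abs_of_pos (rho_pos hR _)]; exact rho_le hR _

/-- Hardy's inequality, regularised at distance `R`, in the direction of the vectors `v k`. -/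
theorem hardy {R : ℝ} (hR : 0 < R) {ζ : F → Space} (hζ : Continuous ζ) {v : Fin 3 → F}
    (hv : ∀ x k (t : ℝ), ζ (x + t • v k) = ζ x + t • unitVec k) {u : L2 F} {w : Fin 3 → L2 F}
    (h : ∀ k, IsP (v k) u (w k)) :
    ∫ x, rho R (ζ x) * ‖u x‖ ^ 2 ≤ 4 * ∑ k, ‖w k‖ ^ 2 := by
  have hpos : ∀ z : Space, 0 < ‖z‖ ^ 2 + R ^ 2 := fun z => by positivity
  -- The vector field ζ/(|ζ|² + R²) has divergence 3ρ - 2|ζ|²ρ² ≥ ρ and squared length at most ρ.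
  -- Integrating by parts and using 2ab ≤ a²/2 + 2b² gives ∫ρ|u|² ≤ ½ ∫ρ|u|² + 2 ∑‖w_k‖², whence the
  -- factor 4.
  let G : Fin 3 → F → ℝ := fun k x => ζ x k * rho R (ζ x)
  let G' : Fin 3 → F → ℝ := fun k x => rho R (ζ x) - 2 * (ζ x k * rho R (ζ x)) ^ 2
  have hGsq : ∀ k x, (G k x) ^ 2 ≤ (R ^ 2)⁻¹ := by
    intro k x
    refine le_trans ?_ (rho_le hR (ζ x))
    simp only [G, rho]
    rw [mul_pow, inv_pow, ← div_eq_mul_inv, div_le_iff₀ (by positivity), sq (‖ζ x‖ ^ 2 + R ^ 2),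
      inv_mul_cancel_left₀ (hpos _).ne']
    nlinarith [sq_apply_le (ζ x) k]
  have hGc : ∀ k, Continuous (G k) := fun k => by
    have h1 : Continuous fun x => ζ x k := by fun_prop
    exact h1.mul ((continuous_rho hR).comp hζ)
  have hG : ∀ k, BddMeas (G k) := fun k => .of_continuous (hGc k) (C := R⁻¹) fun x => by
    refine abs_le_of_sq_le_sq ?_ (by positivity)
    simpa using hGsq k x
  have hG' : ∀ k, BddMeas (G' k) := fun k =>
    (bddMeas_rho hR hζ).sub ((BddMeas.const 2).mul (by
      simpa [sq] using (hG k).mul (hG k)))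
  have hd : ∀ k x, HasDerivAt (fun t : ℝ => G k (x + t • v k)) (G' k x) 0 := by
    intro k x
    simp only [G, G', rho, hv, norm_add_smul_unitVec_sq, add_smul_unitVec_apply]
    have h1 : HasDerivAt (fun t : ℝ => ζ x k + t) 1 0 := (hasDerivAt_id 0).const_add _
    have h2 : HasDerivAt (fun t : ℝ => ‖ζ x‖ ^ 2 + 2 * t * ζ x k + t ^ 2 + R ^ 2)
        (2 * ζ x k) 0 := by
      have := ((((hasDerivAt_id (0 : ℝ)).const_mul 2).mul_const (ζ x k)).const_add
        (‖ζ x‖ ^ 2)).add ((hasDerivAt_id (0 : ℝ)).pow 2) |>.add_const (R ^ 2)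
      simpa using this
    have h3 := h1.mul (h2.fun_inv (by simpa using (hpos (ζ x)).ne'))
    refine h3.congr_deriv ?_
    have := (hpos (ζ x)).ne'
    simp
    field_simp
    ring
  have key : ∀ k, ∫ x, G' k x * ‖u x‖ ^ 2 ≤
      (1 / 2) * (∫ x, (G k x) ^ 2 * ‖u x‖ ^ 2) + 2 * ‖w k‖ ^ 2 := by
    intro k
    refine ((h k).integral_deriv_le (hG k) (hG' k) (hd k)).trans ?_
    have hG2 : BddMeas (fun x => (G k x) ^ 2) := by simpa [sq] using (hG k).mul (hG k)
    rw [norm_sq_eq_integral, ← integral_const_mul, ← integral_const_mul, ← integral_const_mul,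
      ← integral_add ((hG2.integrable u).const_mul _) ((integrable_norm_sq (w k)).const_mul _)]
    refine integral_mono ((integrable_mul_norm_mul_norm (hG k).abs u (w k)).const_mul 2)
      (((hG2.integrable u).const_mul _).add ((integrable_norm_sq (w k)).const_mul _)) fun x => ?_
    simp only
    have e : (G k x) ^ 2 = |G k x| ^ 2 := (sq_abs _).symm
    rw [e]
    nlinarith [sq_nonneg (|G k x| * ‖u x‖ - 2 * ‖w k x‖)]
  have hG2 : ∀ k, BddMeas (fun x => (G k x) ^ 2) := fun k => by
    simpa [sq] using (hG k).mul (hG k)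
  have hsum := Finset.sum_le_sum fun k (_ : k ∈ Finset.univ) => key k
  rw [Finset.sum_add_distrib, ← Finset.mul_sum, ← Finset.mul_sum,
    ← integral_finsetSum _ (fun k _ => (hG' k).integrable u),
    ← integral_finsetSum _ (fun k _ => (hG2 k).integrable u)] at hsum
  have hle : ∫ x, rho R (ζ x) * ‖u x‖ ^ 2 ≤
      (∫ x, ∑ k, G' k x * ‖u x‖ ^ 2) := by
    refine integral_mono ((bddMeas_rho hR hζ).integrable u)
      (integrable_finsetSum _ fun k _ => (hG' k).integrable u) fun x => ?_
    rw [← Finset.sum_mul]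
    refine mul_le_mul_of_nonneg_right ?_ (sq_nonneg _)
    have e : ∑ k, G' k x = 3 * rho R (ζ x) - 2 * (‖ζ x‖ ^ 2 * rho R (ζ x) ^ 2) := by
      rw [norm_sq_eq_sum]
      simp only [G', Fin.sum_univ_three]
      ring
    rw [e]
    have h1 := rho_pos hR (ζ x)
    have h2 : ‖ζ x‖ ^ 2 * rho R (ζ x) ≤ 1 := by
      rw [rho, ← div_eq_mul_inv, div_le_one (hpos _)]
      nlinarith [sq_nonneg R]
    nlinarith
  have hle2 : (∫ x, ∑ k, (G k x) ^ 2 * ‖u x‖ ^ 2) ≤ ∫ x, rho R (ζ x) * ‖u x‖ ^ 2 := by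
    refine integral_mono (integrable_finsetSum _ fun k _ => (hG2 k).integrable u)
      ((bddMeas_rho hR hζ).integrable u) fun x => ?_
    simp only
    rw [← Finset.sum_mul]
    refine mul_le_mul_of_nonneg_right ?_ (sq_nonneg _)
    have e : ∑ k, (G k x) ^ 2 = ‖ζ x‖ ^ 2 * rho R (ζ x) * rho R (ζ x) := by
      rw [norm_sq_eq_sum]
      simp only [G, Fin.sum_univ_three]
      ring
    rw [e]
    have h2 : ‖ζ x‖ ^ 2 * rho R (ζ x) ≤ 1 := by
      rw [rho, ← div_eq_mul_inv, div_le_one (hpos _)]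
      nlinarith [sq_nonneg R]
    nlinarith [rho_pos hR (ζ x)]
  linarith

/-- The indicator function of the ball of radius `r`. -/
def near (r : ℝ) (z : Space) : ℝ := if ‖z‖ ≤ r then 1 else 0

theorem near_nonneg (r : ℝ) (z : Space) : 0 ≤ near r z := by unfold near; split_ifs <;> norm_num

theorem near_le_one (r : ℝ) (z : Space) : near r z ≤ 1 := by unfold near; split_ifs <;> norm_num

theorem near_neg (r : ℝ) (z : Space) : near r (-z) = near r z := by simp [near]

theorem measurable_near (r : ℝ) : Measurable (near r) :=
  Measurable.ite (measurableSet_le (by fun_prop) (by fun_prop)) measurable_const measurable_const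

theorem bddMeas_near (r : ℝ) {ζ : F → Space} (hζ : Continuous ζ) :
    BddMeas (fun x => near r (ζ x)) :=
  ⟨((measurable_near r).comp hζ.measurable).aestronglyMeasurable, 1, fun x => by
    rw [abs_of_nonneg (near_nonneg r _)]; exact near_le_one r _⟩

theorem near_le_rho {r : ℝ} (hr : 0 < r) (z : Space) : near r z ≤ 2 * r ^ 2 * rho r z := by
  unfold near
  split_ifs with h
  · rw [rho, ← div_eq_mul_inv, le_div_iff₀ (by positivity)]
    have : ‖z‖ ^ 2 ≤ r ^ 2 := by gcongr
    linarith
  · have := rho_pos hr z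
    positivity

theorem hardy_ball {r : ℝ} (hr : 0 < r) {ζ : F → Space} (hζ : Continuous ζ) {v : Fin 3 → F}
    (hv : ∀ x k (t : ℝ), ζ (x + t • v k) = ζ x + t • unitVec k) {u : L2 F} {w : Fin 3 → L2 F}
    (h : ∀ k, IsP (v k) u (w k)) :
    ∫ x, near r (ζ x) * ‖u x‖ ^ 2 ≤ 8 * r ^ 2 * ∑ k, ‖w k‖ ^ 2 := by
  have h1 := hardy hr hζ hv h
  have h2 : ∫ x, near r (ζ x) * ‖u x‖ ^ 2 ≤ ∫ x, 2 * r ^ 2 * (rho r (ζ x) * ‖u x‖ ^ 2) := by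
    refine integral_mono ((bddMeas_near r hζ).integrable u)
      (((bddMeas_rho hr hζ).integrable u).const_mul _) fun x => ?_
    have := mul_le_mul_of_nonneg_right (near_le_rho hr (ζ x)) (sq_nonneg ‖u x‖)
    simp only
    linarith
  rw [integral_const_mul] at h2
  nlinarith [sq_nonneg r]

/-- The density of `u` near the diagonal `ζ = 0`, where `v` and `v'` move `ζ` in opposite
directions, is controlled by mixed derivatives. -/
theorem mixed_ball {R : ℝ} (hR : 0 < R) {ζ : F → Space} (hζ : Continuous ζ) {v v' : Fin 3 → F}
    (hv : ∀ x k (t : ℝ), ζ (x + t • v k) = ζ x + t • unitVec k)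
    (hv' : ∀ x k (t : ℝ), ζ (x + t • v' k) = ζ x - t • unitVec k) {u : L2 F}
    {w y : Fin 3 → L2 F} {z : Fin 3 → Fin 3 → L2 F} (h : ∀ k, IsP (v k) u (w k))
    (hy : ∀ k, IsP (v' k) u (y k)) (hz : ∀ k l, IsP (v' l) (w k) (z k l)) :
    ∫ x, near R (ζ x) * ‖u x‖ ^ 2 ≤
      24 * R ^ 3 * ((∑ k, ‖y k‖ ^ 2) + ∑ k, ∑ l, ‖z k l‖ ^ 2) := by
  have hpos : ∀ z : Space, 0 < ‖z‖ ^ 2 + R ^ 2 := fun z => by positivity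
  let σ : F → ℝ := fun x => Real.sqrt (‖ζ x‖ ^ 2 + R ^ 2)
  have hσ : ∀ x, 0 < σ x := fun x => Real.sqrt_pos.2 (hpos _)
  have hσ2 : ∀ x, σ x ^ 2 = ‖ζ x‖ ^ 2 + R ^ 2 := fun x => Real.sq_sqrt (hpos _).le
  have hRσ : ∀ x, R ≤ σ x := fun x => by
    refine abs_le_of_sq_le_sq' ?_ (hσ x).le |>.2
    rw [hσ2]; nlinarith [sq_nonneg ‖ζ x‖]
  have hζσ : ∀ k x, |ζ x k| ≤ σ x := fun k x => by
    refine abs_le_of_sq_le_sq ?_ (hσ x).le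
    rw [hσ2]; nlinarith [sq_apply_le (ζ x) k, sq_nonneg R]
  have hσc : Continuous σ := by fun_prop
  -- A regularized Coulomb field: its divergence 3R²/σ⁵ is a smeared delta function, at least
  -- 1/(2R³) on |ζ| ≤ R. Its components are bounded by the Hardy weight ρ = σ⁻², so after one
  -- integration by parts along `v` both resulting factors are controlled by Hardy's inequality
  -- along `v'`.
  let G : Fin 3 → F → ℝ := fun k x => ζ x k * ((σ x) ^ 3)⁻¹
  let G' : Fin 3 → F → ℝ := fun k x => ((σ x) ^ 3)⁻¹ - 3 * (ζ x k) ^ 2 * ((σ x) ^ 5)⁻¹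
  have hGρ : ∀ k x, |G k x| ≤ rho R (ζ x) := by
    intro k x
    have h1 : rho R (ζ x) = (σ x ^ 2)⁻¹ := by rw [rho, hσ2]
    rw [h1, abs_mul, abs_of_pos (inv_pos.2 (pow_pos (hσ x) 3)), ← div_eq_mul_inv,
      div_le_iff₀ (pow_pos (hσ x) 3)]
    have : (σ x ^ 2)⁻¹ * σ x ^ 3 = σ x := by have := (hσ x).ne'; field_simp
    rw [this]
    exact hζσ k x
  have hGc : ∀ k, Continuous (G k) := fun k =>
    (by fun_prop : Continuous fun x => ζ x k).mul
      ((hσc.pow 3).inv₀ fun x => (pow_pos (hσ x) 3).ne')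
  have hG : ∀ k, BddMeas (G k) := fun k => .of_continuous (hGc k) (C := (R ^ 2)⁻¹) fun x =>
    (hGρ k x).trans (rho_le hR _)
  have hG'c : ∀ k, Continuous (G' k) := fun k =>
    ((hσc.pow 3).inv₀ fun x => (pow_pos (hσ x) 3).ne').sub
      ((by fun_prop : Continuous fun x => 3 * (ζ x k) ^ 2).mul
      ((hσc.pow 5).inv₀ fun x => (pow_pos (hσ x) 5).ne'))
  have hG' : ∀ k, BddMeas (G' k) := fun k => .of_continuous (hG'c k)
    (C := (R ^ 3)⁻¹ + 3 * (R ^ 3)⁻¹) fun x => by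
      have h1 : ((σ x) ^ 3)⁻¹ ≤ (R ^ 3)⁻¹ := by
        have := hRσ x
        gcongr
      have h0 : 0 < ((σ x) ^ 3)⁻¹ := inv_pos.2 (pow_pos (hσ x) 3)
      have h2 : (ζ x k) ^ 2 * ((σ x) ^ 5)⁻¹ ≤ ((σ x) ^ 3)⁻¹ := by
        rw [← div_eq_mul_inv, div_le_iff₀ (pow_pos (hσ x) 5)]
        have : (σ x ^ 3)⁻¹ * σ x ^ 5 = σ x ^ 2 := by have := (hσ x).ne'; field_simp
        rw [this]
        exact sq_le_sq.2 ((hζσ k x).trans (le_abs_self _))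
      have h3 : 0 ≤ (ζ x k) ^ 2 * ((σ x) ^ 5)⁻¹ :=
        mul_nonneg (sq_nonneg _) (inv_pos.2 (pow_pos (hσ x) 5)).le
      simp only [G']
      rw [abs_le]
      constructor <;> nlinarith
  have hd : ∀ k x, HasDerivAt (fun t : ℝ => G k (x + t • v k)) (G' k x) 0 := by
    intro k x
    simp only [G, G', σ, hv, norm_add_smul_unitVec_sq, add_smul_unitVec_apply]
    have h1 : HasDerivAt (fun t : ℝ => ζ x k + t) 1 0 := (hasDerivAt_id 0).const_add _
    have h2 : HasDerivAt (fun t : ℝ => ‖ζ x‖ ^ 2 + 2 * t * ζ x k + t ^ 2 + R ^ 2)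
        (2 * ζ x k) 0 := by
      have := ((((hasDerivAt_id (0 : ℝ)).const_mul 2).mul_const (ζ x k)).const_add
        (‖ζ x‖ ^ 2)).add ((hasDerivAt_id (0 : ℝ)).pow 2) |>.add_const (R ^ 2)
      simpa using this
    have h3 := (h2.sqrt (by simpa using (hpos (ζ x)).ne')).pow 3
    have hs := hσ x
    have hs' : Real.sqrt (‖ζ x‖ ^ 2 + R ^ 2) = σ x := rfl
    have h4 := h1.mul (h3.fun_inv (by simpa [hs'] using hs.ne'))
    refine h4.congr_deriv ?_
    simp [hs']
    have := hs.ne'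
    field_simp
    ring
  have key : ∀ k, ∫ x, G' k x * ‖u x‖ ^ 2 ≤
      4 * (∑ l, ‖y l‖ ^ 2) + 4 * ∑ l, ‖z k l‖ ^ 2 := by
    intro k
    refine ((h k).integral_deriv_le (hG k) (hG' k) (hd k)).trans ?_
    -- Translation along `v'` moves ζ backwards, so Hardy's inequality is applied to -ζ; the weight
    -- is even.
    have hζ' : Continuous fun x => -ζ x := hζ.neg
    have hv'' : ∀ x k (t : ℝ), -ζ (x + t • v' k) = -ζ x + t • unitVec k := fun x k t => by
      rw [hv']; abel
    have e : ∀ x, rho R (-ζ x) = rho R (ζ x) := fun x => by simp [rho]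
    have i1 := hardy hR hζ' hv'' hy
    have i2 := hardy hR hζ' hv'' (hz k)
    simp only [e] at i1 i2
    have i3 : ∀ f : L2 F, ∫ x, |G k x| * ‖f x‖ ^ 2 ≤ ∫ x, rho R (ζ x) * ‖f x‖ ^ 2 := fun f =>
      integral_mono ((hG k).abs.integrable f) ((bddMeas_rho hR hζ).integrable f) fun x =>
        mul_le_mul_of_nonneg_right (hGρ k x) (sq_nonneg _)
    linarith [weighted_cauchy (hG k) u (w k), i3 u, i3 (w k)]
  have hsum := Finset.sum_le_sum fun k (_ : k ∈ Finset.univ) => key k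
  rw [Finset.sum_add_distrib, ← Finset.mul_sum, Finset.sum_const,
    ← integral_finsetSum _ (fun k _ => (hG' k).integrable u)] at hsum
  simp only [Finset.card_univ, Fintype.card_fin, nsmul_eq_mul] at hsum
  have hle : ∫ x, near R (ζ x) * ‖u x‖ ^ 2 ≤ 2 * R ^ 3 * ∫ x, ∑ k, G' k x * ‖u x‖ ^ 2 := by
    rw [← integral_const_mul]
    refine integral_mono ((bddMeas_near R hζ).integrable u)
      ((integrable_finsetSum _ fun k _ => (hG' k).integrable u).const_mul _) fun x => ?_
    simp only
    rw [← Finset.sum_mul, ← mul_assoc]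
    refine mul_le_mul_of_nonneg_right ?_ (sq_nonneg _)
    have e : ∑ k, G' k x = 3 * R ^ 2 * ((σ x) ^ 5)⁻¹ := by
      have h1 : ∑ k, G' k x = 3 * ((σ x) ^ 3)⁻¹ - 3 * ‖ζ x‖ ^ 2 * ((σ x) ^ 5)⁻¹ := by
        rw [norm_sq_eq_sum]
        simp only [G', Fin.sum_univ_three]
        ring
      have h2 : ((σ x) ^ 3)⁻¹ = σ x ^ 2 * ((σ x) ^ 5)⁻¹ := by have := (hσ x).ne'; field_simp
      rw [h1, h2, hσ2]
      ring
    rw [e]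
    unfold near
    split_ifs with hn
    · rw [← mul_assoc, ← div_eq_mul_inv, le_div_iff₀ (pow_pos (hσ x) 5), one_mul]
      have h1 : σ x ^ 2 ≤ 2 * R ^ 2 := by
        rw [hσ2]
        have : ‖ζ x‖ ^ 2 ≤ R ^ 2 := by gcongr
        linarith
      -- Rounds √2 up to 3/2, so that σ⁵ ≤ 6 R⁵ = 2R³ · 3R².
      have h2 : σ x ≤ 3 / 2 * R := by
        refine abs_le_of_sq_le_sq' ?_ (by positivity) |>.2
        nlinarith [sq_nonneg R]
      calc σ x ^ 5 = σ x ^ 2 * σ x ^ 2 * σ x := by ring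
        _ ≤ (2 * R ^ 2) * (2 * R ^ 2) * (3 / 2 * R) := by
          have := hσ x
          gcongr
        _ = 2 * R ^ 3 * (3 * R ^ 2) := by ring
    · have := hσ x
      positivity
  have hR3 : 0 < R ^ 3 := by positivity
  refine hle.trans ?_
  have hn : 0 ≤ ∑ k, ∑ l, ‖z k l‖ ^ 2 := by positivity
  have hn' : 0 ≤ ∑ l, ‖y l‖ ^ 2 := by positivity
  -- The term with `y` occurs once for each of the three directions k, which turns 4 into 12.
  have hsum' : (∫ x, ∑ k, G' k x * ‖u x‖ ^ 2) ≤
      12 * ((∑ k, ‖y k‖ ^ 2) + ∑ k, ∑ l, ‖z k l‖ ^ 2) := by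
    rw [← Finset.mul_sum Finset.univ (fun k => ∑ l, ‖z k l‖ ^ 2) 4] at hsum
    push_cast at hsum
    linarith
  calc _ ≤ 2 * R ^ 3 * (12 * ((∑ k, ‖y k‖ ^ 2) + ∑ k, ∑ l, ‖z k l‖ ^ 2)) := by gcongr
    _ = _ := by ring

end Hardy

/-! ### Splitting off one copy of ℝ³ from the configuration space. -/

section Coordinates

variable {F : Type} [NormedAddCommGroup F] [InnerProductSpace ℝ F] [FiniteDimensional ℝ F]
  [MeasurableSpace F] [BorelSpace F]

/-- `pr` is the coordinate map adjoint to the isometric embedding `e` of `ℝ³`. -/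
def IsCoord (pr : F → Space) (e : Space →ₗᵢ[ℝ] F) : Prop :=
  ∀ a ξ, inner ℝ (e a) ξ = inner ℝ a (pr ξ)

variable {pr pr' : F → Space} {e e' : Space →ₗᵢ[ℝ] F}

theorem IsCoord.pr_add (h : IsCoord pr e) (x y : F) : pr (x + y) = pr x + pr y := by
  refine ext_inner_left ℝ fun a => ?_
  rw [← h, inner_add_right, inner_add_right, h, h]

theorem IsCoord.pr_e (h : IsCoord pr e) (a : Space) : pr (e a) = a := by
  refine ext_inner_left ℝ fun b => ?_
  rw [← h, e.inner_map_map]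

theorem IsCoord.pr_smul (h : IsCoord pr e) (c : ℝ) (x : F) : pr (c • x) = c • pr x := by
  refine ext_inner_left ℝ fun a => ?_
  rw [← h, inner_smul_right, inner_smul_right, h]

theorem IsCoord.continuous (h : IsCoord pr e) : Continuous pr := by
  let L : F →ₗ[ℝ] Space := ⟨⟨pr, h.pr_add⟩, h.pr_smul⟩
  exact L.continuous_of_finiteDimensional

theorem IsCoord.mom_eq (h : IsCoord pr e) (ξ : F) (k : Fin 3) :
    mom pr ξ k = 2 * Real.pi * inner ℝ (e (unitVec k)) ξ := by
  rw [h, mom]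
  simp [EuclideanSpace.inner_single_left]

/-- The orthogonal complement of the range of `e`. -/
abbrev coComp (e : Space →ₗᵢ[ℝ] F) : Submodule ℝ F := (LinearMap.range e.toLinearMap)ᗮ

/-- The decomposition of `F` into the coordinate `pr` and the orthogonal directions. -/
def splitEquiv (e : Space →ₗᵢ[ℝ] F) : F ≃ₗᵢ[ℝ] WithLp 2 (Space × coComp e) :=
  (LinearMap.range e.toLinearMap).orthogonalDecomposition.trans
    (LinearIsometryEquiv.withLpProdCongr 2 e.equivRange.symm (LinearIsometryEquiv.refl ℝ _))

theorem splitEquiv_symm_apply (e : Space →ₗᵢ[ℝ] F) (z : WithLp 2 (Space × coComp e)) :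
    (splitEquiv e).symm z = e z.fst + z.snd := by
  simp [splitEquiv]
  rfl

/-- The measurable equivalence `(a, y) ↦ e a + y`. -/
def join (e : Space →ₗᵢ[ℝ] F) : Space × coComp e ≃ᵐ F :=
  (MeasurableEquiv.toLp 2 (Space × coComp e)).trans (splitEquiv e).symm.toMeasurableEquiv

theorem join_apply (e : Space →ₗᵢ[ℝ] F) (z : Space × coComp e) : join e z = e z.1 + z.2 :=
  splitEquiv_symm_apply e (WithLp.toLp 2 z)

theorem measurePreserving_join (e : Space →ₗᵢ[ℝ] F) : MeasurePreserving (join e) :=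
  (WithLp.volume_preserving_toLp Space (coComp e)).trans (splitEquiv e).symm.measurePreserving

theorem IsCoord.pr_join (h : IsCoord pr e) (z : Space × coComp e) : pr (join e z) = z.1 := by
  rw [join_apply, h.pr_add, h.pr_e]
  have : pr (z.2 : F) = 0 := by
    refine ext_inner_left ℝ fun a => ?_
    rw [← h, inner_zero_right]
    exact (Submodule.mem_orthogonal _ _).1 z.2.2 _ ⟨a, rfl⟩
  rw [this, add_zero]

/-- The fibres of `pr` may have infinite measure, so volume is in general not preserved; that null
sets pull back to null sets is enough for measurability and almost everywhere identities. -/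
theorem IsCoord.quasiMeasurePreserving (h : IsCoord pr e) :
    Measure.QuasiMeasurePreserving pr volume volume := by
  have h1 : pr = Prod.fst ∘ (join e).symm := by
    ext1 x
    obtain ⟨z, rfl⟩ := (join e).surjective x
    simp [h.pr_join]
  rw [h1]
  exact Measure.quasiMeasurePreserving_fst.comp
    (measurePreserving_join e).symm.quasiMeasurePreserving

theorem BddMeas.comp_pr (h : IsCoord pr e) {m : Space → ℝ} (hm : BddMeas m) :
    BddMeas (fun x => m (pr x)) :=
  ⟨hm.1.comp_quasiMeasurePreserving h.quasiMeasurePreserving, hm.2.imp fun _ hC _ => hC _⟩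

end Coordinates

/-! ### Fourier multipliers and the bounded low-momentum part of p². -/

section FourierMultiplier

variable {F : Type} [NormedAddCommGroup F] [InnerProductSpace ℝ F] [FiniteDimensional ℝ F]
  [MeasurableSpace F] [BorelSpace F]
  {pr pr' : F → Space} {e e' : Space →ₗᵢ[ℝ] F}

/-- The Fourier multiplier with a bounded symbol. -/
def fmul (m : F → ℝ) (h : BddMeas m) : L2 F →L[ℂ] L2 F :=
  (Lp.fourierTransformₗᵢ F ℂ).symm.toContinuousLinearEquiv.toContinuousLinearMap ∘L
    mulCLM m h ∘L (Lp.fourierTransformₗᵢ F ℂ).toContinuousLinearEquiv.toContinuousLinearMap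

theorem fourier_fmul {m : F → ℝ} (h : BddMeas m) (u : L2 F) :
    (𝓕 (fmul m h u) : L2 F) = mulOp m (𝓕 u) :=
  (Lp.fourierTransformₗᵢ F ℂ).apply_symm_apply _

theorem inner_fmul {m : F → ℝ} (h : BddMeas m) (v u : L2 F) :
    inner ℂ v (fmul m h u) =
      ∫ ξ, (starRingEnd ℂ) ((𝓕 v : L2 F) ξ) * (m ξ : ℂ) * (𝓕 u : L2 F) ξ := by
  rw [← Lp.inner_fourier_eq, fourier_fmul, (h.isMul _).inner_eq]

theorem norm_fmul_le {m : F → ℝ} (h : BddMeas m) {C : ℝ} (hC : ∀ x, |m x| ≤ C) (u : L2 F) :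
    ‖fmul m h u‖ ≤ C * ‖u‖ := by
  rw [← Lp.norm_fourier_eq, fourier_fmul, ← Lp.norm_fourier_eq u]
  exact norm_mulOp_le h hC _

theorem inner_fmul_comm {m : F → ℝ} (h : BddMeas m) (v u : L2 F) :
    inner ℂ (fmul m h v) u = inner ℂ v (fmul m h u) := by
  rw [← Lp.inner_fourier_eq, ← Lp.inner_fourier_eq v, fourier_fmul, fourier_fmul]
  exact (h.isMul _).inner_comm (h.isMul _)

theorem IsP.fmul {m : F → ℝ} (h : BddMeas m) {v : F} {u w : L2 F} (hp : IsP v u w) :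
    IsP v (fmul m h u) (fmul m h w) := by
  unfold IsP
  rw [fourier_fmul, fourier_fmul]
  filter_upwards [hp, h.isMul (𝓕 u : L2 F), h.isMul (𝓕 w : L2 F)] with x h1 h2 h3
  rw [← h2, ← h3, ← h1]
  ring

/-- A Fourier multiplier whose symbol is the transform of an integrable function is an average of
translations. -/
theorem inner_fmul_eq_integral_tr (hc : IsCoord pr e) {M : Space → ℝ} {g : Space → ℂ}
    (hg : Integrable g volume) (hM : ∀ η, (M η : ℂ) = ∫ a, g a * chr a η)
    (h : BddMeas fun ξ => M (pr ξ)) (v u : L2 F) :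
    inner ℂ v (fmul _ h u) = ∫ a, g a * inner ℂ v (tr (e a) u) := by
  rw [inner_fmul]
  have e1 : ∀ a, inner ℂ v (tr (e a) u) =
      ∫ ξ, (starRingEnd ℂ) ((𝓕 v : L2 F) ξ) * (chr a (pr ξ) * (𝓕 u : L2 F) ξ) := by
    intro a
    rw [← Lp.inner_fourier_eq, inner_eq_integral]
    refine integral_congr_ae ?_
    filter_upwards [fourier_tr (e a) u] with ξ hξ
    rw [hξ, chr, chr, hc]
  simp_rw [e1, hM, ← integral_const_mul, ← integral_mul_const]
  rw [integral_integral_swap]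
  · refine integral_congr_ae (Eventually.of_forall fun a => integral_congr_ae
      (Eventually.of_forall fun ξ => ?_))
    ring
  · have h1 : Integrable (fun ξ => (starRingEnd ℂ) ((𝓕 v : L2 F) ξ) * (𝓕 u : L2 F) ξ) volume := by
      refine (L2.integrable_inner (𝕜 := ℂ) (𝓕 v : L2 F) (𝓕 u)).congr
        (Eventually.of_forall fun x => by simp [RCLike.inner_apply, mul_comm])
    have h2 := h1.mul_prod hg
    have h3 : Continuous fun z : F × Space => chr z.2 (pr z.1) := by
      have := hc.continuous
      unfold chr
      fun_prop
    refine ((h2.bdd_mul (c := 1) h3.aestronglyMeasurable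
      (Eventually.of_forall fun z => (norm_chr _ _).le))).congr
      (Eventually.of_forall fun z => ?_)
    simp only [Function.uncurry]
    ring

/-- The symbol `|η|² (1 - θ(η / s))` of the low-momentum part of `p²`. -/
def lowSym (θ : Space → ℝ) (s : ℝ) (η : Space) : ℝ := ‖η‖ ^ 2 * (1 - θ (s⁻¹ • η))

theorem lowSym_nonneg {θ : Space → ℝ} (hθ : IsSmoothHeaviside θ) (s : ℝ) (η : Space) :
    0 ≤ lowSym θ s η := mul_nonneg (sq_nonneg _) (sub_nonneg.2 (hθ.le_one _))

theorem lowSym_eq_zero {θ : Space → ℝ} (hθ : IsSmoothHeaviside θ) {s : ℝ} (hs : 0 < s) {η : Space}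
    (h : 2 * s ≤ ‖η‖) : lowSym θ s η = 0 := by
  rw [lowSym, hθ.eq_one, sub_self, mul_zero]
  rw [norm_smul, norm_inv, Real.norm_of_nonneg hs.le, le_inv_mul_iff₀ hs]
  linarith

theorem abs_lowSym_le {θ : Space → ℝ} (hθ : IsSmoothHeaviside θ) {s : ℝ} (hs : 0 < s)
    (η : Space) : |lowSym θ s η| ≤ 4 * s ^ 2 := by
  rw [abs_of_nonneg (lowSym_nonneg hθ s η)]
  rcases le_total (2 * s) ‖η‖ with h | h
  · rw [lowSym_eq_zero hθ hs h]; positivity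
  · have h1 : ‖η‖ ^ 2 ≤ (2 * s) ^ 2 := by gcongr
    have h2 := hθ.nonneg (s⁻¹ • η)
    have h3 := hθ.le_one (s⁻¹ • η)
    unfold lowSym
    nlinarith [sq_nonneg ‖η‖]

theorem contDiff_lowSym {θ : Space → ℝ} (hθ : IsSmoothHeaviside θ) (s : ℝ) :
    ContDiff ℝ ∞ (lowSym θ s) := by
  unfold lowSym
  have := hθ.smooth
  exact (contDiff_norm_sq ℝ).mul (contDiff_const.sub (this.comp (contDiff_const_smul _)))

/-- The symbol is smooth with compact support, because 1 - θ vanishes at large momenta; hence it is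
a Schwartz function and `g` is its Fourier transform. The factor 2π is the one relating the
frequency to the momentum. -/
theorem exists_integrable_lowSym {θ : Space → ℝ} (hθ : IsSmoothHeaviside θ) {s : ℝ} (hs : 0 < s) :
    ∃ g : Space → ℂ, Integrable g volume ∧
      ∀ η : Space, (lowSym θ s ((2 * Real.pi) • η) : ℂ) = ∫ a, g a * chr a η := by
  have h1 : ContDiff ℝ ∞ (fun η : Space => (lowSym θ s ((2 * Real.pi) • η) : ℂ)) :=
    Complex.ofRealCLM.contDiff.comp ((contDiff_lowSym hθ s).comp (contDiff_const_smul _))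
  have h2 : HasCompactSupport (fun η : Space => (lowSym θ s ((2 * Real.pi) • η) : ℂ)) := by
    refine HasCompactSupport.of_support_subset_isCompact
      (isCompact_closedBall (0 : Space) (2 * s / (2 * Real.pi))) fun η hη => ?_
    by_contra hn
    refine hη ?_
    rw [Metric.mem_closedBall, dist_zero_right, not_le, div_lt_iff₀ (by positivity)] at hn
    beta_reduce
    rw [lowSym_eq_zero hθ hs, Complex.ofReal_zero]
    rw [norm_smul, Real.norm_of_nonneg (by positivity)]
    linarith
  let f : SchwartzMap Space ℂ := h2.toSchwartzMap h1
  refine ⟨⇑(𝓕 f : SchwartzMap Space ℂ), (𝓕 f : SchwartzMap Space ℂ).integrable, fun η => ?_⟩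
  have h3 : f η = (𝓕⁻ (𝓕 f : SchwartzMap Space ℂ) : SchwartzMap Space ℂ) η := by
    rw [FourierTransform.fourierInv_fourier_eq]
  have h4 : f η = (lowSym θ s ((2 * Real.pi) • η) : ℂ) := rfl
  rw [← h4, h3, SchwartzMap.fourierInv_coe, Real.fourierInv_eq']
  congr 1
  ext a
  rw [smul_eq_mul, mul_comm, chr]

theorem bddMeas_lowSym {θ : Space → ℝ} (hθ : IsSmoothHeaviside θ) {s : ℝ} (hs : 0 < s)
    (hc : IsCoord pr e) : BddMeas (fun ξ => lowSym θ s (mom pr ξ)) :=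
  .of_continuous ((contDiff_lowSym hθ s).continuous.comp (by
    have := hc.continuous
    unfold mom
    fun_prop)) fun x => abs_lowSym_le hθ hs _

/-- The bounded operator `p² (1 - θ_s(p))` in the variable `pr x`. -/
def lowOp {θ : Space → ℝ} (hθ : IsSmoothHeaviside θ) {s : ℝ} (hs : 0 < s)
    (hc : IsCoord pr e) : L2 F →L[ℂ] L2 F :=
  fmul _ (bddMeas_lowSym hθ hs hc)

/-- The same `g` serves for every space and every coordinate. This uniformity makes the operator
compatible with all maps that intertwine translations. -/
theorem exists_lowOp_eq {θ : Space → ℝ} (hθ : IsSmoothHeaviside θ) {s : ℝ} (hs : 0 < s) :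
    ∃ g : Space → ℂ, Integrable g volume ∧
      ∀ {F : Type} [NormedAddCommGroup F] [InnerProductSpace ℝ F] [FiniteDimensional ℝ F]
        [MeasurableSpace F] [BorelSpace F] {pr : F → Space} {e : Space →ₗᵢ[ℝ] F}
        (hc : IsCoord pr e) (v u : L2 F),
        inner ℂ v (lowOp hθ hs hc u) = ∫ a, g a * inner ℂ v (tr (e a) u) := by
  obtain ⟨g, hg, hM⟩ := exists_integrable_lowSym hθ hs
  exact ⟨g, hg, fun hc v u =>
    inner_fmul_eq_integral_tr hc (M := fun η => lowSym θ s ((2 * Real.pi) • η)) hg hM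
      (bddMeas_lowSym hθ hs hc) v u⟩

end FourierMultiplier

/-! ### Operators that intertwine two coordinates. -/

section Intertwine

variable {F : Type} [NormedAddCommGroup F] [InnerProductSpace ℝ F] [FiniteDimensional ℝ F]
  [MeasurableSpace F] [BorelSpace F]
  {F' : Type} [NormedAddCommGroup F'] [InnerProductSpace ℝ F'] [FiniteDimensional ℝ F']
  [MeasurableSpace F'] [BorelSpace F']
  {pr : F → Space} {e : Space →ₗᵢ[ℝ] F} {pr' : F' → Space} {e' : Space →ₗᵢ[ℝ] F'}

/-- `B` intertwines the translations and the multiplication operators of two coordinates. -/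
structure Intertwines (pr : F → Space) (e : Space →ₗᵢ[ℝ] F) (pr' : F' → Space)
    (e' : Space →ₗᵢ[ℝ] F') (B : L2 F →L[ℂ] L2 F') : Prop where
  map_tr : ∀ a u, B (tr (e a) u) = tr (e' a) (B u)
  map_mul : ∀ m : Space → ℝ, BddMeas m → ∀ u,
    B (mulOp (fun x => m (pr x)) u) = mulOp (fun x => m (pr' x)) (B u)

variable {B : L2 F →L[ℂ] L2 F'}

theorem Intertwines.isP (h : Intertwines pr e pr' e' B) {a : Space} {u w : L2 F}
    (hp : IsP (e a) u w) : IsP (e' a) (B u) (B w) :=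
  hp.map B fun t u => by rw [← map_smul, ← map_smul, h.map_tr]

theorem Intertwines.isMul (h : Intertwines pr e pr' e' B) (hc : IsCoord pr e)
    (hc' : IsCoord pr' e') {m : Space → ℝ} (hm : AEStronglyMeasurable m volume) {u w : L2 F}
    (hp : IsMul (fun x => m (pr x)) u w) : IsMul (fun x => m (pr' x)) (B u) (B w) := by
  refine IsMul.of_tendsto_trunc (hm.comp_quasiMeasurePreserving hc'.quasiMeasurePreserving) ?_
  have := (B.continuous.tendsto _).comp
    (tendsto_mulOp_trunc (hm.comp_quasiMeasurePreserving hc.quasiMeasurePreserving) hp)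
  refine this.congr fun n => ?_
  exact h.map_mul (trunc m n) (bddMeas_trunc hm n) u

/-- Both operators are averages of translations with the same weight `g`, and `B` intertwines the
translations. -/
theorem Intertwines.lowOp_comm (h : Intertwines pr e pr' e' B) (hc : IsCoord pr e)
    (hc' : IsCoord pr' e') {θ : Space → ℝ} (hθ : IsSmoothHeaviside θ) {s : ℝ} (hs : 0 < s)
    (u : L2 F) : B (lowOp hθ hs hc u) = lowOp hθ hs hc' (B u) := by
  obtain ⟨g, -, hK⟩ := exists_lowOp_eq hθ hs
  refine ext_inner_left ℂ fun v => ?_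
  rw [hK, ← ContinuousLinearMap.adjoint_inner_left, hK]
  congr 1
  ext a
  rw [ContinuousLinearMap.adjoint_inner_left, h.map_tr]

end Intertwine

/-! ### The Lax–Milgram theorem. -/

section LaxMilgram

/-- The Lax–Milgram theorem on a closed subspace. -/
theorem exists_laxMilgram {G : Type*} [NormedAddCommGroup G] [InnerProductSpace ℂ G]
    [CompleteSpace G] (W : Submodule ℂ G) (hW : IsClosed (W : Set G)) (T : G →L[ℂ] G) {c : ℝ}
    (hc : 0 < c) (h : ∀ g ∈ W, c * ‖g‖ ^ 2 ≤ (inner ℂ g (T g)).re) :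
    ∃ S : G →L[ℂ] G, ∀ f, S f ∈ W ∧ ∀ v ∈ W, inner ℂ v (T (S f)) = inner ℂ v f := by
  have : CompleteSpace W := hW.completeSpace_coe
  -- The compression of `T` to `W` is invertible by coercivity; its inverse is then extended by zero
  -- on the orthogonal complement.
  let T' : W →L[ℂ] W := W.orthogonalProjectionOnto ∘L T ∘L W.subtypeL
  have hT' : ∀ v u : W, inner ℂ v (T' u) = inner ℂ (v : G) (T u) := fun v u => by
    simp only [T', ContinuousLinearMap.comp_apply, Submodule.subtypeL_apply]
    rw [← Submodule.inner_orthogonalProjectionOnto_eq_of_mem_left]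
  have hu : IsUnit T' := by
    refine ContinuousLinearMap.isUnit_of_forall_le_norm_inner_map T' (c := ⟨c, hc.le⟩) hc
      fun x => ?_
    rw [← inner_conj_symm, RCLike.norm_conj, hT']
    calc ‖x‖ ^ 2 * c = c * ‖(x : G)‖ ^ 2 := by rw [mul_comm]; rfl
      _ ≤ _ := (h x x.2).trans ((le_abs_self _).trans (Complex.abs_re_le_norm _))
  obtain ⟨t, ht⟩ := hu
  refine ⟨W.subtypeL ∘L (↑t⁻¹ : W →L[ℂ] W) ∘L W.orthogonalProjectionOnto, fun f => ⟨?_, ?_⟩⟩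
  · simp
  · intro v hv
    have h1 := hT' ⟨v, hv⟩ ((↑t⁻¹ : W →L[ℂ] W) (W.orthogonalProjectionOnto f))
    have h2 : T' ((↑t⁻¹ : W →L[ℂ] W) (W.orthogonalProjectionOnto f)) =
        W.orthogonalProjectionOnto f := by
      rw [← ht, ← mul_apply_eq_comp, Units.mul_inv]
      rfl
    rw [h2] at h1
    simp only [ContinuousLinearMap.comp_apply, Submodule.subtypeL_apply]
    rw [← h1]
    exact Submodule.inner_orthogonalProjectionOnto_eq_of_mem_left (⟨v, hv⟩ : W) f

end LaxMilgram

/-- A coordinate `ℝ³` of the space `F`. -/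
structure Coord (F : Type) [NormedAddCommGroup F] [InnerProductSpace ℝ F] where
  /-- The coordinate map. -/
  pr : F → Space
  /-- The embedding of `ℝ³` adjoint to the coordinate map. -/
  e : Space →ₗᵢ[ℝ] F
  isCoord : IsCoord pr e

/-- The data defining the one-body operator. -/
structure Params where
  A : Space → Space
  V : Space → ℝ
  θ : Space → ℝ
  ε : ℝ
  s : ℝ
  measA : ∀ k, AEStronglyMeasurable (fun x => A x k) volume
  measV : AEStronglyMeasurable V volume
  V_nonneg : ∀ x, 0 ≤ V x
  heav : IsSmoothHeaviside θ
  s_pos : 0 < s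
  ε_pos : 0 < ε
  ε_lt : ε < 1

/-! ### The one-body form in terms of p, A and √V, and its resolvent. -/

section Forms

variable {F : Type} [NormedAddCommGroup F] [InnerProductSpace ℝ F] [FiniteDimensional ℝ F]
  [MeasurableSpace F] [BorelSpace F]
  {F' : Type} [NormedAddCommGroup F'] [InnerProductSpace ℝ F'] [FiniteDimensional ℝ F']
  [MeasurableSpace F'] [BorelSpace F'] (P : Params) (c : Coord F) (c' : Coord F')

/-- The index set of the operators `p_k`, `A_k` and `√V` of which the form is made. -/
abbrev CompIdx : Type := Fin 3 ⊕ Fin 3 ⊕ Unit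

/-- `w` is the image of `u` under one of the operators `p_k`, `A_k`, `√V`. -/
def IsComp : CompIdx → L2 F → L2 F → Prop
  | Sum.inl k => IsP (c.e (unitVec k))
  | Sum.inr (Sum.inl k) => IsMul (fun x => P.A (c.pr x) k)
  | Sum.inr (Sum.inr _) => IsMul (fun x => Real.sqrt (P.V (c.pr x)))

/-- The operators `p_k`, `A_k`, `√V`. -/
def comp : CompIdx → L2 F → L2 F
  | Sum.inl k => momOp c.pr k
  | Sum.inr (Sum.inl k) => mulOp (fun x => P.A (c.pr x) k)
  | Sum.inr (Sum.inr _) => mulOp (fun x => Real.sqrt (P.V (c.pr x)))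

variable {P c c'}

theorem IsComp.comp_eq {j : CompIdx} {u w : L2 F} (h : IsComp P c j u w) : comp P c j u = w := by
  rcases j with k | k | k
  · change 𝓕⁻ (mulOp _ _) = w
    have h1 : IsMul (fun ξ => mom c.pr ξ k) (𝓕 u) (𝓕 w) :=
      IsMul.congr_fun h fun ξ => (c.isCoord.mom_eq ξ k).symm
    rw [h1.mulOp_eq, FourierTransform.fourierInv_fourier_eq]
  · exact IsMul.mulOp_eq h
  · exact IsMul.mulOp_eq h

theorem mem_formDomain_iff {u : L2 F} :
    u ∈ formDomain P.A P.V c.pr ↔ ∀ j, IsComp P c j u (comp P c j u) := by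
  constructor
  · rintro ⟨h1, h2, h3⟩ (k | k | k)
    · have h4 := isMul_mulOp (h1 k)
      change IsMul _ _ _
      have h5 : (𝓕 (comp P c (Sum.inl k) u) : L2 F) = mulOp (fun ξ => mom c.pr ξ k) (𝓕 u) :=
        FourierTransform.fourier_fourierInv_eq _
      rw [h5]
      exact h4.congr_fun (c.isCoord.mom_eq · k)
    · exact isMul_mulOp (h2 k)
    · exact isMul_mulOp h3
  · intro h
    refine ⟨fun k => ?_, fun k => IsMul.memLp (h (Sum.inr (Sum.inl k))),
      IsMul.memLp (h (Sum.inr (Sum.inr ())))⟩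
    exact IsMul.memLp (IsMul.congr_fun (h (Sum.inl k)) fun ξ => (c.isCoord.mom_eq ξ k).symm)

theorem mem_formDomain_of_isComp {u : L2 F} (w : CompIdx → L2 F) (h : ∀ j, IsComp P c j u (w j)) :
    u ∈ formDomain P.A P.V c.pr :=
  mem_formDomain_iff.2 fun j => by rw [(h j).comp_eq]; exact h j

theorem IsComp.add {j : CompIdx} {u w u' w' : L2 F} (h : IsComp P c j u w)
    (h' : IsComp P c j u' w') : IsComp P c j (u + u') (w + w') := by
  rcases j with k | k | k
  · exact IsP.add h h'
  · exact IsMul.add h h'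
  · exact IsMul.add h h'

theorem IsComp.smul {j : CompIdx} {u w : L2 F} (h : IsComp P c j u w) (z : ℂ) :
    IsComp P c j (z • u) (z • w) := by
  rcases j with k | k | k
  · exact IsP.smul h z
  · exact IsMul.smul h z
  · exact IsMul.smul h z

theorem IsComp.zero (j : CompIdx) : IsComp P c j (0 : L2 F) 0 := by
  rcases j with k | k | k
  · exact IsP.zero _
  · exact IsMul.zero _
  · exact IsMul.zero _

theorem IsComp.of_tendsto {j : CompIdx} {u w : ℕ → L2 F} {u' w' : L2 F}
    (h : ∀ n, IsComp P c j (u n) (w n)) (hu : Tendsto u atTop (𝓝 u'))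
    (hw : Tendsto w atTop (𝓝 w')) : IsComp P c j u' w' := by
  rcases j with k | k | k
  · exact IsP.of_tendsto h hu hw
  · exact IsMul.of_tendsto h hu hw
  · exact IsMul.of_tendsto h hu hw

theorem IsComp.map {B : L2 F →L[ℂ] L2 F'} (hB : Intertwines c.pr c.e c'.pr c'.e B) {j : CompIdx}
    {u w : L2 F} (h : IsComp P c j u w) : IsComp P c' j (B u) (B w) := by
  rcases j with k | k | k
  · exact hB.isP h
  · exact hB.isMul c.isCoord c'.isCoord (P.measA k) h
  · exact hB.isMul c.isCoord c'.isCoord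
      (Real.continuous_sqrt.comp_aestronglyMeasurable P.measV) h

variable (P c) in
/-- The form domain as a subspace. -/
def dom : Submodule ℂ (L2 F) where
  carrier := formDomain P.A P.V c.pr
  zero_mem' := mem_formDomain_of_isComp (fun _ => 0) IsComp.zero
  add_mem' hu hv := mem_formDomain_of_isComp _
    fun j => (mem_formDomain_iff.1 hu j).add (mem_formDomain_iff.1 hv j)
  smul_mem' z _ hu := mem_formDomain_of_isComp _ fun j => (mem_formDomain_iff.1 hu j).smul z

theorem isComp_of_mem {u : L2 F} (h : u ∈ dom P c) (j : CompIdx) :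
    IsComp P c j u (comp P c j u) := mem_formDomain_iff.1 h j

theorem comp_add {u v : L2 F} (hu : u ∈ dom P c) (hv : v ∈ dom P c) (j : CompIdx) :
    comp P c j (u + v) = comp P c j u + comp P c j v :=
  ((isComp_of_mem hu j).add (isComp_of_mem hv j)).comp_eq

theorem comp_smul {u : L2 F} (hu : u ∈ dom P c) (z : ℂ) (j : CompIdx) :
    comp P c j (z • u) = z • comp P c j u :=
  ((isComp_of_mem hu j).smul z).comp_eq

theorem mem_dom_map {B : L2 F →L[ℂ] L2 F'} (hB : Intertwines c.pr c.e c'.pr c'.e B) {u : L2 F}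
    (hu : u ∈ dom P c) : B u ∈ dom P c' :=
  mem_formDomain_of_isComp _ fun j => (isComp_of_mem hu j).map hB

theorem comp_map {B : L2 F →L[ℂ] L2 F'} (hB : Intertwines c.pr c.e c'.pr c'.e B) {u : L2 F}
    (hu : u ∈ dom P c) (j : CompIdx) : comp P c' j (B u) = B (comp P c j u) :=
  ((isComp_of_mem hu j).map hB).comp_eq

variable (P c) in
/-- The operator `p² (1 - θ_s(p))` in the coordinate `c`. -/
def kOp : L2 F →L[ℂ] L2 F := lowOp P.heav P.s_pos c.isCoord

theorem kOp_comm (v u : L2 F) : inner ℂ (kOp P c v) u = inner ℂ v (kOp P c u) :=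
  inner_fmul_comm _ v u

theorem norm_kOp_le (u : L2 F) : ‖kOp P c u‖ ≤ 4 * P.s ^ 2 * ‖u‖ :=
  norm_fmul_le _ (fun _ => abs_lowSym_le P.heav P.s_pos _) u

theorem kOp_map {B : L2 F →L[ℂ] L2 F'} (hB : Intertwines c.pr c.e c'.pr c'.e B) (u : L2 F) :
    kOp P c' (B u) = B (kOp P c u) := (hB.lowOp_comm c.isCoord c'.isCoord P.heav P.s_pos u).symm

variable (P c) in
/-- The form of `h - (1 - ε) p² θ_s(p)` in the coordinate `c`. -/
def qLow (v u : L2 F) : ℂ := lowForm P.A P.V P.θ P.ε P.s c.pr v u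

/-- On the form domain p² θ_s(p) = p² - p² (1 - θ_s(p)), and the subtracted operator is bounded. The
only unbounded contribution of the cut-off is therefore a multiple of p². -/
theorem highForm_eq {v u : L2 F} (hv : v ∈ dom P c) (hu : u ∈ dom P c) :
    highForm P.θ P.s c.pr v u =
      (∑ k, inner ℂ (comp P c (Sum.inl k) v) (comp P c (Sum.inl k) u)) -
        inner ℂ v (kOp P c u) := by
  have h1 : ∀ k, inner ℂ (comp P c (Sum.inl k) v) (comp P c (Sum.inl k) u) =
      ∫ ξ, (starRingEnd ℂ) ((𝓕 v : L2 F) ξ) * ((mom c.pr ξ k ^ 2 : ℝ) : ℂ) * (𝓕 u : L2 F) ξ := by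
    intro k
    rw [← Lp.inner_fourier_eq, inner_eq_integral]
    refine integral_congr_ae ?_
    have a1 : IsMul _ _ _ := isComp_of_mem hv (Sum.inl k)
    have a2 : IsMul _ _ _ := isComp_of_mem hu (Sum.inl k)
    filter_upwards [a1, a2] with ξ h1 h2
    rw [← h1, ← h2, c.isCoord.mom_eq, map_mul, Complex.conj_ofReal]
    push_cast
    ring
  have hi : ∀ k, Integrable (fun ξ => (starRingEnd ℂ) ((𝓕 v : L2 F) ξ) *
      ((mom c.pr ξ k ^ 2 : ℝ) : ℂ) * (𝓕 u : L2 F) ξ) volume := by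
    intro k
    refine (L2.integrable_inner (𝕜 := ℂ) (𝓕 (comp P c (Sum.inl k) v) : L2 F)
      (𝓕 (comp P c (Sum.inl k) u))).congr ?_
    have a1 : IsMul _ _ _ := isComp_of_mem hv (Sum.inl k)
    have a2 : IsMul _ _ _ := isComp_of_mem hu (Sum.inl k)
    filter_upwards [a1, a2] with ξ h1 h2
    rw [← h1, ← h2, c.isCoord.mom_eq, RCLike.inner_apply, map_mul, Complex.conj_ofReal]
    push_cast
    ring
  have hm := bddMeas_lowSym P.heav P.s_pos c.isCoord
  have hi' : Integrable (fun ξ => (starRingEnd ℂ) ((𝓕 v : L2 F) ξ) *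
      (lowSym P.θ P.s (mom c.pr ξ) : ℂ) * (𝓕 u : L2 F) ξ) volume := by
    refine (L2.integrable_inner (𝕜 := ℂ) (𝓕 v : L2 F)
      (mulOp (fun ξ => lowSym P.θ P.s (mom c.pr ξ)) (𝓕 u : L2 F))).congr ?_
    filter_upwards [hm.isMul (𝓕 u : L2 F)] with ξ h1
    rw [← h1]
    simp [RCLike.inner_apply]
    ring
  have h2 : inner ℂ v (kOp P c u) = ∫ ξ, (starRingEnd ℂ) ((𝓕 v : L2 F) ξ) *
      (lowSym P.θ P.s (mom c.pr ξ) : ℂ) * (𝓕 u : L2 F) ξ := inner_fmul _ v u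
  simp_rw [h1]
  rw [h2, ← integral_finsetSum _ fun k _ => hi k, ← integral_sub
    (integrable_finsetSum _ fun k _ => hi k) hi', highForm]
  congr 1
  ext ξ
  have e1 : ‖mom c.pr ξ‖ ^ 2 * P.θ (P.s⁻¹ • mom c.pr ξ) =
      (∑ k, mom c.pr ξ k ^ 2) - lowSym P.θ P.s (mom c.pr ξ) := by
    rw [lowSym, ← norm_sq_eq_sum]; ring
  rw [e1]
  push_cast
  rw [← Finset.sum_mul, ← Finset.mul_sum]
  ring

/-- The working form of the definition: ε p², the cross terms with `A`, |A|², V and a bounded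
operator. Linearity, symmetry, transport and coercivity are all read off from this finite sum of
inner products. -/
theorem qLow_eq {v u : L2 F} (hv : v ∈ dom P c) (hu : u ∈ dom P c) :
    qLow P c v u =
      (∑ k, ((P.ε : ℂ) * inner ℂ (comp P c (Sum.inl k) v) (comp P c (Sum.inl k) u) +
        inner ℂ (comp P c (Sum.inl k) v) (comp P c (Sum.inr (Sum.inl k)) u) +
        inner ℂ (comp P c (Sum.inr (Sum.inl k)) v) (comp P c (Sum.inl k) u) +
        inner ℂ (comp P c (Sum.inr (Sum.inl k)) v) (comp P c (Sum.inr (Sum.inl k)) u))) +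
      inner ℂ (comp P c (Sum.inr (Sum.inr ())) v) (comp P c (Sum.inr (Sum.inr ())) u) +
      ((1 - P.ε : ℝ) : ℂ) * inner ℂ v (kOp P c u) := by
  have h1 : ∫ x, (starRingEnd ℂ) (v x) * (P.V (c.pr x) : ℂ) * u x =
      inner ℂ (comp P c (Sum.inr (Sum.inr ())) v) (comp P c (Sum.inr (Sum.inr ())) u) := by
    rw [inner_eq_integral]
    refine integral_congr_ae ?_
    have a1 : IsMul _ _ _ := isComp_of_mem hv (Sum.inr (Sum.inr ()))
    have a2 : IsMul _ _ _ := isComp_of_mem hu (Sum.inr (Sum.inr ()))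
    filter_upwards [a1, a2] with x h1 h2
    rw [← h1, ← h2]
    have : (P.V (c.pr x) : ℂ) = (Real.sqrt (P.V (c.pr x)) : ℂ) * Real.sqrt (P.V (c.pr x)) := by
      rw [← Complex.ofReal_mul, Real.mul_self_sqrt (P.V_nonneg _)]
    rw [this]
    simp
    ring
  rw [qLow, lowForm, hForm, h1, highForm_eq hv hu]
  have h2 : ∀ k, inner ℂ (momOp c.pr k v + mulOp (fun x => P.A (c.pr x) k) v)
      (momOp c.pr k u + mulOp (fun x => P.A (c.pr x) k) u) =
        inner ℂ (comp P c (Sum.inl k) v) (comp P c (Sum.inl k) u) +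
        inner ℂ (comp P c (Sum.inl k) v) (comp P c (Sum.inr (Sum.inl k)) u) +
        inner ℂ (comp P c (Sum.inr (Sum.inl k)) v) (comp P c (Sum.inl k) u) +
        inner ℂ (comp P c (Sum.inr (Sum.inl k)) v) (comp P c (Sum.inr (Sum.inl k)) u) := by
    intro k
    rw [inner_add_left, inner_add_right, inner_add_right]
    simp only [comp]
    ring
  simp_rw [h2, Fin.sum_univ_three]
  push_cast
  ring

/-- The form transforms under intertwining operators. -/
theorem qLow_map {B : L2 F →L[ℂ] L2 F'} (hB : Intertwines c.pr c.e c'.pr c'.e B)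
    (hB' : Intertwines c'.pr c'.e c.pr c.e (ContinuousLinearMap.adjoint B)) {v : L2 F'} {u : L2 F}
    (hv : v ∈ dom P c') (hu : u ∈ dom P c) :
    qLow P c' v (B u) = qLow P c (ContinuousLinearMap.adjoint B v) u := by
  rw [qLow_eq hv (mem_dom_map hB hu), qLow_eq (mem_dom_map hB' hv) hu]
  simp only [comp_map hB hu, comp_map hB' hv, kOp_map hB, ContinuousLinearMap.adjoint_inner_left]

theorem qLow_add_right {v u u' : L2 F} (hv : v ∈ dom P c) (hu : u ∈ dom P c)
    (hu' : u' ∈ dom P c) : qLow P c v (u + u') = qLow P c v u + qLow P c v u' := by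
  rw [qLow_eq hv hu, qLow_eq hv hu', qLow_eq hv (add_mem hu hu')]
  simp only [comp_add hu hu', inner_add_right, map_add, Fin.sum_univ_three]
  ring

theorem qLow_smul_right {v u : L2 F} (hv : v ∈ dom P c) (hu : u ∈ dom P c) (z : ℂ) :
    qLow P c v (z • u) = z * qLow P c v u := by
  rw [qLow_eq hv hu, qLow_eq hv (Submodule.smul_mem _ z hu)]
  simp only [comp_smul hu, inner_smul_right, map_smul, Fin.sum_univ_three]
  ring

theorem qLow_conj {v u : L2 F} (hv : v ∈ dom P c) (hu : u ∈ dom P c) :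
    (starRingEnd ℂ) (qLow P c v u) = qLow P c u v := by
  rw [qLow_eq hv hu, qLow_eq hu hv]
  simp only [map_add, map_mul, inner_conj_symm, Complex.conj_ofReal, kOp_comm,
    Fin.sum_univ_three]
  ring

/-- The squared graph norm of all the operators of which the form is made. -/
def graphSq (P : Params) (c : Coord F) (u : L2 F) : ℝ := ‖u‖ ^ 2 + ∑ j, ‖comp P c j u‖ ^ 2

/-- The graph space consists of vectors with the components `u`, `p_k u`, `A_k u`, `√V u`. -/
abbrev GraphL2 (F : Type) [NormedAddCommGroup F] [InnerProductSpace ℝ F] [FiniteDimensional ℝ F]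
    [MeasurableSpace F] [BorelSpace F] : Type := PiLp 2 (fun _ : Option CompIdx => L2 F)

/-- The components of a vector of the graph space. -/
def gproj (i : Option CompIdx) : GraphL2 F →L[ℂ] L2 F :=
  PiLp.proj (𝕜 := ℂ) 2 (fun _ : Option CompIdx => L2 F) i

/-- The bounded operator representing the form on the graph space. -/
def graphOp (P : Params) (c : Coord F) (μ : ℝ) :
    GraphL2 F →L[ℂ] GraphL2 F :=
  (PiLp.continuousLinearEquiv 2 ℂ (fun _ : Option CompIdx => L2 F)).symm.toContinuousLinearMap ∘L
    ContinuousLinearMap.pi fun i => match i with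
      | none => (((1 - P.ε : ℝ) : ℂ) • kOp P c + (μ : ℂ) • ContinuousLinearMap.id ℂ (L2 F)) ∘L
          gproj none
      | some (Sum.inl k) => (P.ε : ℂ) • gproj (some (Sum.inl k)) +
          gproj (some (Sum.inr (Sum.inl k)))
      | some (Sum.inr (Sum.inl k)) => gproj (some (Sum.inl k)) +
          gproj (some (Sum.inr (Sum.inl k)))
      | some (Sum.inr (Sum.inr k)) => gproj (some (Sum.inr (Sum.inr k)))

variable (P c) in
/-- The graph space of the form domain. -/
def graphSpace : Submodule ℂ (GraphL2 F) where
  carrier := {g | ∀ j, IsComp P c j (g none) (g (some j))}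
  zero_mem' _ := IsComp.zero _
  add_mem' hg hg' j := (hg j).add (hg' j)
  smul_mem' z _ hg j := (hg j).smul z

theorem isClosed_graphSpace : IsClosed (graphSpace P c : Set (GraphL2 F)) := by
  refine IsSeqClosed.isClosed fun g g' hg hgg j => ?_
  have hcont : ∀ i, Tendsto (fun n => (g n) i) atTop (𝓝 (g' i)) := fun i =>
    ((gproj i).continuous.tendsto g').comp hgg
  exact IsComp.of_tendsto (fun n => hg n j) (hcont none) (hcont (some j))

/-- The point of the graph space over `u`. -/
def graphPt (P : Params) (c : Coord F) (u : L2 F) : GraphL2 F :=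
  WithLp.toLp 2 fun i => match i with
    | none => u
    | some j => comp P c j u

theorem graphPt_mem {u : L2 F} (hu : u ∈ dom P c) : graphPt P c u ∈ graphSpace P c :=
  fun j => isComp_of_mem hu j

theorem eq_graphPt {g : GraphL2 F} (hg : g ∈ graphSpace P c) :
    g none ∈ dom P c ∧ g = graphPt P c (g none) := by
  refine ⟨mem_formDomain_of_isComp _ hg, ?_⟩
  ext i : 1
  rcases i with _ | j
  · rfl
  · exact (hg j).comp_eq.symm

theorem norm_graphPt_sq (u : L2 F) : ‖graphPt P c u‖ ^ 2 = graphSq P c u := by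
  rw [PiLp.norm_sq_eq_of_L2, Fintype.sum_option]
  rfl

theorem inner_graphOp {v u : L2 F} (hv : v ∈ dom P c) (hu : u ∈ dom P c) (μ : ℝ) :
    inner ℂ (graphPt P c v) (graphOp P c μ (graphPt P c u)) =
      qLow P c v u + μ * inner ℂ v u := by
  rw [qLow_eq hv hu, PiLp.inner_apply, Fintype.sum_option, Fintype.sum_sum_type,
    Fintype.sum_sum_type]
  have e0 : graphOp P c μ (graphPt P c u) none =
      ((1 - P.ε : ℝ) : ℂ) • kOp P c u + (μ : ℂ) • u := rfl
  have e1 : ∀ k, graphOp P c μ (graphPt P c u) (some (Sum.inl k)) =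
      (P.ε : ℂ) • comp P c (Sum.inl k) u + comp P c (Sum.inr (Sum.inl k)) u := fun _ => rfl
  have e2 : ∀ k, graphOp P c μ (graphPt P c u) (some (Sum.inr (Sum.inl k))) =
      comp P c (Sum.inl k) u + comp P c (Sum.inr (Sum.inl k)) u := fun _ => rfl
  have e3 : ∀ k, graphOp P c μ (graphPt P c u) (some (Sum.inr (Sum.inr k))) =
      comp P c (Sum.inr (Sum.inr k)) u := fun _ => rfl
  have e4 : graphPt P c v none = v := rfl
  have e5 : ∀ j, graphPt P c v (some j) = comp P c j v := fun _ => rfl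
  simp only [e0, e1, e2, e3, e4, e5, inner_add_right, inner_smul_right, Fin.sum_univ_three,
    Finset.univ_unique, Finset.sum_singleton, PUnit.default_eq_unit]
  ring

/-- The inverse of `qLow + μ` when this form is coercive. -/
theorem exists_resolvent {μ d : ℝ} (hd : 0 < d)
    (h : ∀ u ∈ dom P c, d * graphSq P c u ≤ (qLow P c u u).re + μ * ‖u‖ ^ 2) :
    ∃ S : L2 F →L[ℂ] L2 F, ∀ f, S f ∈ dom P c ∧
      ∀ v ∈ dom P c, qLow P c v (S f) + μ * inner ℂ v (S f) = inner ℂ v f := by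
  -- The form is bounded on the graph space, which is closed because p, A and √V are closed
  -- operators. The right-hand side `f` enters only through the component `none`, which is what `J`
  -- below encodes.
  obtain ⟨S, hS⟩ := exists_laxMilgram (graphSpace P c) isClosed_graphSpace (graphOp P c μ) hd
    (by
      intro g hg
      obtain ⟨h1, h2⟩ := eq_graphPt hg
      rw [h2, norm_graphPt_sq, inner_graphOp h1 h1]
      refine (h _ h1).trans (le_of_eq ?_)
      rw [Complex.add_re, inner_self_eq_norm_sq_to_K, Complex.re_ofReal_mul]
      norm_cast)
  let J : L2 F →L[ℂ] GraphL2 F :=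
    (PiLp.continuousLinearEquiv 2 ℂ (fun _ : Option CompIdx => L2 F)).symm.toContinuousLinearMap ∘L
      ContinuousLinearMap.single ℂ (fun _ : Option CompIdx => L2 F) none
  refine ⟨gproj none ∘L S ∘L J, fun f => ?_⟩
  obtain ⟨h1, h2⟩ := hS (J f)
  obtain ⟨h3, h4⟩ := eq_graphPt h1
  refine ⟨h3, fun v hv => ?_⟩
  have h5 := h2 _ (graphPt_mem hv)
  rw [h4, inner_graphOp hv h3] at h5
  refine h5.trans ?_
  rw [PiLp.inner_apply, Fintype.sum_option]
  have : ∀ j : CompIdx, (J f) (some j) = 0 := fun j => by simp [J]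
  simp only [this, inner_zero_right, Finset.sum_const_zero, add_zero]
  simp [J, graphPt]

end Forms

/-! ### The Sobolev embedding H¹ ⊂ L⁶, localized. -/

section Sobolev

open scoped SchwartzMap LineDeriv NNReal

theorem opNorm_le_sum (L : Space →L[ℝ] ℂ) : ‖L‖ ≤ ∑ k, ‖L (unitVec k)‖ := by
  refine L.opNorm_le_bound (Finset.sum_nonneg fun _ _ => norm_nonneg _) fun x => ?_
  have hx : x = ∑ k, x k • unitVec k := by
    ext i
    simp [unitVec, Finset.sum_apply, Pi.single_apply]
  conv_lhs => rw [hx]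
  rw [map_sum, Finset.sum_mul]
  refine (norm_sum_le _ _).trans (Finset.sum_le_sum fun k _ => ?_)
  rw [map_smul, norm_smul, mul_comm]
  gcongr
  exact abs_apply_le x k

/-- The Sobolev inequality for Schwartz functions, localized by a bump function. -/
theorem exists_sobolev_schwartz {χ : Space → ℝ} (hχ : ContDiff ℝ ∞ χ) (hc : HasCompactSupport χ) :
    ∃ C : ℝ≥0, ∀ f : 𝓢(Space, ℂ), eLpNorm (fun x => (χ x : ℂ) * f x) 6 volume ≤
      C * (eLpNorm f 2 volume + ∑ k, eLpNorm (⇑(∂_{unitVec k} f : 𝓢(Space, ℂ))) 2 volume) := by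
  obtain ⟨K1, hK1⟩ := hχ.continuous.bounded_above_of_compact_support hc
  obtain ⟨K2, hK2⟩ := (hχ.continuous_fderiv (by simp)).bounded_above_of_compact_support
    (hc.fderiv (𝕜 := ℝ))
  let K : ℝ≥0 := ⟨|K1| + |K2|, by positivity⟩
  let C0 := SNormLESNormFDerivOfEqConst ℂ (volume : Measure Space) 2
  refine ⟨C0 * K, fun f => ?_⟩
  have hf : ContDiff ℝ ∞ f := f.smooth'
  have e1 : (fun x => (χ x : ℂ) * f x) = fun x => χ x • f x := by ext x; simp
  have hd : ContDiff ℝ 1 (fun x => χ x • f x) := (hχ.smul hf).of_le (by simp)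
  have h1 := eLpNorm_le_eLpNorm_fderiv_of_eq (μ := (volume : Measure Space)) (F := ℂ)
    (u := fun x => χ x • f x) hd (hc.smul_right) (p := 2) (p' := 6) (by norm_num) (by simp)
    (by simp; norm_num)
  rw [e1]
  refine h1.trans ?_
  rw [ENNReal.coe_mul, mul_assoc]
  refine mul_le_mul' le_rfl ?_
  have h2 : ∀ x, ‖fderiv ℝ (fun x => χ x • f x) x‖ ≤
      ‖(K : ℝ) * (‖f x‖ + ∑ k, ‖(∂_{unitVec k} f : 𝓢(Space, ℂ)) x‖)‖ := by
    intro x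
    have a1 := opNorm_le_sum (fderiv ℝ f x)
    rw [fderiv_fun_smul (hχ.differentiable (by simp) x) (hf.differentiable (by simp) x)]
    refine le_trans ?_ (le_abs_self _)
    refine (norm_add_le _ _).trans ?_
    rw [norm_smul, ContinuousLinearMap.norm_smulRight_apply]
    have a2 : ‖χ x‖ ≤ K := (hK1 x).trans ((le_abs_self _).trans (by simp [K]; exact le_add_of_nonneg_right (abs_nonneg _)))
    have a3 : ‖fderiv ℝ χ x‖ ≤ K := (hK2 x).trans ((le_abs_self _).trans (by simp [K]; exact le_add_of_nonneg_left (abs_nonneg _)))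
    rw [mul_add, add_comm]
    gcongr
    exact a1
  refine (eLpNorm_mono h2).trans ?_
  have e2 : (fun x => (K : ℝ) * (‖f x‖ + ∑ k, ‖(∂_{unitVec k} f : 𝓢(Space, ℂ)) x‖)) =
      (K : ℝ) • ((fun x => ‖f x‖) + ∑ k, fun x => ‖(∂_{unitVec k} f : 𝓢(Space, ℂ)) x‖) := by
    ext x; simp
  rw [e2, eLpNorm_const_smul]
  have e3 : ‖(K : ℝ)‖ₑ = K := by simp [enorm]
  rw [e3]
  have m0 : AEStronglyMeasurable (fun x => ‖f x‖) volume :=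
    f.continuous.norm.aestronglyMeasurable
  have m1 : ∀ k, AEStronglyMeasurable (fun x => ‖(∂_{unitVec k} f : 𝓢(Space, ℂ)) x‖) volume := fun k =>
    (∂_{unitVec k} f : 𝓢(Space, ℂ)).continuous.norm.aestronglyMeasurable
  norm_cast
  gcongr
  refine (eLpNorm_add_le m0 (Finset.aestronglyMeasurable_sum _ fun k _ => m1 k)
    (by norm_num)).trans ?_
  refine add_le_add (eLpNorm_norm _).le ((eLpNorm_sum_le (fun k _ => m1 k) (by norm_num)).trans
    (Finset.sum_le_sum fun k _ => (eLpNorm_norm _).le))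

/-- Schwartz functions are dense in the Sobolev space `H¹`. -/
theorem exists_schwartz_tendsto {u : L2 Space} {w : Fin 3 → L2 Space}
    (h : ∀ k, IsP (unitVec k) u (w k)) :
    ∃ f : ℕ → 𝓢(Space, ℂ), Tendsto (fun n => (f n).toLp 2 volume) atTop (𝓝 u) ∧
      ∀ k, Tendsto (fun n => (∂_{unitVec k} (f n)).toLp 2 volume) atTop
        (𝓝 (Complex.I • w k)) := by
  -- The hypothesis says that ϖ û is in L². It is approximated in L² by Schwartz functions φ_n, and
  -- ι φ_n, with ι = 1/ϖ smooth of temperate growth, is again Schwartz. Since ι and ξ ι are bounded,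
  -- functions and gradients converge together.
  let ϖ : Space → ℝ := fun ξ => (1 + ‖ξ‖ ^ 2) ^ (1 / 2 : ℝ)
  let ι : Space → ℝ := fun ξ => (1 + ‖ξ‖ ^ 2) ^ (-(1 / 2) : ℝ)
  have hpos : ∀ ξ : Space, 0 < 1 + ‖ξ‖ ^ 2 := fun ξ => by positivity
  have hϖι : ∀ ξ, ι ξ * ϖ ξ = 1 := fun ξ => by
    simp only [ϖ, ι]
    rw [← Real.rpow_add (hpos ξ)]
    norm_num
  have hϖ2 : ∀ ξ, ϖ ξ ^ 2 = 1 + ‖ξ‖ ^ 2 := fun ξ => by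
    simp only [ϖ]
    rw [← Real.rpow_natCast, ← Real.rpow_mul (hpos ξ).le]
    norm_num
  have hϖ0 : ∀ ξ, 0 < ϖ ξ := fun ξ => Real.rpow_pos_of_pos (hpos ξ) _
  have hι0 : ∀ ξ, 0 < ι ξ := fun ξ => Real.rpow_pos_of_pos (hpos ξ) _
  have hϖc : Continuous ϖ := Continuous.rpow_const (by fun_prop) fun ξ => Or.inl (hpos ξ).ne'
  have hιc : Continuous ι := Continuous.rpow_const (by fun_prop) fun ξ => Or.inl (hpos ξ).ne'
  have hϖ1 : ∀ ξ, 1 ≤ ϖ ξ := fun ξ => by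
    have := hϖ2 ξ
    have h0 := hϖ0 ξ
    nlinarith [sq_nonneg ‖ξ‖]
  have hϖn : ∀ ξ, ‖ξ‖ ≤ ϖ ξ := fun ξ => by
    have := hϖ2 ξ
    have h0 := hϖ0 ξ
    refine abs_le_of_sq_le_sq' ?_ h0.le |>.2
    linarith
  have hιb : BddMeas ι := ⟨hιc.aestronglyMeasurable, 1, fun ξ => by
    rw [abs_of_pos (hι0 ξ)]
    have := hϖι ξ
    nlinarith [hϖ1 ξ, hι0 ξ]⟩
  have hξb : ∀ k, BddMeas (fun ξ : Space => 2 * Real.pi * inner ℝ (unitVec k) ξ * ι ξ) := fun k =>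
    ⟨(by fun_prop : Continuous _).aestronglyMeasurable, 2 * Real.pi, fun ξ => by
      have a1 : |inner ℝ (unitVec k) ξ| ≤ ‖ξ‖ := by
        have := abs_real_inner_le_norm (unitVec k) ξ
        simpa [unitVec] using this
      rw [abs_mul, abs_mul, abs_of_pos Real.two_pi_pos, abs_of_pos (hι0 ξ), mul_assoc]
      refine mul_le_of_le_one_right Real.two_pi_pos.le ?_
      rw [← hϖι ξ, mul_comm]
      exact mul_le_mul_of_nonneg_left (a1.trans (hϖn ξ)) (hι0 ξ).le⟩
  have hy : MemLp (fun ξ => (ϖ ξ : ℂ) * (𝓕 u : L2 Space) ξ) 2 volume := by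
    have hm : MemLp (fun ξ => ‖(𝓕 u : L2 Space) ξ‖ + ∑ k, ‖(𝓕 (w k) : L2 Space) ξ‖) 2 volume :=
      (Lp.memLp _).norm.add (memLp_finsetSum _ fun k _ => (Lp.memLp _).norm)
    refine hm.mono ((Complex.continuous_ofReal.comp hϖc).aestronglyMeasurable.mul
      (Lp.aestronglyMeasurable _)) ?_
    have h' := ae_all_iff.2 h
    filter_upwards [h'] with ξ hξ
    have a1 : ϖ ξ ≤ 1 + ∑ k, |2 * Real.pi * inner ℝ (unitVec k) ξ| := by
      have b1 : ‖ξ‖ ≤ ∑ k, |2 * Real.pi * inner ℝ (unitVec k) ξ| := by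
        have c1 : ∀ k, |ξ k| ≤ |2 * Real.pi * inner ℝ (unitVec k) ξ| := fun k => by
          have : inner ℝ (unitVec k) ξ = ξ k := by
            rw [EuclideanSpace.inner_single_left]; simp
          rw [this, abs_mul, abs_of_pos Real.two_pi_pos]
          exact le_mul_of_one_le_left (abs_nonneg _) (by linarith [Real.pi_gt_three])
        refine le_trans ?_ (Finset.sum_le_sum fun k _ => c1 k)
        refine abs_le_of_sq_le_sq' ?_ (Finset.sum_nonneg fun _ _ => abs_nonneg _) |>.2
        rw [norm_sq_eq_sum, Fin.sum_univ_three, Fin.sum_univ_three]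
        have := abs_nonneg (ξ 0)
        have := abs_nonneg (ξ 1)
        have := abs_nonneg (ξ 2)
        rw [← sq_abs (ξ 0), ← sq_abs (ξ 1), ← sq_abs (ξ 2)]
        nlinarith [mul_nonneg (abs_nonneg (ξ 0)) (abs_nonneg (ξ 1)),
          mul_nonneg (abs_nonneg (ξ 0)) (abs_nonneg (ξ 2)),
          mul_nonneg (abs_nonneg (ξ 1)) (abs_nonneg (ξ 2))]
      have b2 := hϖ2 ξ
      have b3 := norm_nonneg ξ
      have : ϖ ξ ≤ 1 + ‖ξ‖ := abs_le_of_sq_le_sq' (by nlinarith) (by positivity) |>.2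
      linarith
    rw [norm_mul, Complex.norm_real, Real.norm_of_nonneg (hϖ0 ξ).le, Real.norm_of_nonneg
      (add_nonneg (norm_nonneg _) (Finset.sum_nonneg fun _ _ => norm_nonneg _))]
    have a2 : ∀ k, ‖(𝓕 (w k) : L2 Space) ξ‖ =
        |2 * Real.pi * inner ℝ (unitVec k) ξ| * ‖(𝓕 u : L2 Space) ξ‖ := fun k => by
      have := hξ k
      rw [← this, norm_mul, Complex.norm_real, Real.norm_eq_abs]
    simp_rw [a2]
    rw [← Finset.sum_mul]
    nlinarith [norm_nonneg ((𝓕 u : L2 Space) ξ)]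
  let y : L2 Space := mulOp ϖ (𝓕 u)
  have hy' : IsMul ϖ (𝓕 u) y := isMul_mulOp hy
  have hdense := SchwartzMap.denseRange_toLpCLM (E := Space) (F := ℂ) (p := 2)
    (μ := volume) ENNReal.ofNat_ne_top
  obtain ⟨x, hx, hxy⟩ := mem_closure_iff_seq_limit.1 (hdense y)
  choose φ hφ using hx
  have hφ' : ∀ n, (φ n).toLp 2 volume = x n := hφ
  have htg : ι.HasTemperateGrowth :=
    Function.hasTemperateGrowth_one_add_norm_sq_rpow Space _
  let g : ℕ → 𝓢(Space, ℂ) := fun n => SchwartzMap.smulLeftCLM ℂ ι (φ n)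
  have hg : ∀ n, (g n).toLp 2 volume = mulCLM ι hιb (x n) := by
    intro n
    rw [mulCLM_apply]
    symm
    apply IsMul.mulOp_eq
    rw [← hφ' n]
    filter_upwards [(g n).coeFn_toLp 2 volume, (φ n).coeFn_toLp 2 volume] with ξ h1 h2
    rw [h1, h2]
    simp [g, SchwartzMap.smulLeftCLM_apply_apply htg]
  have hu : mulCLM ι hιb y = 𝓕 u := by
    rw [mulCLM_apply]
    apply IsMul.mulOp_eq
    filter_upwards [hy'] with ξ h1
    rw [← h1, ← mul_assoc, ← Complex.ofReal_mul, hϖι, Complex.ofReal_one, one_mul]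
  refine ⟨fun n => 𝓕⁻ (g n), ?_, fun k => ?_⟩
  · rw [← tendsto_fourier_iff]
    have : ∀ n, (𝓕 ((𝓕⁻ (g n)).toLp 2 volume) : L2 Space) = mulCLM ι hιb (x n) := fun n => by
      rw [SchwartzMap.toLp_fourier_eq, FourierTransform.fourier_fourierInv_eq, hg]
    simp_rw [this, ← hu]
    exact ((mulCLM ι hιb).continuous.tendsto y).comp hxy
  · rw [← tendsto_fourier_iff]
    have e1 : ∀ n, (𝓕 ((∂_{unitVec k} (𝓕⁻ (g n))).toLp 2 volume) : L2 Space) =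
        Complex.I • mulCLM _ (hξb k) (x n) := fun n => by
      rw [SchwartzMap.toLp_fourier_eq, SchwartzMap.fourier_lineDerivOp_eq,
        FourierTransform.fourier_fourierInv_eq, mulCLM_apply]
      refine Lp.ext ?_
      have htg' : (fun ξ : Space => inner ℝ ξ (unitVec k)).HasTemperateGrowth := by fun_prop
      have := (hξb k).isMul (x n)
      rw [← hφ' n] at this ⊢
      filter_upwards [SchwartzMap.coeFn_toLp ((2 * Real.pi * Complex.I) • SchwartzMap.smulLeftCLM ℂ
        (fun ξ : Space => inner ℝ ξ (unitVec k)) (g n)) 2 volume,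
        (φ n).coeFn_toLp 2 volume, this, Lp.coeFn_smul Complex.I (mulOp (fun ξ : Space => 2 * Real.pi * inner ℝ (unitVec k) ξ * ι ξ) ((φ n).toLp 2 volume))] with ξ h1 h2 h3 h4
      rw [h1, h4, Pi.smul_apply, ← h3, h2]
      simp only [g, _root_.smul_apply, SchwartzMap.smulLeftCLM_apply_apply htg',
        SchwartzMap.smulLeftCLM_apply_apply htg, Complex.real_smul, smul_eq_mul, real_inner_comm]
      push_cast
      ring
    have e2 : (𝓕 (Complex.I • w k) : L2 Space) = Complex.I • mulCLM _ (hξb k) y := by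
      rw [fourier_smul']
      congr 1
      symm
      rw [mulCLM_apply]
      apply IsMul.mulOp_eq
      have := h k
      filter_upwards [hy', this] with ξ h1 h2
      rw [← h1, ← h2, ← mul_assoc, ← Complex.ofReal_mul, mul_assoc _ (ι ξ), hϖι, mul_one]
    simp_rw [e1, e2]
    exact (((mulCLM _ (hξb k)).continuous.tendsto y).comp hxy).const_smul _

/-- The Sobolev inequality in `H¹(ℝ³)`, localized by a bump function. -/
theorem exists_sobolev {χ : Space → ℝ} (hχ : ContDiff ℝ ∞ χ) (hc : HasCompactSupport χ) :
    ∃ C : ℝ, 0 ≤ C ∧ ∀ (u : L2 Space) (w : Fin 3 → L2 Space), (∀ k, IsP (unitVec k) u (w k)) →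
      eLpNorm (fun x => (χ x : ℂ) * u x) 6 volume ≤
        ENNReal.ofReal (C * (‖u‖ + ∑ k, ‖w k‖)) := by
  obtain ⟨C, hC⟩ := exists_sobolev_schwartz hχ hc
  refine ⟨C, C.2, fun u w h => ?_⟩
  obtain ⟨f, hf, hdf⟩ := exists_schwartz_tendsto h
  obtain ⟨ns, hns, hae⟩ := exists_subseq_ae_tendsto hf
  have hae2 : ∀ᵐ x, ∀ n, (f (ns n)).toLp 2 volume x = f (ns n) x :=
    ae_all_iff.2 fun n => (f (ns n)).coeFn_toLp 2 volume
  have hlim : ∀ᵐ x, Tendsto (fun n => (χ x : ℂ) * f (ns n) x) atTop (𝓝 ((χ x : ℂ) * u x)) := by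
    filter_upwards [hae, hae2] with x h1 h2
    simp_rw [h2] at h1
    exact h1.const_mul _
  -- By Fatou's lemma almost everywhere convergence suffices on the left; the right-hand side
  -- converges because the gradients do.
  refine (Lp.eLpNorm_lim_le_liminf_eLpNorm (fun n =>
    ((Complex.continuous_ofReal.comp hχ.continuous).mul
      (f (ns n)).continuous).aestronglyMeasurable) _ hlim).trans ?_
  have hb : ∀ n, eLpNorm (fun x => (χ x : ℂ) * f (ns n) x) 6 volume ≤
      ENNReal.ofReal (C * (‖(f (ns n)).toLp 2 volume‖ +
        ∑ k, ‖(∂_{unitVec k} (f (ns n)) : 𝓢(Space, ℂ)).toLp 2 volume‖)) := by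
    intro n
    refine (hC _).trans (le_of_eq ?_)
    have e : ∀ g : 𝓢(Space, ℂ), eLpNorm g 2 volume = ENNReal.ofReal ‖g.toLp 2 volume‖ := fun g => by
      rw [← eLpNorm_congr_ae (g.coeFn_toLp 2 volume), Lp.norm_def, ENNReal.ofReal_toReal]
      exact Lp.eLpNorm_ne_top _
    simp_rw [e]
    rw [← ENNReal.ofReal_sum_of_nonneg fun _ _ => norm_nonneg _, ← ENNReal.ofReal_add
      (norm_nonneg _) (Finset.sum_nonneg fun _ _ => norm_nonneg _), ENNReal.ofReal_mul (NNReal.coe_nonneg C),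
      ENNReal.ofReal_coe_nnreal]
  have ht : Tendsto (fun n => ENNReal.ofReal (C * (‖(f (ns n)).toLp 2 volume‖ +
        ∑ k, ‖(∂_{unitVec k} (f (ns n)) : 𝓢(Space, ℂ)).toLp 2 volume‖))) atTop
      (𝓝 (ENNReal.ofReal (C * (‖u‖ + ∑ k, ‖w k‖)))) := by
    refine ENNReal.tendsto_ofReal (Tendsto.const_mul _ ?_)
    refine Tendsto.add (hf.norm.comp hns.tendsto_atTop) (tendsto_finsetSum _ fun k _ => ?_)
    have := ((hdf k).norm.comp hns.tendsto_atTop)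
    rwa [norm_smul, Complex.norm_I, one_mul] at this
  rw [← ht.liminf_eq]
  exact liminf_le_liminf (Eventually.of_forall hb)

end Sobolev

/-- The identity coordinate of `ℝ³`. -/
def idCoord : Coord Space where
  pr := id
  e := LinearIsometry.id
  isCoord := fun _ _ => rfl

/-- The growth conditions on the magnetic and the electric potential. -/
structure Growth (P : Params) : Prop where
  A_loc : ∀ K : Set Space, IsCompact K → MemLp P.A 3 (volume.restrict K)
  V_growth : Tendsto P.V (cocompact Space) atTop
  AV : Tendsto (fun x => ‖P.A x‖ ^ 2 / P.V x) (cocompact Space) (𝓝 0)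

/-! ### Relative form-boundedness of A and coercivity of the one-body form. -/

section RelBound

open scoped NNReal

variable {P : Params}

theorem Growth.exists_radius (h : Growth P) {η : ℝ} (hη : 0 < η) :
    ∃ r : ℝ, 0 < r ∧ ∀ x, r < ‖x‖ → ‖P.A x‖ ^ 2 ≤ η * P.V x := by
  have h1 : ∀ᶠ x in cocompact Space, ‖P.A x‖ ^ 2 ≤ η * P.V x := by
    filter_upwards [h.V_growth.eventually_ge_atTop 1, h.AV.eventually_le_const hη] with x h2 h3
    rwa [div_le_iff₀ (by linarith)] at h3
  rw [← Metric.cobounded_eq_cocompact, (Metric.hasBasis_cobounded_compl_closedBall 0).eventually_iff] at h1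
  obtain ⟨r, -, hr⟩ := h1
  refine ⟨max r 1, by positivity, fun x hx => hr ?_⟩
  simp only [Set.mem_compl_iff, Metric.mem_closedBall, dist_zero_right, not_le]
  exact (le_max_left _ _).trans_lt hx

instance : ENNReal.HolderTriple 3 6 2 := ⟨by
  have h3 : (3 : ℝ≥0∞)⁻¹ = 2 * 6⁻¹ := by
    rw [show (6 : ℝ≥0∞) = 2 * 3 by norm_num, ENNReal.mul_inv (by simp) (by simp), ← mul_assoc,
      ENNReal.mul_inv_cancel (by simp) (by simp), one_mul]
  have h2 : (2 : ℝ≥0∞)⁻¹ = 3 * 6⁻¹ := by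
    rw [show (6 : ℝ≥0∞) = 3 * 2 by norm_num, ENNReal.mul_inv (by simp) (by simp), ← mul_assoc,
      ENNReal.mul_inv_cancel (by simp) (by simp), one_mul]
  rw [h3, h2]
  ring⟩

/-- Outside a large ball |A|² ≤ η V. Inside, `A` in L³ is a bounded function plus a remainder `T` of
small L³ norm, and Hölder with exponents 3 and 6 followed by Sobolev bounds T u by a small multiple
of the H¹ norm of `u`. -/
theorem Growth.exists_A_bound (h : Growth P) {η : ℝ} (hη : 0 < η) :
    ∃ C : ℝ, ∀ u ∈ dom P idCoord, ∑ k, ‖comp P idCoord (Sum.inr (Sum.inl k)) u‖ ^ 2 ≤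
      η * (∑ k, ‖comp P idCoord (Sum.inl k) u‖ ^ 2 +
        ‖comp P idCoord (Sum.inr (Sum.inr ())) u‖ ^ 2) + C * ‖u‖ ^ 2 := by
  obtain ⟨r, hr0, hr⟩ := h.exists_radius hη
  let χ : ContDiffBump (0 : Space) := ⟨r, r + 1, hr0, by linarith⟩
  have hχ1 : ∀ x : Space, ‖x‖ ≤ r → χ x = 1 := fun x hx =>
    χ.one_of_mem_closedBall (by simpa using hx)
  obtain ⟨Cs, hCs0, hCs⟩ := exists_sobolev (χ := χ) χ.contDiff χ.hasCompactSupport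
  let B : Set Space := Metric.closedBall 0 r
  have hB : MeasurableSet B := Metric.isClosed_closedBall.measurableSet
  have hAB := h.A_loc B (isCompact_closedBall 0 r)
  let g := hAB.1.mk P.A
  have hgs : StronglyMeasurable g := hAB.1.stronglyMeasurable_mk
  have hg : P.A =ᵐ[volume.restrict B] g := hAB.1.ae_eq_mk
  have hgL : MemLp g 3 (volume.restrict B) := hAB.ae_eq hg
  -- The factor 4 comes from squaring a sum of four norms, those of `u` and of its three
  -- derivatives.
  obtain ⟨δ, hδ0, hδ⟩ : ∃ δ : ℝ, 0 < δ ∧ (δ * Cs) ^ 2 * 4 ≤ η := by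
    refine ⟨Real.sqrt (η / 4) / (1 + Cs), by positivity, ?_⟩
    have : (Real.sqrt (η / 4) / (1 + Cs) * Cs) ^ 2 = η / 4 * (Cs / (1 + Cs)) ^ 2 := by
      rw [div_mul_eq_mul_div, mul_div_assoc, mul_pow, Real.sq_sqrt (by positivity)]
    rw [this]
    have h1 : Cs / (1 + Cs) ≤ 1 := (div_le_one (by positivity)).2 (by linarith)
    have h0 : 0 ≤ Cs / (1 + Cs) := by positivity
    have h2 : (Cs / (1 + Cs)) ^ 2 ≤ 1 := pow_le_one₀ h0 h1
    nlinarith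
  -- The level above which `A` has L³ norm at most δ on the ball; it exists because |A|³ is
  -- integrable there.
  obtain ⟨M, hM0, hM⟩ := hgL.eLpNorm_indicator_norm_ge_pos_le hgs hδ0
  let T : Space → Space := B.indicator ({x | M ≤ ‖g x‖₊}.indicator g)
  have hTm : AEStronglyMeasurable T volume :=
    ((hgs.indicator (measurableSet_le measurable_const hgs.norm.measurable)).indicator
      hB).aestronglyMeasurable
  have hT : eLpNorm T 3 volume ≤ ENNReal.ofReal δ := by
    rw [eLpNorm_indicator_eq_eLpNorm_restrict hB]
    exact hM
  refine ⟨M ^ 2 + η, fun u hu => ?_⟩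
  let w : Fin 3 → L2 Space := fun k => comp P idCoord (Sum.inl k) u
  let a : Fin 3 → L2 Space := fun k => comp P idCoord (Sum.inr (Sum.inl k)) u
  let y : L2 Space := comp P idCoord (Sum.inr (Sum.inr ())) u
  have hw : ∀ k, IsP (unitVec k) u (w k) := fun k => isComp_of_mem hu (Sum.inl k)
  have ha : ∀ k, IsMul (fun x => P.A x k) u (a k) := fun k =>
    isComp_of_mem hu (Sum.inr (Sum.inl k))
  have hy : IsMul (fun x => Real.sqrt (P.V x)) u y := isComp_of_mem hu (Sum.inr (Sum.inr ()))
  have hS := hCs u w hw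
  set S := ‖u‖ + ∑ k, ‖w k‖ with hSdef
  have hS0 : 0 ≤ S := add_nonneg (norm_nonneg _) (Finset.sum_nonneg fun _ _ => norm_nonneg _)
  have hχu : AEStronglyMeasurable (fun x => (χ x : ℂ) * u x) volume :=
    (Complex.continuous_ofReal.comp χ.continuous).aestronglyMeasurable.mul
      (Lp.aestronglyMeasurable u)
  have hz1 : eLpNorm (fun x => (‖T x‖ : ℂ) * ((χ x : ℂ) * u x)) 2 volume ≤
      ENNReal.ofReal (δ * (Cs * S)) := by
    have := eLpNorm_le_eLpNorm_mul_eLpNorm_of_nnnorm (p := 3) (q := 6) (r := 2) hTm hχu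
      (fun (t : Space) (z : ℂ) => (‖t‖ : ℂ) * z) 1 (Eventually.of_forall fun x => by
        simp)
    refine this.trans ?_
    rw [ENNReal.coe_one, one_mul, ENNReal.ofReal_mul hδ0.le]
    exact mul_le_mul' hT hS
  have hzm : MemLp (fun x => (‖T x‖ : ℂ) * ((χ x : ℂ) * u x)) 2 volume :=
    ⟨(Complex.continuous_ofReal.comp_aestronglyMeasurable hTm.norm).mul hχu,
      hz1.trans_lt ENNReal.ofReal_lt_top⟩
  let z : L2 Space := hzm.toLp _
  have hz : ‖z‖ ^ 2 ≤ η * (‖u‖ ^ 2 + ∑ k, ‖w k‖ ^ 2) := by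
    have h1 : ‖z‖ ≤ δ * (Cs * S) := by
      rw [Lp.norm_toLp]
      exact ENNReal.toReal_le_of_le_ofReal (by positivity) hz1
    have h2 : S ^ 2 ≤ 4 * (‖u‖ ^ 2 + ∑ k, ‖w k‖ ^ 2) := by
      rw [hSdef, Fin.sum_univ_three, Fin.sum_univ_three]
      nlinarith [sq_nonneg (‖u‖ - ‖w 0‖), sq_nonneg (‖u‖ - ‖w 1‖), sq_nonneg (‖u‖ - ‖w 2‖),
        sq_nonneg (‖w 0‖ - ‖w 1‖), sq_nonneg (‖w 0‖ - ‖w 2‖), sq_nonneg (‖w 1‖ - ‖w 2‖)]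
    calc ‖z‖ ^ 2 ≤ (δ * (Cs * S)) ^ 2 := by gcongr
      _ = (δ * Cs) ^ 2 * S ^ 2 := by ring
      _ ≤ (δ * Cs) ^ 2 * (4 * (‖u‖ ^ 2 + ∑ k, ‖w k‖ ^ 2)) := by gcongr
      _ = (δ * Cs) ^ 2 * 4 * (‖u‖ ^ 2 + ∑ k, ‖w k‖ ^ 2) := by ring
      _ ≤ _ := by gcongr
  have key : ∑ k, ‖a k‖ ^ 2 ≤ η * ‖y‖ ^ 2 + M ^ 2 * ‖u‖ ^ 2 + ‖z‖ ^ 2 := by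
    have hi : Integrable (fun x => η * ‖y x‖ ^ 2 + M ^ 2 * ‖u x‖ ^ 2) volume :=
      ((integrable_norm_sq y).const_mul _).add ((integrable_norm_sq u).const_mul _)
    simp_rw [norm_sq_eq_integral]
    rw [← integral_finsetSum _ fun k _ => integrable_norm_sq (a k), ← integral_const_mul,
      ← integral_const_mul, ← integral_add ((integrable_norm_sq y).const_mul _)
      ((integrable_norm_sq u).const_mul _), ← integral_add hi
      (integrable_norm_sq z)]
    refine integral_mono_ae (integrable_finsetSum _ fun k _ => integrable_norm_sq (a k))
      (hi.add (integrable_norm_sq z)) ?_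
    filter_upwards [ae_all_iff.2 ha, hy, hzm.coeFn_toLp, (ae_restrict_iff' hB).1 hg]
      with x h1 h2 h3 h4
    have e1 : ∑ k, ‖a k x‖ ^ 2 = ‖P.A x‖ ^ 2 * ‖u x‖ ^ 2 := by
      rw [norm_sq_eq_sum, Finset.sum_mul]
      refine Finset.sum_congr rfl fun k _ => ?_
      rw [← h1 k, norm_mul, mul_pow, Complex.norm_real, Real.norm_eq_abs, sq_abs]
    have e2 : ‖y x‖ ^ 2 = P.V x * ‖u x‖ ^ 2 := by
      rw [← h2, norm_mul, mul_pow, Complex.norm_real, Real.norm_eq_abs, sq_abs,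
        Real.sq_sqrt (P.V_nonneg x)]
    rw [e1, e2]
    have n0 := sq_nonneg ‖u x‖
    have n1 := sq_nonneg ‖z x‖
    have n2 := mul_nonneg hη.le (mul_nonneg (P.V_nonneg x) n0)
    have n3 := mul_nonneg (sq_nonneg (M : ℝ)) n0
    rcases lt_or_ge r ‖x‖ with hx | hx
    · have := mul_le_mul_of_nonneg_right (hr x hx) n0
      nlinarith
    · have hxB : x ∈ B := by simpa [B] using hx
      have hgx := h4 hxB
      rcases le_or_gt M ‖g x‖₊ with hm | hm
      · have : ‖z x‖ ^ 2 = ‖P.A x‖ ^ 2 * ‖u x‖ ^ 2 := by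
          have hTx : T x = g x := by
            simp only [T, Set.indicator_of_mem hxB]
            exact Set.indicator_of_mem (s := {x | M ≤ ‖g x‖₊}) hm g
          change ‖(hzm.toLp _) x‖ ^ 2 = _
          rw [h3, hχ1 x hx, hTx, ← hgx, norm_mul, Complex.norm_real]
          simp [mul_pow]
        linarith
      · have hm' : ‖P.A x‖ < M := by rw [hgx]; exact_mod_cast hm
        have : ‖P.A x‖ ^ 2 ≤ M ^ 2 := by gcongr
        nlinarith
  have := norm_nonneg u
  change ∑ k, ‖a k‖ ^ 2 ≤ η * (∑ k, ‖w k‖ ^ 2 + ‖y‖ ^ 2) + _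
  linarith

variable {F : Type} [NormedAddCommGroup F] [InnerProductSpace ℝ F] [FiniteDimensional ℝ F]
  [MeasurableSpace F] [BorelSpace F] {c : Coord F}

theorem graphSq_eq (u : L2 F) : graphSq P c u = ‖u‖ ^ 2 + ∑ k, ‖comp P c (Sum.inl k) u‖ ^ 2 +
    ∑ k, ‖comp P c (Sum.inr (Sum.inl k)) u‖ ^ 2 + ‖comp P c (Sum.inr (Sum.inr ())) u‖ ^ 2 := by
  rw [graphSq, Fintype.sum_sum_type, Fintype.sum_sum_type]
  simp only [Finset.univ_unique, Finset.sum_singleton, PUnit.default_eq_unit]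
  ring

/-- The cross term is split as 2ab ≤ (ε/2) a² + (2/ε) b², sacrificing half of the remaining ε p²,
and the low-momentum operator is bounded by 4s². -/
theorem le_re_qLow {u : L2 F} (hu : u ∈ dom P c) :
    P.ε / 2 * ∑ k, ‖comp P c (Sum.inl k) u‖ ^ 2 +
      (1 - 2 / P.ε) * ∑ k, ‖comp P c (Sum.inr (Sum.inl k)) u‖ ^ 2 +
      ‖comp P c (Sum.inr (Sum.inr ())) u‖ ^ 2 - 4 * P.s ^ 2 * ‖u‖ ^ 2 ≤ (qLow P c u u).re := by
  have hε := P.ε_pos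
  have hre : ∀ v : L2 F, (inner ℂ v v).re = ‖v‖ ^ 2 := fun v => inner_self_eq_norm_sq (𝕜 := ℂ) v
  have h1 : ∀ v w : L2 F, -(‖v‖ * ‖w‖) ≤ (inner ℂ v w).re := fun v w =>
    (abs_le.1 ((Complex.abs_re_le_norm _).trans (norm_inner_le_norm v w))).1
  have h2 : -(4 * P.s ^ 2 * ‖u‖ ^ 2) ≤ (1 - P.ε) * (inner ℂ u (kOp P c u)).re := by
    have a1 := h1 u (kOp P c u)
    have a2 := mul_le_mul_of_nonneg_left (norm_kOp_le (P := P) (c := c) u) (norm_nonneg u)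
    have a3 : 0 ≤ P.s ^ 2 * ‖u‖ ^ 2 := by positivity
    have a4 := P.ε_lt
    have a5 := mul_le_mul_of_nonneg_left a1 (sub_nonneg.2 a4.le)
    nlinarith
  have h3 : ∀ k, P.ε / 2 * ‖comp P c (Sum.inl k) u‖ ^ 2 +
      (1 - 2 / P.ε) * ‖comp P c (Sum.inr (Sum.inl k)) u‖ ^ 2 ≤
      ((P.ε : ℂ) * inner ℂ (comp P c (Sum.inl k) u) (comp P c (Sum.inl k) u) +
        inner ℂ (comp P c (Sum.inl k) u) (comp P c (Sum.inr (Sum.inl k)) u) +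
        inner ℂ (comp P c (Sum.inr (Sum.inl k)) u) (comp P c (Sum.inl k) u) +
        inner ℂ (comp P c (Sum.inr (Sum.inl k)) u) (comp P c (Sum.inr (Sum.inl k)) u)).re := by
    intro k
    set p := comp P c (Sum.inl k) u
    set a := comp P c (Sum.inr (Sum.inl k)) u
    have a1 := h1 p a
    have a2 := h1 a p
    rw [Complex.add_re, Complex.add_re, Complex.add_re, Complex.re_ofReal_mul, hre, hre]
    have a3 : 2 * (‖p‖ * ‖a‖) ≤ P.ε / 2 * ‖p‖ ^ 2 + 2 / P.ε * ‖a‖ ^ 2 := by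
      have := sq_nonneg (P.ε * ‖p‖ - 2 * ‖a‖)
      have e : P.ε / 2 * ‖p‖ ^ 2 + 2 / P.ε * ‖a‖ ^ 2 - 2 * (‖p‖ * ‖a‖) =
        (P.ε * ‖p‖ - 2 * ‖a‖) ^ 2 / (2 * P.ε) := by
        field_simp
        ring
      have : 0 ≤ (P.ε * ‖p‖ - 2 * ‖a‖) ^ 2 / (2 * P.ε) := by positivity
      linarith
    nlinarith
  have h4 := Finset.sum_le_sum fun k (_ : k ∈ Finset.univ) => h3 k
  rw [qLow_eq hu hu, Complex.add_re, Complex.add_re, Complex.re_sum, Complex.re_ofReal_mul, hre]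
  rw [Finset.sum_add_distrib, ← Finset.mul_sum, ← Finset.mul_sum] at h4
  linarith

theorem Growth.coercive (h : Growth P) :
    ∃ C : ℝ, ∀ u ∈ dom P idCoord, P.ε / 4 * graphSq P idCoord u ≤
      (qLow P idCoord u u).re + C * ‖u‖ ^ 2 := by
  have hε := P.ε_pos
  have hε1 := P.ε_lt
  -- With this η the loss (2/ε) |A|² costs (ε/4) (p² + V), which leaves ε/4 of p² and at least as
  -- much of V.
  obtain ⟨C, hC⟩ := h.exists_A_bound (η := P.ε ^ 2 / 8) (by positivity)
  refine ⟨2 / P.ε * C + 4 * P.s ^ 2 + P.ε / 4, fun u hu => ?_⟩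
  have h1 := le_re_qLow hu
  have h2 := mul_le_mul_of_nonneg_left (hC u hu) (by positivity : 0 ≤ 2 / P.ε)
  rw [graphSq_eq]
  set p := ∑ k, ‖comp P idCoord (Sum.inl k) u‖ ^ 2
  set a := ∑ k, ‖comp P idCoord (Sum.inr (Sum.inl k)) u‖ ^ 2
  set v := ‖comp P idCoord (Sum.inr (Sum.inr ())) u‖ ^ 2
  have ha : 0 ≤ a := Finset.sum_nonneg fun _ _ => sq_nonneg _
  have hv : 0 ≤ v := sq_nonneg _
  have e : 2 / P.ε * (P.ε ^ 2 / 8 * (p + v) + C * ‖u‖ ^ 2) =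
      P.ε / 4 * (p + v) + 2 / P.ε * C * ‖u‖ ^ 2 := by
    field_simp
    ring
  rw [e] at h2
  nlinarith

end RelBound

/-! ### The spectral definition of κ and the gap of h̃ on ℝ³. -/

section Kappa

variable {P : Params}

/-- The number `κ` belonging to the parameters. -/
def kap (P : Params) : ℝ := kappa P.A P.V P.θ P.ε P.s

theorem qLow_sub_right {F : Type} [NormedAddCommGroup F] [InnerProductSpace ℝ F]
    [FiniteDimensional ℝ F] [MeasurableSpace F] [BorelSpace F] {c : Coord F} {v u u' : L2 F}
    (hv : v ∈ dom P c) (hu : u ∈ dom P c) (hu' : u' ∈ dom P c) :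
    qLow P c v (u - u') = qLow P c v u - qLow P c v u' := by
  have h1 : u - u' = u + (-1 : ℂ) • u' := by rw [neg_one_smul, sub_eq_add_neg]
  rw [h1, qLow_add_right hv hu (Submodule.smul_mem _ _ hu'), qLow_smul_right hv hu']
  ring

/-- For such `t` the shifted form is coercive and Lax–Milgram provides a bounded inverse. It follows
that the spectrum is bounded below, without which its infimum would carry no information. -/
theorem notMem_opSpectrum {C : ℝ} (hC : ∀ u ∈ dom P idCoord, P.ε / 4 * graphSq P idCoord u ≤
      (qLow P idCoord u u).re + C * ‖u‖ ^ 2) {t : ℝ} (ht : C ≤ -(t + 1)) :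
    (t : ℂ) ∉ opSpectrum (formOperator (H := L2 Space) (formDomain P.A P.V id)
      (fun v u => lowForm P.A P.V P.θ P.ε P.s id v u - inner ℂ v u)) := by
  have hco : ∀ u ∈ dom P idCoord, P.ε / 4 * graphSq P idCoord u ≤
      (qLow P idCoord u u).re + (-(t + 1)) * ‖u‖ ^ 2 := fun u hu =>
    (hC u hu).trans (by gcongr)
  obtain ⟨S, hS⟩ := exists_resolvent (by linarith [P.ε_pos]) hco
  simp only [opSpectrum, Set.mem_ofPred_eq, not_not]
  refine ⟨S, fun u f => ⟨?_, ?_⟩⟩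
  · rintro ⟨h1, h2⟩
    have hu : u ∈ dom P idCoord := h1
    obtain ⟨h3, h4⟩ := hS f
    have hd : u - S f ∈ dom P idCoord := sub_mem hu h3
    have e1 : qLow P idCoord (u - S f) (u - S f) + ((-(t + 1) : ℝ) : ℂ) *
        inner ℂ (u - S f) (u - S f) = 0 := by
      have a1 := h2 _ hd
      have a2 := h4 _ hd
      change qLow P idCoord (u - S f) u - _ = _ at a1
      have a3 : qLow P idCoord (u - S f) (u - S f) =
          qLow P idCoord (u - S f) u - qLow P idCoord (u - S f) (S f) := qLow_sub_right hd hu h3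
      rw [a3, inner_sub_right (u - S f) u]
      simp only [inner_add_right, inner_smul_right] at a1
      push_cast at a2 ⊢
      linear_combination a1 - a2
    have e2 := hco _ hd
    have e3 : (qLow P idCoord (u - S f) (u - S f)).re + (-(t + 1)) * ‖u - S f‖ ^ 2 = 0 := by
      have := congrArg Complex.re e1
      rw [Complex.add_re, Complex.re_ofReal_mul] at this
      rw [← inner_self_eq_norm_sq (𝕜 := ℂ) (u - S f)]
      exact this
    rw [e3] at e2
    have e4 : ‖u - S f‖ ^ 2 ≤ graphSq P idCoord (u - S f) :=
      le_add_of_nonneg_right (Finset.sum_nonneg fun _ _ => sq_nonneg _)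
    have e5 : ‖u - S f‖ ^ 2 ≤ 0 := by
      have := P.ε_pos
      nlinarith
    exact sub_eq_zero.1 (norm_eq_zero.1 (pow_eq_zero_iff (two_ne_zero)|>.1
      (le_antisymm e5 (sq_nonneg _))))
  · rintro rfl
    obtain ⟨h3, h4⟩ := hS f
    refine ⟨h3, fun v hv => ?_⟩
    have := h4 v hv
    change qLow P idCoord v (S f) - _ = _
    simp only [inner_add_right, inner_smul_right]
    push_cast at this
    linear_combination this

/-- The Cauchy–Schwarz inequality for the form `q - m`, assumed nonnegative. -/
theorem form_cauchy_schwarz {F : Type} [NormedAddCommGroup F] [InnerProductSpace ℝ F]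
    [FiniteDimensional ℝ F] [MeasurableSpace F] [BorelSpace F] {c : Coord F} {m : ℝ}
    (hm : ∀ u ∈ dom P c, m * ‖u‖ ^ 2 ≤ (qLow P c u u).re) {v u : L2 F} (hv : v ∈ dom P c)
    (hu : u ∈ dom P c) :
    ‖qLow P c v u - m * inner ℂ v u‖ ^ 2 ≤ ((qLow P c v v).re - m * ‖v‖ ^ 2) *
      ((qLow P c u u).re - m * ‖u‖ ^ 2) := by
  let Q : dom P c → dom P c → ℂ := fun v u => qLow P c v u - m * inner ℂ (v : L2 F) (u : L2 F)
  let core : PreInnerProductSpace.Core ℂ (dom P c) :=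
    { inner := Q
      conj_inner_symm := fun x y => by
        change (starRingEnd ℂ) (_ - _) = _ - _
        rw [map_sub, map_mul, qLow_conj y.2 x.2, Complex.conj_ofReal, inner_conj_symm]
      re_inner_nonneg := fun x => by
        change 0 ≤ (qLow P c x x - m * inner ℂ (x : L2 F) (x : L2 F)).re
        rw [Complex.sub_re, Complex.re_ofReal_mul]
        have h1 := inner_self_eq_norm_sq (𝕜 := ℂ) (x : L2 F)
        have h2 := hm x x.2
        change (inner ℂ (x : L2 F) (x : L2 F)).re = _ at h1
        rw [h1]
        exact sub_nonneg.2 h2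
      add_left := fun x y z => by
        change qLow P c (x + y : L2 F) z - m * inner ℂ (x + y : L2 F) (z : L2 F) = _ - _ + (_ - _)
        rw [← qLow_conj z.2 (add_mem x.2 y.2), qLow_add_right z.2 x.2 y.2, map_add,
          qLow_conj z.2 x.2, qLow_conj z.2 y.2, inner_add_left]
        ring
      smul_left := fun x y r => by
        change qLow P c (r • (x : L2 F)) y - m * inner ℂ (r • (x : L2 F)) (y : L2 F) = _ * (_ - _)
        rw [← qLow_conj y.2 (Submodule.smul_mem _ r x.2), qLow_smul_right y.2 x.2, map_mul,
          qLow_conj y.2 x.2, inner_smul_left]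
        ring }
  have h := InnerProductSpace.Core.inner_mul_inner_self_le (c := core) ⟨v, hv⟩ ⟨u, hu⟩
  have hr : ∀ w (hw : w ∈ dom P c), (Q ⟨w, hw⟩ ⟨w, hw⟩).re = (qLow P c w w).re - m * ‖w‖ ^ 2 := by
    intro w hw
    change (qLow P c w w - m * inner ℂ w w).re = _
    rw [Complex.sub_re, Complex.re_ofReal_mul, ← inner_self_eq_norm_sq (𝕜 := ℂ) w]
    rfl
  change ‖Q ⟨v, hv⟩ ⟨u, hu⟩‖ * ‖Q ⟨u, hu⟩ ⟨v, hv⟩‖ ≤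
    (Q ⟨v, hv⟩ ⟨v, hv⟩).re * (Q ⟨u, hu⟩ ⟨u, hu⟩).re at h
  have hsymm : ‖Q ⟨u, hu⟩ ⟨v, hv⟩‖ = ‖Q ⟨v, hv⟩ ⟨u, hu⟩‖ := by
    have h1 : (starRingEnd ℂ) (Q ⟨u, hu⟩ ⟨v, hv⟩) = Q ⟨v, hv⟩ ⟨u, hu⟩ :=
      core.conj_inner_symm ⟨v, hv⟩ ⟨u, hu⟩
    rw [← h1, RCLike.norm_conj]
  rw [hsymm, hr, hr, ← sq] at h
  exact h

/-- Let m be the infimum of the form over unit vectors. It is enough that m - 1 lies in the spectrum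
of the operator shifted by 1, since then κ ≤ m - 1. If it did not, a bounded inverse `S` and
Cauchy–Schwarz for the nonnegative form q - m would keep q(w, w) - m away from zero on unit vectors.
-/
theorem Growth.kap_le (h : Growth P) {u : L2 Space} (hu : u ∈ dom P idCoord) :
    (kap P + 1) * ‖u‖ ^ 2 ≤ (qLow P idCoord u u).re := by
  obtain ⟨C, hC⟩ := h.coercive
  have hre : ∀ v : L2 Space, (inner ℂ v v).re = ‖v‖ ^ 2 := fun v =>
    inner_self_eq_norm_sq (𝕜 := ℂ) v
  rcases eq_or_ne u 0 with rfl | hu0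
  · have : qLow P idCoord (0 : L2 Space) 0 = 0 := by
      have := qLow_smul_right hu hu 0
      simpa using this
    simp [this]
  have hscale : ∀ v ∈ dom P idCoord, v ≠ 0 → ∃ w ∈ dom P idCoord, ‖w‖ = 1 ∧
      (qLow P idCoord v v).re = (qLow P idCoord w w).re * ‖v‖ ^ 2 := by
    intro v hv hv0
    have hn : ‖v‖ ≠ 0 := norm_ne_zero_iff.2 hv0
    have hw : ((‖v‖⁻¹ : ℝ) : ℂ) • v ∈ dom P idCoord := Submodule.smul_mem _ _ hv
    refine ⟨((‖v‖⁻¹ : ℝ) : ℂ) • v, hw, ?_, ?_⟩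
    · rw [norm_smul, Complex.norm_real, norm_inv, norm_norm, inv_mul_cancel₀ hn]
    · rw [qLow_smul_right hw hv, ← qLow_conj hv hw, qLow_smul_right hv hv, map_mul,
        qLow_conj hv hv, Complex.conj_ofReal, Complex.re_ofReal_mul, Complex.re_ofReal_mul]
      field_simp
  let Z : Set ℝ := {t | ∃ w ∈ dom P idCoord, ‖w‖ = 1 ∧ (qLow P idCoord w w).re = t}
  have hZb : BddBelow Z := ⟨-C, by
    rintro t ⟨w, hw, hw1, rfl⟩
    have h1 := hC w hw
    rw [hw1] at h1
    have h2 : 0 ≤ graphSq P idCoord w :=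
      add_nonneg (sq_nonneg _) (Finset.sum_nonneg fun _ _ => sq_nonneg _)
    have := P.ε_pos
    nlinarith⟩
  have hZn : Z.Nonempty := by
    obtain ⟨w, hw, hw1, -⟩ := hscale u hu hu0
    exact ⟨_, w, hw, hw1, rfl⟩
  set m := sInf Z with hmdef
  have hm : ∀ v ∈ dom P idCoord, m * ‖v‖ ^ 2 ≤ (qLow P idCoord v v).re := by
    intro v hv
    rcases eq_or_ne v 0 with rfl | hv0
    · have : qLow P idCoord (0 : L2 Space) 0 = 0 := by
        have := qLow_smul_right hv hv 0
        simpa using this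
      simp [this]
    · obtain ⟨w, hw, hw1, hw2⟩ := hscale v hv hv0
      rw [hw2]
      gcongr
      exact csInf_le hZb ⟨w, hw, hw1, rfl⟩
  have hspec : ((m - 1 : ℝ) : ℂ) ∈ opSpectrum (formOperator (H := L2 Space)
      (formDomain P.A P.V id) (fun v u => lowForm P.A P.V P.θ P.ε P.s id v u - inner ℂ v u)) := by
    rintro ⟨S, hS⟩
    have hSf : ∀ f, S f ∈ dom P idCoord ∧ ∀ v ∈ dom P idCoord,
        qLow P idCoord v (S f) - m * inner ℂ v (S f) = inner ℂ v f := by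
      intro f
      obtain ⟨h1, h2⟩ := (hS (S f) f).2 rfl
      refine ⟨h1, fun v hv => ?_⟩
      have h3 := h2 v hv
      change qLow P idCoord v (S f) - _ = _ at h3
      simp only [inner_add_right, inner_smul_right] at h3
      push_cast at h3
      linear_combination h3
    -- For a unit vector w, 1 = |⟨w, w⟩|² = |(q - m)(w, S w)|² ≤ (q - m)(w, w) · (q - m)(S w, S w),
    -- and the last factor is Re ⟨S w, w⟩ ≤ ‖S‖.
    have hlow : ∀ w ∈ dom P idCoord, ‖w‖ = 1 → 1 ≤ ((qLow P idCoord w w).re - m) * (‖S‖ + 1) := by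
      intro w hw hw1
      obtain ⟨h1, h2⟩ := hSf w
      have h3 := form_cauchy_schwarz hm hw h1
      rw [h2 w hw] at h3
      have h4 : (qLow P idCoord (S w) (S w)).re - m * ‖S w‖ ^ 2 ≤ ‖S‖ + 1 := by
        have h5 := congrArg Complex.re (h2 (S w) h1)
        rw [Complex.sub_re, Complex.re_ofReal_mul, hre] at h5
        rw [h5]
        refine (Complex.re_le_norm _).trans ((norm_inner_le_norm _ _).trans ?_)
        rw [hw1, mul_one]
        have := S.le_opNorm w
        rw [hw1, mul_one] at this
        linarith
      have h6 : 0 ≤ (qLow P idCoord w w).re - m * ‖w‖ ^ 2 := sub_nonneg.2 (hm w hw)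
      have h7 : ‖(inner ℂ w w : ℂ)‖ = 1 := by
        rw [inner_self_eq_norm_sq_to_K, hw1]; simp
      rw [h7, one_pow] at h3
      refine h3.trans ((mul_le_mul_of_nonneg_left h4 h6).trans (le_of_eq ?_))
      rw [hw1]; ring
    obtain ⟨t, ⟨w, hw, hw1, rfl⟩, ht⟩ := exists_lt_of_csInf_lt hZn
      (show sInf Z < m + 1 / (‖S‖ + 2) from lt_add_of_pos_right _ (by positivity))
    have h1 := hlow w hw hw1
    have h2 : (qLow P idCoord w w).re - m < 1 / (‖S‖ + 2) := by linarith
    have h3 : ((qLow P idCoord w w).re - m) * (‖S‖ + 1) ≤ 1 / (‖S‖ + 2) * (‖S‖ + 1) := by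
      gcongr
    have h4 : 1 / (‖S‖ + 2) * (‖S‖ + 1) < 1 := by
      rw [div_mul_eq_mul_div, one_mul, div_lt_one (by positivity)]
      linarith
    linarith
  have hκ : kap P ≤ m - 1 := by
    refine csInf_le ⟨-C - 1, fun t ht => ?_⟩ hspec
    by_contra hlt
    exact notMem_opSpectrum hC (by linarith) ht
  refine le_trans ?_ (hm u hu)
  gcongr
  linarith

/-- The one-body operator controls all the operators of which it is made. -/
theorem Growth.exists_gap (h : Growth P) :
    ∃ d : ℝ, 0 < d ∧ ∀ u ∈ dom P idCoord, d * graphSq P idCoord u ≤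
      (qLow P idCoord u u).re - kap P * ‖u‖ ^ 2 := by
  obtain ⟨C, hC⟩ := h.coercive
  have hε := P.ε_pos
  -- Since ‖u‖² ≤ q - κ‖u‖², one has q + C‖u‖² = (q - κ‖u‖²) + (C + κ)‖u‖² ≤ (1 + |C + κ|) (q -
  -- κ‖u‖²).
  refine ⟨P.ε / 4 / (1 + |C + kap P|), by positivity, fun u hu => ?_⟩
  have h1 := hC u hu
  have h2 := h.kap_le hu
  rw [div_mul_eq_mul_div, div_le_iff₀ (by positivity)]
  have h3 : ‖u‖ ^ 2 ≤ (qLow P idCoord u u).re - kap P * ‖u‖ ^ 2 := by linarith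
  have h4 := mul_le_mul_of_nonneg_right h3 (abs_nonneg (C + kap P))
  have h5 := mul_le_mul_of_nonneg_right (le_abs_self (C + kap P)) (sq_nonneg ‖u‖)
  linarith

end Kappa

/-! ### Tensor products and the transfer of the gap to every coordinate. -/

section Tensor

variable {F : Type} [NormedAddCommGroup F] [InnerProductSpace ℝ F] [FiniteDimensional ℝ F]
  [MeasurableSpace F] [BorelSpace F] {e : Space →ₗᵢ[ℝ] F}

/-- The function `f ⊗ φ` on `F`. -/
def tensFun (e : Space →ₗᵢ[ℝ] F) (f : L2 Space) (φ : L2 (coComp e)) (x : F) : ℂ :=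
  f ((join e).symm x).1 * φ ((join e).symm x).2

theorem ae_join_iff {p : F → Prop} :
    (∀ᵐ z : Space × coComp e, p (join e z)) ↔ ∀ᵐ x, p x := by
  rw [← (measurePreserving_join e).map_eq]
  exact ((join e).measurableEmbedding.ae_map_iff).symm

theorem ae_fst {p : Space → Prop} (h : ∀ᵐ a, p a) :
    ∀ᵐ x : F, p ((join e).symm x).1 := by
  rw [← ae_join_iff (e := e)]
  simp only [MeasurableEquiv.symm_apply_apply]
  exact Measure.quasiMeasurePreserving_fst.ae h

theorem ae_snd {p : coComp e → Prop} (h : ∀ᵐ a, p a) :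
    ∀ᵐ x : F, p ((join e).symm x).2 := by
  rw [← ae_join_iff (e := e)]
  simp only [MeasurableEquiv.symm_apply_apply]
  exact Measure.quasiMeasurePreserving_snd.ae h

theorem memLp_tensFun (f : L2 Space) (φ : L2 (coComp e)) : MemLp (tensFun e f φ) 2 volume := by
  have h1 : MemLp (fun z : Space × coComp e => f z.1 * φ z.2) 2 volume := by
    refine (memLp_two_iff_integrable_sq_norm ?_).2 ?_
    · exact (Lp.aestronglyMeasurable f).comp_fst.mul (Lp.aestronglyMeasurable φ).comp_snd
    · refine ((integrable_norm_sq f).mul_prod (integrable_norm_sq φ)).congr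
        (Eventually.of_forall fun z => ?_)
      simp [mul_pow]
  exact h1.comp_measurePreserving (measurePreserving_join e).symm

theorem integral_join (f : F → ℂ) :
    ∫ x, f x = ∫ z : Space × coComp e, f (join e z) :=
  ((measurePreserving_join e).integral_comp (join e).measurableEmbedding f).symm

theorem inner_toLp_tensFun (f g : L2 Space) (φ ψ : L2 (coComp e)) :
    inner ℂ ((memLp_tensFun f φ).toLp _) ((memLp_tensFun g ψ).toLp _) =
      inner ℂ f g * inner ℂ φ ψ := by
  rw [inner_eq_integral, inner_eq_integral, inner_eq_integral, ← integral_prod_mul]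
  have : ∫ x, (starRingEnd ℂ) ((memLp_tensFun f φ).toLp _ x) * (memLp_tensFun g ψ).toLp _ x =
      ∫ x, (starRingEnd ℂ) (tensFun e f φ x) * tensFun e g ψ x := by
    refine integral_congr_ae ?_
    filter_upwards [(memLp_tensFun f φ).coeFn_toLp, (memLp_tensFun g ψ).coeFn_toLp] with x h1 h2
    rw [h1, h2]
  rw [this, integral_join (e := e)]
  congr 1
  ext z
  simp only [tensFun, MeasurableEquiv.symm_apply_apply, map_mul]
  ring

theorem norm_toLp_tensFun (f : L2 Space) (φ : L2 (coComp e)) :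
    ‖(memLp_tensFun f φ).toLp _‖ = ‖f‖ * ‖φ‖ := by
  have h := inner_toLp_tensFun f f φ φ
  rw [inner_self_eq_norm_sq_to_K, inner_self_eq_norm_sq_to_K, inner_self_eq_norm_sq_to_K] at h
  have h2 : ‖(memLp_tensFun f φ).toLp _‖ ^ 2 = (‖f‖ * ‖φ‖) ^ 2 := by
    rw [mul_pow]
    exact_mod_cast h
  exact (sq_eq_sq₀ (norm_nonneg _) (by positivity)).1 h2

/-- The tensor product `f ⊗ φ` as a bilinear map. -/
def tens (e : Space →ₗᵢ[ℝ] F) : L2 Space →L[ℂ] L2 (coComp e) →L[ℂ] L2 F :=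
  LinearMap.mkContinuous₂
    (LinearMap.mk₂ ℂ (fun f φ => (memLp_tensFun (e := e) f φ).toLp _)
      (fun f g φ => by
        rw [← MemLp.toLp_add]
        refine MemLp.toLp_congr _ _ ?_
        filter_upwards [ae_fst (e := e) (Lp.coeFn_add f g)] with x h1
        simp only [tensFun, h1, Pi.add_apply, add_mul])
      (fun c f φ => by
        rw [← MemLp.toLp_const_smul]
        refine MemLp.toLp_congr _ _ ?_
        filter_upwards [ae_fst (e := e) (Lp.coeFn_smul c f)] with x h1
        simp only [tensFun, h1, Pi.smul_apply, smul_eq_mul, mul_assoc])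
      (fun f φ ψ => by
        rw [← MemLp.toLp_add]
        refine MemLp.toLp_congr _ _ ?_
        filter_upwards [ae_snd (e := e) (Lp.coeFn_add φ ψ)] with x h1
        simp only [tensFun, h1, Pi.add_apply, mul_add])
      (fun c f φ => by
        rw [← MemLp.toLp_const_smul]
        refine MemLp.toLp_congr _ _ ?_
        filter_upwards [ae_snd (e := e) (Lp.coeFn_smul c φ)] with x h1
        simp only [tensFun, h1, Pi.smul_apply, smul_eq_mul]
        ring))
    1 (fun f φ => by rw [one_mul]; exact (norm_toLp_tensFun f φ).le)

theorem coeFn_tens (f : L2 Space) (φ : L2 (coComp e)) :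
    tens e f φ =ᵐ[volume] tensFun e f φ := (memLp_tensFun f φ).coeFn_toLp

theorem inner_tens (f g : L2 Space) (φ ψ : L2 (coComp e)) :
    inner ℂ (tens e f φ) (tens e g ψ) = inner ℂ f g * inner ℂ φ ψ := inner_toLp_tensFun f g φ ψ

/-- Tensoring with a fixed φ leaves the distinguished variable untouched. The adjoint, a partial
inner product with φ, is therefore a slicing map to L²(ℝ³) that respects p, A and √V. -/
theorem intertwines_tens {pr : F → Space} (hc : IsCoord pr e) (φ : L2 (coComp e)) :
    Intertwines id LinearIsometry.id pr e ((tens e).flip φ) where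
  map_tr a f := by
    refine Lp.ext ?_
    simp only [ContinuousLinearMap.flip_apply]
    filter_upwards [coeFn_tens (e := e) (tr ((LinearIsometry.id : Space →ₗᵢ[ℝ] Space) a) f) φ,
      coeFn_tr (e a) (tens e f φ), ae_add (e a) (coeFn_tens (e := e) f φ),
      ae_fst (e := e) (coeFn_tr ((LinearIsometry.id : Space →ₗᵢ[ℝ] Space) a) f)] with x h1 h2 h3 h4
    rw [h1, h2, h3]
    obtain ⟨z, rfl⟩ := (join e).surjective x
    have : join e z + e a = join e (z.1 + a, z.2) := by
      rw [join_apply, join_apply, map_add]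
      abel
    rw [this]
    simp only [tensFun, MeasurableEquiv.symm_apply_apply] at h4 ⊢
    rw [h4]
    rfl
  map_mul m hm f := by
    symm
    simp only [ContinuousLinearMap.flip_apply]
    apply IsMul.mulOp_eq
    filter_upwards [coeFn_tens (e := e) f φ, coeFn_tens (e := e) (mulOp (fun x => m (id x)) f) φ,
      ae_fst (e := e) (hm.isMul f)] with x h1 h2 h3
    obtain ⟨z, rfl⟩ := (join e).surjective x
    rw [h1, h2, hc.pr_join]
    simp only [tensFun, MeasurableEquiv.symm_apply_apply, id] at h3 ⊢
    rw [← h3, mul_assoc]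

theorem Intertwines.adjoint {F' : Type} [NormedAddCommGroup F'] [InnerProductSpace ℝ F']
    [FiniteDimensional ℝ F'] [MeasurableSpace F'] [BorelSpace F']
    {pr : F → Space} {pr' : F' → Space} {e' : Space →ₗᵢ[ℝ] F'} {B : L2 F →L[ℂ] L2 F'}
    (hc : IsCoord pr e) (hc' : IsCoord pr' e') (h : Intertwines pr e pr' e' B) :
    Intertwines pr' e' pr e (ContinuousLinearMap.adjoint B) where
  map_tr a u := by
    refine ext_inner_left ℂ fun v => ?_
    rw [ContinuousLinearMap.adjoint_inner_right, ← neg_neg (e' a), ← inner_tr_left, ← map_neg,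
      ← h.map_tr, ← ContinuousLinearMap.adjoint_inner_right, inner_tr_left, map_neg, neg_neg]
  map_mul m hm u := by
    refine ext_inner_left ℂ fun v => ?_
    have h1 := (hm.comp_pr hc).isMul v
    have h2 := (hm.comp_pr hc).isMul (ContinuousLinearMap.adjoint B u)
    have h3 := (hm.comp_pr hc').isMul u
    have h4 := (hm.comp_pr hc').isMul (B v)
    rw [ContinuousLinearMap.adjoint_inner_right, ← h4.inner_comm h3, ← h.map_mul m hm,
      ← h1.inner_comm h2, ContinuousLinearMap.adjoint_inner_right]

/-- A locally square integrable function whose integrals over rectangles vanish is zero. -/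
theorem ae_eq_zero_of_rectangles {Y : Type} [NormedAddCommGroup Y] [InnerProductSpace ℝ Y]
    [FiniteDimensional ℝ Y] [MeasurableSpace Y] [BorelSpace Y] {f : Space × Y → ℂ}
    (hf : MemLp f 2 volume)
    (h : ∀ S : Set Space, ∀ T : Set Y, MeasurableSet S → MeasurableSet T → volume S < ⊤ →
      volume T < ⊤ → ∫ z in S ×ˢ T, f z = 0) : f =ᵐ[volume] 0 := by
  let K : ℕ → Set (Space × Y) := fun n => Metric.closedBall 0 n ×ˢ Metric.closedBall 0 n
  have hS : ∀ n : ℕ, MeasurableSet (Metric.closedBall (0 : Space) n) := fun n =>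
    Metric.isClosed_closedBall.measurableSet
  have hT : ∀ n : ℕ, MeasurableSet (Metric.closedBall (0 : Y) n) := fun n =>
    Metric.isClosed_closedBall.measurableSet
  have hSf : ∀ n : ℕ, volume (Metric.closedBall (0 : Space) n) < ⊤ := fun n =>
    measure_closedBall_lt_top
  have hTf : ∀ n : ℕ, volume (Metric.closedBall (0 : Y) n) < ⊤ := fun n =>
    measure_closedBall_lt_top
  -- On a bounded rectangle `f` is integrable, and the sets over which its integral vanishes form a
  -- Dynkin system containing the π-system of rectangles.
  have key : ∀ n, f =ᵐ[volume.restrict (K n)] 0 := by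
    intro n
    have hfin : IsFiniteMeasure ((volume : Measure (Space × Y)).restrict (K n)) := ⟨by
      rw [Measure.restrict_apply_univ, Measure.volume_eq_prod, Measure.prod_prod]
      exact ENNReal.mul_lt_top (hSf n) (hTf n)⟩
    have hi : Integrable f (volume.restrict (K n)) :=
      (hf.restrict (K n)).integrable (by norm_num)
    refine hi.ae_eq_zero_of_forall_setIntegral_eq_zero fun E hE _ => ?_
    refine MeasurableSpace.induction_on_inter (C := fun E _ => ∫ z in E, f z ∂volume.restrict (K n) = 0)
      generateFrom_prod.symm isPiSystem_prod ?_ ?_ ?_ ?_ E hE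
    · simp
    · rintro _ ⟨S, (hS' : MeasurableSet S), T, (hT' : MeasurableSet T), rfl⟩
      rw [Measure.restrict_restrict (hS'.prod hT'), Set.prod_inter_prod]
      exact h _ _ (hS'.inter (hS n)) (hT'.inter (hT n))
        ((measure_mono Set.inter_subset_right).trans_lt (hSf n))
        ((measure_mono Set.inter_subset_right).trans_lt (hTf n))
    · intro t ht h0
      have h1 := integral_add_compl ht hi
      rw [h0, zero_add] at h1
      rw [h1]
      exact h _ _ (hS n) (hT n) (hSf n) (hTf n)
    · intro g hd hm h0
      rw [integral_iUnion hm hd hi.integrableOn]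
      simp [h0]
  have hU : ⋃ n, K n = Set.univ := by
    refine Set.eq_univ_of_forall fun z => ?_
    obtain ⟨n, hn⟩ := exists_nat_ge (max ‖z.1‖ ‖z.2‖)
    refine Set.mem_iUnion.2 ⟨n, ?_, ?_⟩
    · simpa using (le_max_left _ _).trans hn
    · simpa using (le_max_right _ _).trans hn
  have := (ae_restrict_iUnion_iff K fun z => f z = 0).2 key
  rwa [hU, Measure.restrict_univ] at this

theorem eq_zero_of_inner_tens {u : L2 F} (h : ∀ f φ, inner ℂ (tens e f φ) u = 0) : u = 0 := by
  have hu : MemLp (fun z : Space × coComp e => u (join e z)) 2 volume :=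
    (Lp.memLp u).comp_measurePreserving (measurePreserving_join e)
  have h0 := ae_eq_zero_of_rectangles hu (fun S T hS hT hS' hT' => by
    have h1 := h (indicatorConstLp 2 hS hS'.ne 1) (indicatorConstLp 2 hT hT'.ne 1)
    rw [inner_eq_integral, integral_join (e := e)] at h1
    rw [← h1, ← integral_indicator (hS.prod hT)]
    refine integral_congr_ae ?_
    filter_upwards [(ae_join_iff (e := e)).2
        (coeFn_tens (indicatorConstLp 2 hS hS'.ne 1) (indicatorConstLp 2 hT hT'.ne 1)),
      Measure.quasiMeasurePreserving_fst.ae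
        (indicatorConstLp_coeFn (p := 2) (hs := hS) (hμs := hS'.ne) (c := (1 : ℂ))),
      Measure.quasiMeasurePreserving_snd.ae
        (indicatorConstLp_coeFn (p := 2) (hs := hT) (hμs := hT'.ne) (c := (1 : ℂ)))]
      with z h2 h3 h4
    rw [h2]
    simp only [tensFun, MeasurableEquiv.symm_apply_apply]
    rw [h3, h4]
    by_cases hz1 : z.1 ∈ S <;> by_cases hz2 : z.2 ∈ T <;>
      simp [Set.indicator, hz1, hz2])
  refine Lp.ext ?_
  have : ∀ᵐ x, u x = 0 := (ae_join_iff (e := e)).1 h0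
  filter_upwards [this, Lp.coeFn_zero (E := ℂ) (p := 2) (μ := (volume : Measure F))] with x h1 h2
  rw [h1, h2]
  rfl

/-- The Parseval identity for a basis of the functions of the orthogonal directions. -/
theorem exists_parseval (e : Space →ₗᵢ[ℝ] F) :
    ∃ (ι : Type) (φ : ι → L2 (coComp e)), ∀ v u : L2 F,
      HasSum (fun i => inner ℂ (ContinuousLinearMap.adjoint ((tens e).flip (φ i)) v)
        (ContinuousLinearMap.adjoint ((tens e).flip (φ i)) u)) (inner ℂ v u) := by
  classical
  obtain ⟨w, b, hb⟩ := exists_hilbertBasis ℂ (L2 (coComp e))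
  let J : w → L2 Space →ₗᵢ[ℂ] L2 F := fun i =>
    ⟨((tens e).flip (b i)).toLinearMap, fun f => by
      change ‖tens e f (b i)‖ = ‖f‖
      have := norm_toLp_tensFun f (b i)
      rw [b.orthonormal.1 i, mul_one] at this
      exact this⟩
  have hJ : ∀ i f, J i f = tens e f (b i) := fun _ _ => rfl
  have horth : OrthogonalFamily ℂ (fun _ : w => L2 Space) J := by
    intro i j hij f g
    rw [hJ, hJ, inner_tens, b.orthonormal.2 hij, mul_zero]
  -- If `u` is orthogonal to all f ⊗ b_i, then for fixed `f` the partial inner product of `u` with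
  -- `f` has no component along the basis, so `u` is orthogonal to all product vectors.
  have htop : ⊤ ≤ (⨆ i, LinearMap.range (J i).toLinearMap).topologicalClosure := by
    rw [top_le_iff, Submodule.topologicalClosure_eq_top_iff, Submodule.eq_bot_iff]
    intro u hu
    refine eq_zero_of_inner_tens (e := e) fun f φ => ?_
    have h1 : ContinuousLinearMap.adjoint (tens e f) u = 0 := by
      refine b.repr.injective ?_
      rw [map_zero]
      ext i
      rw [b.repr_apply_apply, ContinuousLinearMap.adjoint_inner_right]
      exact (Submodule.mem_orthogonal _ _).1 hu _ (Submodule.mem_iSup_of_mem i ⟨f, rfl⟩)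
    rw [← ContinuousLinearMap.adjoint_inner_right, h1, inner_zero_right]
  have hsum : IsHilbertSum ℂ (fun _ : w => L2 Space) J := IsHilbertSum.mk horth htop
  refine ⟨w, fun i => b i, fun v u => ?_⟩
  obtain ⟨y, rfl⟩ := hsum.linearIsometryEquiv.symm.surjective u
  have h1 := hsum.hasSum_linearIsometryEquiv_symm y
  have h2 : ∀ i, ContinuousLinearMap.adjoint ((tens e).flip (b i))
      (hsum.linearIsometryEquiv.symm y) = y i := by
    intro i
    refine ext_inner_left ℂ fun f => ?_
    rw [ContinuousLinearMap.adjoint_inner_right]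
    have h3 := h1.mapL (innerSL ℂ (J i f))
    simp only [innerSL_apply_apply] at h3
    refine h3.unique ?_
    have h4 : ∀ j, inner ℂ (J i f) (J j (y j)) = if j = i then inner ℂ f (y i) else 0 := by
      intro j
      split_ifs with hij
      · subst hij
        exact (J j).inner_map_map _ _
      · exact horth (fun h => hij h.symm) _ _
    simp_rw [h4]
    exact hasSum_ite_eq i _
  have h5 := h1.mapL (innerSL ℂ v)
  simp only [innerSL_apply_apply] at h5
  refine h5.congr_fun fun i => ?_
  rw [h2 i, ContinuousLinearMap.adjoint_inner_left]
  rfl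

variable {P : Params}

/-- The gap of the one-body operator on `ℝ³` holds in every coordinate. -/
theorem Growth.exists_gap_coord (h : Growth P) :
    ∃ d : ℝ, 0 < d ∧ ∀ {F : Type} [NormedAddCommGroup F] [InnerProductSpace ℝ F]
      [FiniteDimensional ℝ F] [MeasurableSpace F] [BorelSpace F] (c : Coord F), ∀ u ∈ dom P c,
        d * graphSq P c u ≤ (qLow P c u u).re - kap P * ‖u‖ ^ 2 := by
  obtain ⟨d, hd, hgap⟩ := h.exists_gap
  refine ⟨d, hd, fun {F} _ _ _ _ _ c u hu => ?_⟩
  -- The slices `B i u` lie in the one-body form domain, and by Parseval every inner product in the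
  -- two sides of the inequality is the sum of those of the slices. So the one-body inequality may
  -- be summed.
  obtain ⟨ι, φ, hφ⟩ := exists_parseval c.e
  let B : ι → L2 F →L[ℂ] L2 Space := fun i =>
    ContinuousLinearMap.adjoint ((tens c.e).flip (φ i))
  have hB : ∀ i, Intertwines c.pr c.e idCoord.pr idCoord.e (B i) := fun i =>
    (intertwines_tens c.isCoord (φ i)).adjoint idCoord.isCoord c.isCoord
  have hBu : ∀ i, B i u ∈ dom P idCoord := fun i => mem_dom_map (hB i) hu
  have hns : ∀ v : L2 F, HasSum (fun i => ‖B i v‖ ^ 2) (‖v‖ ^ 2) := by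
    intro v
    have := Complex.hasSum_re (hφ v v)
    rw [show (inner ℂ v v).re = ‖v‖ ^ 2 from inner_self_eq_norm_sq (𝕜 := ℂ) v] at this
    refine this.congr_fun fun i => ?_
    exact (inner_self_eq_norm_sq (𝕜 := ℂ) (B i v)).symm
  have hg : HasSum (fun i => graphSq P idCoord (B i u)) (graphSq P c u) := by
    refine ((hns u).add (hasSum_sum fun j _ => hns (comp P c j u))).congr_fun fun i => ?_
    simp only [graphSq, comp_map (hB i) hu]
  have hq : HasSum (fun i => qLow P idCoord (B i u) (B i u)) (qLow P c u u) := by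
    rw [qLow_eq hu hu]
    refine ((hasSum_sum fun k _ => ((((hφ _ _).mul_left _).add (hφ _ _)).add (hφ _ _)).add
      (hφ _ _)).add (hφ _ _)).add ((hφ _ _).mul_left _) |>.congr_fun fun i => ?_
    rw [qLow_eq (hBu i) (hBu i)]
    simp only [comp_map (hB i) hu, kOp_map (hB i)]
    rfl
  refine hasSum_le (fun i => hgap _ (hBu i)) (hg.mul_left d)
    ((Complex.hasSum_re hq).sub ((hns u).mul_left _))

end Tensor

/-! ### Lower semicontinuity of the graph norms. -/

section LowerSemicontinuity

variable {F : Type} [NormedAddCommGroup F] [InnerProductSpace ℝ F] [FiniteDimensional ℝ F]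
  [MeasurableSpace F] [BorelSpace F] {P : Params} {c : Coord F}

/-- Fatou's lemma for multiplication operators. -/
theorem IsMul.exists_of_bounded {m : F → ℝ} {u w : ℕ → L2 F} {u' : L2 F} {C : ℝ}
    (h : ∀ n, IsMul m (u n) (w n)) (hu : Tendsto u atTop (𝓝 u')) (hC : ∀ n, ‖w n‖ ≤ C) :
    ∃ w', IsMul m u' w' ∧ ‖w'‖ ≤ C := by
  have hC0 : 0 ≤ C := (norm_nonneg _).trans (hC 0)
  obtain ⟨ns, hns, hae⟩ := exists_subseq_ae_tendsto hu
  have hlim : ∀ᵐ x, Tendsto (fun n => w (ns n) x) atTop (𝓝 ((m x : ℂ) * u' x)) := by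
    filter_upwards [hae, ae_all_iff.2 fun n => h (ns n)] with x h1 h2
    exact (h1.const_mul (m x : ℂ)).congr h2
  have hn : eLpNorm (fun x => (m x : ℂ) * u' x) 2 volume ≤ ENNReal.ofReal C := by
    refine (Lp.eLpNorm_lim_le_liminf_eLpNorm (fun n => Lp.aestronglyMeasurable (w (ns n))) _
      hlim).trans ?_
    refine liminf_le_of_frequently_le' (Frequently.of_forall fun n => ?_)
    rw [ENNReal.le_ofReal_iff_toReal_le (Lp.eLpNorm_ne_top _) hC0]
    exact hC (ns n)
  have hm : MemLp (fun x => (m x : ℂ) * u' x) 2 volume :=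
    ⟨aestronglyMeasurable_of_tendsto_ae atTop
      (fun n => Lp.aestronglyMeasurable (w (ns n))) hlim, hn.trans_lt ENNReal.ofReal_lt_top⟩
  refine ⟨_, isMul_mulOp hm, ?_⟩
  rw [mulOp, dif_pos hm, Lp.norm_toLp]
  exact ENNReal.toReal_le_of_le_ofReal hC0 hn

theorem IsP.exists_of_bounded {v : F} {u w : ℕ → L2 F} {u' : L2 F} {C : ℝ}
    (h : ∀ n, IsP v (u n) (w n)) (hu : Tendsto u atTop (𝓝 u')) (hC : ∀ n, ‖w n‖ ≤ C) :
    ∃ w', IsP v u' w' ∧ ‖w'‖ ≤ C := by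
  obtain ⟨y, hy, hyC⟩ := IsMul.exists_of_bounded (m := fun ξ => 2 * Real.pi * inner ℝ v ξ)
    (u := fun n => 𝓕 (u n)) (w := fun n => 𝓕 (w n)) h (tendsto_fourier_iff.2 hu)
    (fun n => by rw [Lp.norm_fourier_eq]; exact hC n)
  have e : (𝓕 (𝓕⁻ y : L2 F) : L2 F) = y := FourierTransform.fourier_fourierInv_eq y
  refine ⟨𝓕⁻ y, ?_, ?_⟩
  · unfold IsP
    rwa [e]
  · rwa [← Lp.norm_fourier_eq, e]

theorem IsComp.exists_of_bounded {j : CompIdx} {u w : ℕ → L2 F} {u' : L2 F} {C : ℝ}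
    (h : ∀ n, IsComp P c j (u n) (w n)) (hu : Tendsto u atTop (𝓝 u')) (hC : ∀ n, ‖w n‖ ≤ C) :
    ∃ w', IsComp P c j u' w' ∧ ‖w'‖ ≤ C := by
  rcases j with k | k | k
  · exact IsP.exists_of_bounded h hu hC
  · exact IsMul.exists_of_bounded h hu hC
  · exact IsMul.exists_of_bounded h hu hC

/-- If the bound failed infinitely often, Fatou's lemma along that subsequence would give the limit
a norm smaller than its own. -/
theorem IsComp.eventually_sub_le {j : CompIdx} {u w : ℕ → L2 F} {u' w' : L2 F}
    (h : ∀ n, IsComp P c j (u n) (w n)) (hu : Tendsto u atTop (𝓝 u'))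
    (hw : IsComp P c j u' w') {δ : ℝ} (hδ : 0 < δ) : ∀ᶠ n in atTop, ‖w'‖ ^ 2 - δ ≤ ‖w n‖ ^ 2 := by
  by_contra hn
  obtain ⟨φ, hφ, hφn⟩ := extraction_of_frequently_atTop (not_eventually.1 hn)
  simp only [not_le] at hφn
  have h0 : 0 ≤ ‖w'‖ ^ 2 - δ := (sq_nonneg _).trans (hφn 0).le
  obtain ⟨y, hy, hyC⟩ := IsComp.exists_of_bounded (u := u ∘ φ) (w := w ∘ φ)
    (C := Real.sqrt (‖w'‖ ^ 2 - δ)) (fun n => h (φ n)) (hu.comp hφ.tendsto_atTop)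
    (fun n => Real.le_sqrt_of_sq_le (hφn n).le)
  rw [← hy.comp_eq, hw.comp_eq] at hyC
  have := pow_le_pow_left₀ (norm_nonneg _) hyC 2
  rw [Real.sq_sqrt h0] at this
  linarith

/-- The vector `u` and its images under the operators `p_k`, `A_k`, `√V`. -/
def gcomp (P : Params) (c : Coord F) : Option CompIdx → L2 F → L2 F
  | none => id
  | some j => comp P c j

theorem graphSq_eq_sum (u : L2 F) : graphSq P c u = ∑ o, ‖gcomp P c o u‖ ^ 2 := by
  rw [Fintype.sum_option]
  rfl

theorem graphSq_nonneg (u : L2 F) : 0 ≤ graphSq P c u :=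
  add_nonneg (sq_nonneg _) (Finset.sum_nonneg fun _ _ => sq_nonneg _)

theorem norm_gcomp_sq_le (o : Option CompIdx) (u : L2 F) :
    ‖gcomp P c o u‖ ^ 2 ≤ graphSq P c u := by
  rw [graphSq_eq_sum]
  exact Finset.single_le_sum (f := fun o => ‖gcomp P c o u‖ ^ 2) (fun _ _ => sq_nonneg _)
    (Finset.mem_univ o)

theorem norm_sq_le_graphSq (u : L2 F) : ‖u‖ ^ 2 ≤ graphSq P c u := norm_gcomp_sq_le none u

theorem gcomp_map {c' : Coord F} {B : L2 F →L[ℂ] L2 F}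
    (hB : Intertwines c.pr c.e c'.pr c'.e B) {u : L2 F} (hu : u ∈ dom P c) (o : Option CompIdx) :
    gcomp P c' o (B u) = B (gcomp P c o u) := by
  rcases o with _ | j
  · rfl
  · exact comp_map hB hu j

theorem mem_dom_of_bounded {u : ℕ → L2 F} {u' : L2 F} {C : ℝ} (h : ∀ n, u n ∈ dom P c)
    (hu : Tendsto u atTop (𝓝 u')) (hC : ∀ n, graphSq P c (u n) ≤ C) : u' ∈ dom P c := by
  have hb : ∀ j n, ‖comp P c j (u n)‖ ≤ Real.sqrt C := fun j n =>
    Real.le_sqrt_of_sq_le ((norm_gcomp_sq_le (some j) (u n)).trans (hC n))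
  have := fun j => IsComp.exists_of_bounded (fun n => isComp_of_mem (h n) j) hu (hb j)
  choose w hw _ using this
  exact mem_formDomain_of_isComp w hw

theorem eventually_norm_gcomp_sub_le {u : ℕ → L2 F} {u' : L2 F} (h : ∀ n, u n ∈ dom P c)
    (hu : Tendsto u atTop (𝓝 u')) (hu' : u' ∈ dom P c) (o : Option CompIdx) {δ : ℝ} (hδ : 0 < δ) :
    ∀ᶠ n in atTop, ‖gcomp P c o u'‖ ^ 2 - δ ≤ ‖gcomp P c o (u n)‖ ^ 2 := by
  rcases o with _ | j
  · exact (hu.norm.pow 2).eventually_const_le (by simp [gcomp]; exact hδ)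
  · exact IsComp.eventually_sub_le (fun n => isComp_of_mem (h n) j) hu (isComp_of_mem hu' j) hδ

/-- Finitely many lower semicontinuity bounds hold simultaneously at a single index, where the bound
on the sum can be used. -/
theorem sum_le_of_eventually_sub_le {ι : Type*} (s : Finset ι) {x : ι → ℝ} {f : ι → ℕ → ℝ} {C : ℝ}
    (h : ∀ a ∈ s, ∀ δ > 0, ∀ᶠ n in atTop, x a - δ ≤ f a n) (hC : ∀ n, ∑ a ∈ s, f a n ≤ C) :
    ∑ a ∈ s, x a ≤ C := by
  refine le_of_forall_pos_le_add fun δ hδ => ?_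
  have h1 : ∀ᶠ n in atTop, ∀ a ∈ s, x a - δ / (s.card + 1) ≤ f a n :=
    (Finset.eventually_all s).2 fun a ha => h a ha _ (by positivity)
  obtain ⟨n, hn⟩ := h1.exists
  have h2 := (Finset.sum_le_sum hn).trans (hC n)
  rw [Finset.sum_sub_distrib, Finset.sum_const, nsmul_eq_mul] at h2
  have h3 : s.card * (δ / (s.card + 1)) ≤ δ := by
    rw [mul_div_assoc', div_le_iff₀ (by positivity)]
    nlinarith
  linarith

end LowerSemicontinuity

/-! ### The form of h̃. -/

section Tilde

variable {F : Type} [NormedAddCommGroup F] [InnerProductSpace ℝ F] [FiniteDimensional ℝ F]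
  [MeasurableSpace F] [BorelSpace F] {P : Params} {c : Coord F}

/-- The form of `h - (1 - ε) p² θ_s(p) - κ` in the coordinate `c`. -/
def qT (P : Params) (c : Coord F) (v u : L2 F) : ℂ := qLow P c v u - kap P * inner ℂ v u

theorem re_inner_self (v : L2 F) : (inner ℂ v v).re = ‖v‖ ^ 2 := inner_self_eq_norm_sq (𝕜 := ℂ) v

theorem re_qT_self (u : L2 F) : (qT P c u u).re = (qLow P c u u).re - kap P * ‖u‖ ^ 2 := by
  rw [qT, Complex.sub_re, Complex.re_ofReal_mul, re_inner_self]

theorem qT_add_right {v u u' : L2 F} (hv : v ∈ dom P c) (hu : u ∈ dom P c)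
    (hu' : u' ∈ dom P c) : qT P c v (u + u') = qT P c v u + qT P c v u' := by
  rw [qT, qT, qT, qLow_add_right hv hu hu', inner_add_right]
  ring

theorem qT_sub_right {v u u' : L2 F} (hv : v ∈ dom P c) (hu : u ∈ dom P c)
    (hu' : u' ∈ dom P c) : qT P c v (u - u') = qT P c v u - qT P c v u' := by
  rw [qT, qT, qT, qLow_sub_right hv hu hu', inner_sub_right]
  ring

theorem qT_smul_right {v u : L2 F} (hv : v ∈ dom P c) (hu : u ∈ dom P c) (z : ℂ) :
    qT P c v (z • u) = z * qT P c v u := by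
  rw [qT, qT, qLow_smul_right hv hu, inner_smul_right]
  ring

theorem qT_conj {v u : L2 F} (hv : v ∈ dom P c) (hu : u ∈ dom P c) :
    (starRingEnd ℂ) (qT P c v u) = qT P c u v := by
  rw [qT, qT, map_sub, map_mul, qLow_conj hv hu, Complex.conj_ofReal, inner_conj_symm]

theorem re_qT_comm {v u : L2 F} (hv : v ∈ dom P c) (hu : u ∈ dom P c) :
    (qT P c v u).re = (qT P c u v).re := by
  rw [← qT_conj hv hu, Complex.conj_re]

theorem qT_add_left {v v' u : L2 F} (hv : v ∈ dom P c) (hv' : v' ∈ dom P c)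
    (hu : u ∈ dom P c) : qT P c (v + v') u = qT P c v u + qT P c v' u := by
  rw [← qT_conj hu (add_mem hv hv'), qT_add_right hu hv hv', map_add, qT_conj hu hv,
    qT_conj hu hv']

theorem qT_smul_left {v u : L2 F} (hv : v ∈ dom P c) (hu : u ∈ dom P c) (z : ℂ) :
    qT P c (z • v) u = (starRingEnd ℂ) z * qT P c v u := by
  rw [← qT_conj hu (Submodule.smul_mem _ z hv), qT_smul_right hu hv, map_mul, qT_conj hu hv]

theorem qT_map {F' : Type} [NormedAddCommGroup F'] [InnerProductSpace ℝ F'] [FiniteDimensional ℝ F']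
    [MeasurableSpace F'] [BorelSpace F'] {c' : Coord F'} {B : L2 F →L[ℂ] L2 F'}
    (hB : Intertwines c.pr c.e c'.pr c'.e B)
    (hB' : Intertwines c'.pr c'.e c.pr c.e (ContinuousLinearMap.adjoint B)) {v : L2 F'} {u : L2 F}
    (hv : v ∈ dom P c') (hu : u ∈ dom P c) :
    qT P c' v (B u) = qT P c (ContinuousLinearMap.adjoint B v) u := by
  rw [qT, qT, qLow_map hB hB' hv hu, ContinuousLinearMap.adjoint_inner_left]

end Tilde

/-! ### Square roots of positive bounded operators. -/

section SquareRoot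

/-- The root is obtained by functional calculus, so it commutes with everything that commutes with
`T`. This property lets roots belonging to one particle act harmlessly on the others. -/
theorem exists_sqrt_of_isPositive {G : Type*} [NormedAddCommGroup G] [InnerProductSpace ℂ G]
    [CompleteSpace G] {T : G →L[ℂ] G} (hT : T.IsPositive) :
    ∃ S : G →L[ℂ] G, (∀ v u, inner ℂ (S v) u = inner ℂ v (S u)) ∧ (∀ u, S (S u) = T u) ∧
      ∀ B : G →L[ℂ] G, (∀ u, T (B u) = B (T u)) → ∀ u, S (B u) = B (S u) := by
  have h0 : 0 ≤ T := (ContinuousLinearMap.nonneg_iff_isPositive _).2 hT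
  refine ⟨CFC.sqrt T, fun v u => ?_, fun u => ?_, fun B hB u => ?_⟩
  · have : IsSelfAdjoint (CFC.sqrt T) :=
      ((ContinuousLinearMap.nonneg_iff_isPositive _).1 (CFC.sqrt_nonneg T)).isSelfAdjoint
    exact (ContinuousLinearMap.isSelfAdjoint_iff_isSymmetric.1 this) v u
  · have := CFC.sqrt_mul_sqrt_self T h0
    exact congrArg (fun T : G →L[ℂ] G => T u) this
  · have hc : Commute T B := by
      ext1 u
      exact hB u
    have := (hc.cfcₙ_nnreal NNReal.sqrt).eq
    exact congrArg (fun T : G →L[ℂ] G => T u) this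

end SquareRoot

/-! ### Yosida approximations of h̃. -/

section Yosida

variable {F : Type} [NormedAddCommGroup F] [InnerProductSpace ℝ F] [FiniteDimensional ℝ F]
  [MeasurableSpace F] [BorelSpace F] {P : Params} {c c' : Coord F} {n d : ℝ}
  {r : L2 F →L[ℂ] L2 F}

/-- `r = n (h̃ + n)⁻¹`. -/
structure IsYosida (P : Params) (c : Coord F) (n : ℝ) (r : L2 F →L[ℂ] L2 F) : Prop where
  mem : ∀ u, r u ∈ dom P c
  eq : ∀ u, ∀ v ∈ dom P c, qT P c v (r u) = n * inner ℂ v (u - r u)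

theorem exists_isYosida (hd : 0 < d)
    (hgap : ∀ u ∈ dom P c, d * graphSq P c u ≤ (qT P c u u).re) (hn : 0 < n) :
    ∃ r, IsYosida P c n r := by
  obtain ⟨S, hS⟩ := exists_resolvent (P := P) (c := c) (μ := n - kap P) hd (fun u hu => by
    have h1 := hgap u hu
    rw [re_qT_self] at h1
    nlinarith [sq_nonneg ‖u‖])
  refine ⟨(n : ℂ) • S, fun u => Submodule.smul_mem _ _ (hS u).1, fun u v hv => ?_⟩
  obtain ⟨h1, h2⟩ := hS u
  have h3 := h2 v hv
  rw [smul_apply, qT_smul_right hv h1, qT, inner_sub_right, inner_smul_right]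
  push_cast at h3
  linear_combination (n : ℂ) * h3

/-- The Yosida approximation `n (1 - r)` of `h̃`. -/
def yos (n : ℝ) (r : L2 F →L[ℂ] L2 F) : L2 F →L[ℂ] L2 F := (n : ℂ) • (1 - r)

theorem yos_apply (n : ℝ) (r : L2 F →L[ℂ] L2 F) (u : L2 F) : yos n r u = (n : ℂ) • (u - r u) := rfl

theorem IsYosida.qT_eq (h : IsYosida P c n r) {v : L2 F} (hv : v ∈ dom P c) (u : L2 F) :
    qT P c v (r u) = inner ℂ v (yos n r u) := by
  rw [h.eq u v hv, yos_apply, inner_smul_right]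

variable (hpos : ∀ u ∈ dom P c, 0 ≤ (qT P c u u).re)

include hpos in
theorem IsYosida.eq_apply (h : IsYosida P c n r) (hn : 0 < n) {u w : L2 F} (hw : w ∈ dom P c)
    (hq : ∀ v ∈ dom P c, qT P c v w = n * inner ℂ v (u - w)) : w = r u := by
  have hy : w - r u ∈ dom P c := sub_mem hw (h.mem u)
  have h1 := qT_sub_right hy hw (h.mem u)
  rw [hq _ hy, h.eq u _ hy, ← mul_sub, ← inner_sub_right,
    show u - w - (u - r u) = -(w - r u) by abel, inner_neg_right] at h1
  have h2 := hpos _ hy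
  rw [h1, Complex.re_ofReal_mul, Complex.neg_re, re_inner_self] at h2
  have h3 : ‖w - r u‖ ^ 2 ≤ 0 := by nlinarith
  exact sub_eq_zero.1 (norm_eq_zero.1 ((pow_eq_zero_iff two_ne_zero).1
    (le_antisymm h3 (sq_nonneg _))))

include hpos in
-- `B (r u)` solves the equation that characterizes `r (B u)`, and positivity of the form makes the
-- solution unique.
theorem IsYosida.comm (h : IsYosida P c n r) (hn : 0 < n) {B : L2 F →L[ℂ] L2 F}
    (hB : Intertwines c.pr c.e c.pr c.e B) (u : L2 F) : r (B u) = B (r u) := by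
  have hB' := hB.adjoint c.isCoord c.isCoord
  symm
  refine h.eq_apply hpos hn (mem_dom_map hB (h.mem u)) fun v hv => ?_
  rw [qT_map hB hB' hv (h.mem u), h.eq u _ (mem_dom_map hB' hv),
    ContinuousLinearMap.adjoint_inner_left, map_sub]

theorem IsYosida.symm (h : IsYosida P c n r) (hn : 0 < n) (v u : L2 F) :
    inner ℂ (r v) u = inner ℂ v (r u) := by
  have h1 := h.eq u (r v) (h.mem v)
  have h2 := h.eq v (r u) (h.mem u)
  rw [← qT_conj (h.mem v) (h.mem u), h1, map_mul, Complex.conj_ofReal] at h2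
  have h3 := mul_left_cancel₀ (Complex.ofReal_ne_zero.2 hn.ne') h2
  rw [inner_conj_symm, inner_sub_left, inner_sub_right, sub_left_inj] at h3
  rw [← inner_conj_symm, h3, inner_conj_symm]

theorem IsYosida.yos_symm (h : IsYosida P c n r) (hn : 0 < n) (v u : L2 F) :
    inner ℂ (yos n r v) u = inner ℂ v (yos n r u) := by
  rw [yos_apply, yos_apply, inner_smul_left, inner_smul_right, inner_sub_left, inner_sub_right,
    h.symm hn, Complex.conj_ofReal]

/-- Both terms on the right are used later: the first bounds the graph norm of `r u`, the second
shows that r u → u as n → ∞ when the left side stays bounded. -/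
theorem IsYosida.inner_yos (h : IsYosida P c n r) (u : L2 F) :
    inner ℂ u (yos n r u) = qT P c (r u) (r u) + n * ‖u - r u‖ ^ 2 := by
  have e : u = r u + (u - r u) := by abel
  conv_lhs => rw [e]
  rw [inner_add_left, h.qT_eq (h.mem u), ← e, yos_apply, inner_smul_right (u - r u),
    inner_self_eq_norm_sq_to_K (𝕜 := ℂ) (u - r u)]
  rfl

theorem IsYosida.re_inner_yos (h : IsYosida P c n r) (u : L2 F) :
    (inner ℂ u (yos n r u)).re = (qT P c (r u) (r u)).re + n * ‖u - r u‖ ^ 2 := by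
  rw [h.inner_yos, Complex.add_re, Complex.re_ofReal_mul]
  norm_cast

include hpos in
theorem IsYosida.isPositive (h : IsYosida P c n r) (hn : 0 < n) : (yos n r).IsPositive := by
  rw [ContinuousLinearMap.isPositive_def']
  refine ⟨?_, fun u => ?_⟩
  · rw [ContinuousLinearMap.isSelfAdjoint_iff_isSymmetric]
    exact fun v u => h.yos_symm hn v u
  · rw [ContinuousLinearMap.reApplyInnerSelf_apply, h.yos_symm hn]
    change 0 ≤ (inner ℂ u (yos n r u)).re
    rw [h.re_inner_yos]
    have := hpos _ (h.mem u)
    positivity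

include hpos in
-- With y = u - r u the difference of the two sides is n ‖y‖² + q(y, y) ≥ 0.
theorem IsYosida.re_inner_yos_le (h : IsYosida P c n r) (hn : 0 < n) {u : L2 F}
    (hu : u ∈ dom P c) : (inner ℂ u (yos n r u)).re ≤ (qT P c u u).re := by
  have hy : u - r u ∈ dom P c := sub_mem hu (h.mem u)
  have e1 : qT P c u u = qT P c u (r u) + qT P c u (u - r u) := by
    rw [← qT_add_right hu (h.mem u) hy]
    congr 1
    abel
  have e2 : qT P c u (u - r u) = qT P c (r u) (u - r u) + qT P c (u - r u) (u - r u) := by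
    rw [← qT_add_left (h.mem u) hy hy]
    congr 1
    abel
  rw [e1, e2, h.qT_eq hu, Complex.add_re, Complex.add_re, re_qT_comm (h.mem u) hy, h.eq u _ hy,
    Complex.re_ofReal_mul, re_inner_self]
  have := hpos _ hy
  have : 0 ≤ n * ‖u - r u‖ ^ 2 := by positivity
  linarith

theorem IsYosida.yos_mem (h : IsYosida P c n r) {u : L2 F} (hu : u ∈ dom P c) :
    yos n r u ∈ dom P c := Submodule.smul_mem _ _ (sub_mem hu (h.mem u))

include hpos in
-- The difference of the two sides is n q(y, y) with y = u - r u.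
theorem IsYosida.norm_yos_sq_le (h : IsYosida P c n r) (hn : 0 < n) {u : L2 F}
    (hu : u ∈ dom P c) : ‖yos n r u‖ ^ 2 ≤ (qT P c (yos n r u) u).re := by
  have hy : u - r u ∈ dom P c := sub_mem hu (h.mem u)
  have hY := h.yos_mem hu
  have e1 : qT P c (yos n r u) u = qT P c (yos n r u) (r u) + qT P c (yos n r u) (u - r u) := by
    rw [← qT_add_right hY (h.mem u) hy]
    congr 1
    abel
  have e2 : qT P c (yos n r u) (u - r u) = n * qT P c (u - r u) (u - r u) := by
    rw [yos_apply, qT_smul_left hy hy, Complex.conj_ofReal]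
  rw [e1, e2, h.qT_eq hY, Complex.add_re, Complex.re_ofReal_mul, re_inner_self]
  have := hpos _ hy
  have : 0 ≤ n * (qT P c (u - r u) (u - r u)).re := by positivity
  linarith

include hpos in
/-- The square root of the Yosida approximation. -/
theorem IsYosida.exists_sqrt (h : IsYosida P c n r) (hn : 0 < n) :
    ∃ S : L2 F →L[ℂ] L2 F, (∀ v u, inner ℂ (S v) u = inner ℂ v (S u)) ∧
      (∀ u, S (S u) = yos n r u) ∧
      ∀ B : L2 F →L[ℂ] L2 F, (∀ u, r (B u) = B (r u)) → ∀ u, S (B u) = B (S u) := by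
  obtain ⟨S, h1, h2, h3⟩ := exists_sqrt_of_isPositive (h.isPositive hpos hn)
  refine ⟨S, h1, h2, fun B hB => h3 B fun u => ?_⟩
  rw [yos_apply, yos_apply, map_smul, map_sub, hB]

end Yosida

/-! ### Commutation of operators acting on independent coordinates. -/

section Independent

variable {F : Type} [NormedAddCommGroup F] [InnerProductSpace ℝ F] [FiniteDimensional ℝ F]
  [MeasurableSpace F] [BorelSpace F] {P : Params} {c c' : Coord F}

/-- The coordinate `c` does not change under translations in the coordinate `c'`. -/
def Indep (c c' : Coord F) : Prop := ∀ x a, c.pr (x + c'.e a) = c.pr x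

theorem tr_comm (v w : F) (u : L2 F) : tr v (tr w u) = tr w (tr v u) := by
  rw [tr_tr, tr_tr, add_comm]

theorem tr_mulOp {m : F → ℝ} (hm : BddMeas m) {v : F} (h : ∀ x, m (x + v) = m x) (u : L2 F) :
    tr v (mulOp m u) = mulOp m (tr v u) := by
  symm
  apply IsMul.mulOp_eq
  filter_upwards [coeFn_tr v u, coeFn_tr v (mulOp m u), ae_add v (hm.isMul u)] with x h1 h2 h3
  rw [h1, h2, ← h3, h]

theorem mulOp_comm {m m' : F → ℝ} (hm : BddMeas m) (hm' : BddMeas m') (u : L2 F) :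
    mulOp m (mulOp m' u) = mulOp m' (mulOp m u) := by
  apply IsMul.mulOp_eq
  filter_upwards [hm'.isMul u, hm.isMul u, hm'.isMul (mulOp m u)] with x h1 h2 h3
  rw [← h3, ← h2, ← h1]
  ring

theorem Indep.intertwines_tr (h : Indep c c') (a : Space) :
    Intertwines c.pr c.e c.pr c.e (tr (c'.e a)) where
  map_tr b u := tr_comm _ _ u
  map_mul m hm u := tr_mulOp (hm.comp_pr c.isCoord) (fun x => by rw [h]) u

theorem Indep.intertwines_mul (h : Indep c' c) {m : Space → ℝ} (hm : BddMeas m) :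
    Intertwines c.pr c.e c.pr c.e (mulCLM _ (hm.comp_pr c'.isCoord)) where
  map_tr b u := (tr_mulOp (hm.comp_pr c'.isCoord) (fun x => by rw [h]) u).symm
  map_mul m' hm' u := mulOp_comm (hm.comp_pr c'.isCoord) (hm'.comp_pr c.isCoord) u

/-- What commutes with everything commuting with the coordinate `c` intertwines independent
coordinates. -/
theorem intertwines_of_comm (h1 : Indep c c') (h2 : Indep c' c) {r : L2 F →L[ℂ] L2 F}
    (hr : ∀ B : L2 F →L[ℂ] L2 F, Intertwines c.pr c.e c.pr c.e B → ∀ u, r (B u) = B (r u)) :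
    Intertwines c'.pr c'.e c'.pr c'.e r where
  map_tr a u := hr _ (h1.intertwines_tr a) u
  map_mul _ hm u := hr _ (h2.intertwines_mul hm) u

variable {n d : ℝ} {r r' S : L2 F →L[ℂ] L2 F}

theorem adjoint_eq_self_of_symm (hS : ∀ v u, inner ℂ (S v) u = inner ℂ v (S u)) :
    ContinuousLinearMap.adjoint S = S :=
  ((ContinuousLinearMap.eq_adjoint_iff S S).2 hS).symm

/-- The mixed form `q'(h Ψ, Ψ)`, `h` the Yosida approximation in an independent coordinate. -/
theorem IsYosida.le_qT_mixed (h : IsYosida P c n r) (h' : IsYosida P c' n r') (hn : 0 < n)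
    (hpos : ∀ u ∈ dom P c, 0 ≤ (qT P c u u).re)
    (hd : 0 ≤ d)
    (hgap : ∀ u ∈ dom P c', d * graphSq P c' u ≤ (qT P c' u u).re)
    (h1 : Indep c c') (h2 : Indep c' c) {Ψ : L2 F} (hΨ : Ψ ∈ dom P c') :
    yos n r Ψ ∈ dom P c' ∧
    (inner ℂ (yos n r Ψ) (yos n r' Ψ)).re ≤ (qT P c' (yos n r Ψ) Ψ).re ∧
      d * ∑ o, (inner ℂ (gcomp P c' o Ψ) (yos n r (gcomp P c' o Ψ))).re ≤
        (qT P c' (yos n r Ψ) Ψ).re := by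
  -- The mixed form becomes diagonal, q'(S Ψ, S Ψ), because the root `S` commutes with everything in
  -- the coordinate `c'`. Both lower bounds then follow from those for q' at the vector S Ψ.
  obtain ⟨S, hS1, hS2, hS3⟩ := h.exists_sqrt hpos hn
  have hSI : Intertwines c'.pr c'.e c'.pr c'.e S :=
    intertwines_of_comm h1 h2 fun B hB => hS3 B fun u => h.comm hpos hn hB u
  have hSI' : Intertwines c'.pr c'.e c'.pr c'.e (ContinuousLinearMap.adjoint S) := by
    rwa [adjoint_eq_self_of_symm hS1]
  have hSΨ : S Ψ ∈ dom P c' := mem_dom_map hSI hΨ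
  have e1 : qT P c' (yos n r Ψ) Ψ = qT P c' (S Ψ) (S Ψ) := by
    rw [qT_map hSI hSI' hSΨ hΨ, adjoint_eq_self_of_symm hS1, hS2]
  have hpos' : ∀ u ∈ dom P c', 0 ≤ (qT P c' u u).re := fun u hu =>
    (mul_nonneg hd (graphSq_nonneg u)).trans (hgap u hu)
  refine ⟨?_, ?_, ?_⟩
  · rw [← hS2]
    exact mem_dom_map hSI hSΨ
  · rw [e1]
    refine le_trans (le_of_eq ?_) (h'.re_inner_yos_le hpos' hn hSΨ)
    have h3 : r' (S Ψ) = S (r' Ψ) := h'.comm hpos' hn hSI Ψ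
    have e2 : yos n r' (S Ψ) = S (yos n r' Ψ) := by
      rw [yos_apply, yos_apply, h3, map_smul, map_sub]
    rw [e2, hS1, ← hS2 Ψ, hS1, hS1]
  · rw [e1]
    refine le_trans (le_of_eq ?_) (hgap _ hSΨ)
    rw [graphSq_eq_sum]
    congr 1
    refine Finset.sum_congr rfl fun o _ => ?_
    rw [gcomp_map hSI hΨ, ← re_inner_self, hS1, hS2]

end Independent

/-! ### The square of ∑ h̃_i controls the mixed products. -/

section Mixed

variable {F : Type} [NormedAddCommGroup F] [InnerProductSpace ℝ F] [FiniteDimensional ℝ F]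
  [MeasurableSpace F] [BorelSpace F] {P : Params} {d : ℝ}
  {ι : Type} [Fintype ι] [DecidableEq ι] {c : ι → Coord F}

/-- Formally this is (∑ h̃_i)² ≥ ∑_{i ≠ j} h̃_i h̃_j. As h̃_j Ψ need not be square integrable, one
factor is replaced by its Yosida approximation, which gives an admissible test vector. -/
theorem mixed_yos (hd : 0 < d) (hgap : ∀ i, ∀ u ∈ dom P (c i), d * graphSq P (c i) u ≤
      (qT P (c i) u u).re) (hc : ∀ i j, i ≠ j → Indep (c i) (c j)) {Ψ Θ : L2 F}
    (hΨ : ∀ i, Ψ ∈ dom P (c i))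
    (heq : ∀ v, (∀ i, v ∈ dom P (c i)) → ∑ i, qT P (c i) v Ψ = inner ℂ v Θ) {n : ℝ} (hn : 0 < n)
    {r : ι → L2 F →L[ℂ] L2 F} (hr : ∀ i, IsYosida P (c i) n (r i)) :
    d * ∑ i, ∑ j ∈ Finset.univ.filter (fun j => j ≠ i), ∑ o,
      (inner ℂ (gcomp P (c i) o Ψ) (yos n (r j) (gcomp P (c i) o Ψ))).re ≤ ‖Θ‖ ^ 2 := by
  have hpos : ∀ i, ∀ u ∈ dom P (c i), 0 ≤ (qT P (c i) u u).re := fun i u hu =>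
    (mul_nonneg hd.le (graphSq_nonneg u)).trans (hgap i u hu)
  let y : ι → L2 F := fun j => yos n (r j) Ψ
  have hy : ∀ i j, y j ∈ dom P (c i) := by
    intro i j
    by_cases hij : j = i
    · subst hij
      exact (hr j).yos_mem (hΨ j)
    · exact ((hr j).le_qT_mixed (hr i) hn (hpos j) hd.le (hgap i) (hc j i hij)
        (hc i j (Ne.symm hij)) (hΨ i)).1
  -- Testing with Y gives ‖Y‖² ≤ ∑_{i,j} Re q_i(y_j, Ψ) = Re ⟨Y, Θ⟩, hence ‖Y‖ ≤ ‖Θ‖, and the whole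
  -- double sum is at most ‖Θ‖².
  let Y : L2 F := ∑ j, y j
  have hY : ∀ i, Y ∈ dom P (c i) := fun i => Submodule.sum_mem _ fun j _ => hy i j
  have h1 := heq Y hY
  have e1 : ∀ i, qT P (c i) Y Ψ = ∑ j, qT P (c i) (y j) Ψ := by
    intro i
    have : ∀ s : Finset ι, qT P (c i) (∑ j ∈ s, y j) Ψ = ∑ j ∈ s, qT P (c i) (y j) Ψ := by
      intro s
      induction s using Finset.induction_on with
      | empty =>
        have := qT_smul_left (hΨ i) (hΨ i) 0
        simpa using this
      | insert a s ha ih =>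
        rw [Finset.sum_insert ha, Finset.sum_insert ha, qT_add_left (hy i a)
          (Submodule.sum_mem _ fun j _ => hy i j) (hΨ i), ih]
    exact this _
  simp_rw [e1] at h1
  have h2 : ∀ i j, (inner ℂ (y j) (y i)).re ≤ (qT P (c i) (y j) Ψ).re := by
    intro i j
    by_cases hij : j = i
    · subst hij
      rw [re_inner_self]
      exact (hr j).norm_yos_sq_le (hpos j) hn (hΨ j)
    · exact ((hr j).le_qT_mixed (hr i) hn (hpos j) hd.le (hgap i) (hc j i hij)
        (hc i j (Ne.symm hij)) (hΨ i)).2.1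
  have h3 : ‖Y‖ ^ 2 ≤ (inner ℂ Y Θ).re := by
    rw [← h1, Complex.re_sum]
    simp_rw [Complex.re_sum]
    rw [← re_inner_self]
    have : inner ℂ Y Y = ∑ i, ∑ j, inner ℂ (y j) (y i) := by
      simp only [Y, sum_inner, inner_sum]
    rw [this, Complex.re_sum]
    refine Finset.sum_le_sum fun i _ => ?_
    rw [Complex.re_sum]
    exact Finset.sum_le_sum fun j _ => h2 i j
  have h4 : (inner ℂ Y Θ).re ≤ ‖Y‖ * ‖Θ‖ :=
    (Complex.re_le_norm _).trans (norm_inner_le_norm _ _)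
  have h5 : ‖Y‖ ≤ ‖Θ‖ := by
    by_contra hlt
    push Not at hlt
    have := norm_nonneg Θ
    nlinarith
  have h6 : (inner ℂ Y Θ).re ≤ ‖Θ‖ ^ 2 := by
    have := norm_nonneg Θ
    nlinarith
  refine le_trans ?_ h6
  -- The diagonal terms are nonnegative and are dropped; each off-diagonal term is bounded below by
  -- the gap.
  rw [← h1, Complex.re_sum, Finset.mul_sum]
  refine Finset.sum_le_sum fun i _ => ?_
  rw [Complex.re_sum, ← Finset.sum_filter_add_sum_filter_not Finset.univ (fun j => j ≠ i),
    Finset.mul_sum]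
  refine le_trans ?_ (le_add_of_nonneg_right (Finset.sum_nonneg fun j hj => ?_))
  · refine Finset.sum_le_sum fun j hj => ?_
    have hij : j ≠ i := (Finset.mem_filter.1 hj).2
    exact ((hr j).le_qT_mixed (hr i) hn (hpos j) hd.le (hgap i) (hc j i hij)
        (hc i j (Ne.symm hij)) (hΨ i)).2.2
  · have hij : j = i := not_not.1 (Finset.mem_filter.1 hj).2
    subst hij
    refine le_trans ?_ (h2 j j)
    rw [re_inner_self]
    positivity

/-- The square of a sum of one-body operators controls the mixed products. -/
theorem mixed_bound (hd : 0 < d) (hgap : ∀ i, ∀ u ∈ dom P (c i), d * graphSq P (c i) u ≤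
      (qT P (c i) u u).re) (hc : ∀ i j, i ≠ j → Indep (c i) (c j)) {Ψ Θ : L2 F}
    (hΨ : ∀ i, Ψ ∈ dom P (c i))
    (heq : ∀ v, (∀ i, v ∈ dom P (c i)) → ∑ i, qT P (c i) v Ψ = inner ℂ v Θ) :
    (∀ i j, j ≠ i → ∀ o, gcomp P (c i) o Ψ ∈ dom P (c j)) ∧
      d ^ 2 * ∑ i, ∑ j ∈ Finset.univ.filter (fun j => j ≠ i), ∑ o,
        graphSq P (c j) (gcomp P (c i) o Ψ) ≤ ‖Θ‖ ^ 2 := by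
  have hpos : ∀ i, ∀ u ∈ dom P (c i), 0 ≤ (qT P (c i) u u).re := fun i u hu =>
    (mul_nonneg hd.le (graphSq_nonneg u)).trans (hgap i u hu)
  have hex : ∀ i, ∀ m : ℕ, ∃ r, IsYosida P (c i) ((m : ℝ) + 1) r := fun i m =>
    exists_isYosida hd (hgap i) (by positivity)
  choose r hr using hex
  have hm : ∀ m : ℕ, (0 : ℝ) < (m : ℝ) + 1 := fun m => by positivity
  have hb := fun m => mixed_yos hd hgap hc hΨ heq (hm m) fun i => hr i m
  have hnn : ∀ (m : ℕ) j w, 0 ≤ (inner ℂ w (yos ((m : ℝ) + 1) (r j m) w)).re := by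
    intro m j w
    rw [(hr j m).re_inner_yos]
    have := hpos j _ ((hr j m).mem w)
    positivity
  have hle : ∀ (m : ℕ) j w, d * graphSq P (c j) (r j m w) ≤
      (inner ℂ w (yos ((m : ℝ) + 1) (r j m) w)).re := by
    intro m j w
    rw [(hr j m).re_inner_yos]
    have h1 := hgap j _ ((hr j m).mem w)
    have h2 : 0 ≤ ((m : ℝ) + 1) * ‖w - r j m w‖ ^ 2 := by positivity
    linarith
  have hsingle : ∀ (m : ℕ) i j, j ≠ i → ∀ o,
      d * (inner ℂ (gcomp P (c i) o Ψ) (yos ((m : ℝ) + 1) (r j m) (gcomp P (c i) o Ψ))).re ≤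
        ‖Θ‖ ^ 2 := by
    intro m i j hij o
    refine le_trans (mul_le_mul_of_nonneg_left ?_ hd.le) (hb m)
    refine le_trans ?_ (Finset.single_le_sum (f := fun i => ∑ j ∈ Finset.univ.filter
      (fun j => j ≠ i), ∑ o, (inner ℂ (gcomp P (c i) o Ψ)
        (yos ((m : ℝ) + 1) (r j m) (gcomp P (c i) o Ψ))).re) (fun i _ => Finset.sum_nonneg
        fun j _ => Finset.sum_nonneg fun o _ => hnn m j _) (Finset.mem_univ i))
    refine le_trans ?_ (Finset.single_le_sum (f := fun j => ∑ o, (inner ℂ (gcomp P (c i) o Ψ)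
        (yos ((m : ℝ) + 1) (r j m) (gcomp P (c i) o Ψ))).re) (fun j _ => Finset.sum_nonneg
        fun o _ => hnn m j _) (Finset.mem_filter.2 ⟨Finset.mem_univ j, hij⟩))
    exact Finset.single_le_sum (f := fun o => (inner ℂ (gcomp P (c i) o Ψ)
        (yos ((m : ℝ) + 1) (r j m) (gcomp P (c i) o Ψ))).re) (fun o _ => hnn m j _)
        (Finset.mem_univ o)
  -- The Yosida form contains (m + 1) ‖w - r w‖², so its uniform bound forces r w → w at rate
  -- m^(-1/2).
  have hconv : ∀ i j, j ≠ i → ∀ o,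
      Tendsto (fun m => r j m (gcomp P (c i) o Ψ)) atTop (𝓝 (gcomp P (c i) o Ψ)) := by
    intro i j hij o
    set w := gcomp P (c i) o Ψ
    have h1 : ∀ m : ℕ, ‖r j m w - w‖ ^ 2 ≤ ‖Θ‖ ^ 2 / d * (1 / ((m : ℝ) + 1)) := by
      intro m
      have h2 := hsingle m i j hij o
      rw [(hr j m).re_inner_yos] at h2
      have h3 := hpos j _ ((hr j m).mem w)
      rw [norm_sub_rev, div_mul_div_comm, mul_one, le_div_iff₀ (mul_pos hd (hm m))]
      nlinarith
    rw [tendsto_iff_norm_sub_tendsto_zero]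
    have h4 : Tendsto (fun m : ℕ => ‖Θ‖ ^ 2 / d * (1 / ((m : ℝ) + 1))) atTop (𝓝 0) := by
      have := tendsto_one_div_add_atTop_nhds_zero_nat (𝕜 := ℝ)
      simpa using this.const_mul (‖Θ‖ ^ 2 / d)
    have h5 := squeeze_zero (fun m => sq_nonneg _) h1 h4
    have h6 := (Real.continuous_sqrt.tendsto 0).comp h5
    rw [Real.sqrt_zero] at h6
    exact h6.congr fun m => Real.sqrt_sq (norm_nonneg _)
  -- The resolvents `r j m w` have uniformly bounded graph norms and converge to `w`; lower
  -- semicontinuity puts `w` in the domain.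
  have hmem : ∀ i j, j ≠ i → ∀ o, gcomp P (c i) o Ψ ∈ dom P (c j) := by
    intro i j hij o
    refine mem_dom_of_bounded (C := ‖Θ‖ ^ 2 / d ^ 2) (fun m => (hr j m).mem (gcomp P (c i) o Ψ))
      (hconv i j hij o) fun m => ?_
    rw [le_div_iff₀ (by positivity)]
    have h1 := mul_le_mul_of_nonneg_left (hle m j (gcomp P (c i) o Ψ)) hd.le
    have h2 := hsingle m i j hij o
    nlinarith
  refine ⟨hmem, ?_⟩
  rw [mul_comm, ← le_div_iff₀ (by positivity)]
  have e : ∀ x : (i : ι) → (j : ι) → Option CompIdx → Option CompIdx → ℝ,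
      ∑ i, ∑ j ∈ Finset.univ.filter (fun j => j ≠ i), ∑ o, ∑ b, x i j o b =
      ∑ a ∈ (Finset.univ.sigma fun i : ι => Finset.univ.filter (fun j => j ≠ i)) ×ˢ
        (Finset.univ ×ˢ Finset.univ : Finset (Option CompIdx × Option CompIdx)),
        x a.1.1 a.1.2 a.2.1 a.2.2 := by
    intro x
    rw [Finset.sum_product, Finset.sum_sigma]
    refine Finset.sum_congr rfl fun i _ => Finset.sum_congr rfl fun j _ => ?_
    rw [Finset.sum_product]
  simp_rw [graphSq_eq_sum]
  rw [e]
  refine sum_le_of_eventually_sub_le _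
    (f := fun a m => ‖gcomp P (c a.1.2) a.2.2 (r a.1.2 m (gcomp P (c a.1.1) a.2.1 Ψ))‖ ^ 2)
    (fun a ha δ hδ => ?_) fun m => ?_
  · have hij : a.1.2 ≠ a.1.1 :=
      (Finset.mem_filter.1 (Finset.mem_sigma.1 (Finset.mem_product.1 ha).1).2).2
    exact eventually_norm_gcomp_sub_le (fun m => (hr a.1.2 m).mem _) (hconv _ _ hij a.2.1)
      (hmem _ _ hij _) a.2.2 hδ
  · rw [← e fun i j o b => ‖gcomp P (c j) b (r j m (gcomp P (c i) o Ψ))‖ ^ 2]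
    simp_rw [← graphSq_eq_sum]
    rw [le_div_iff₀ (by positivity)]
    refine le_trans ?_ (hb m)
    rw [mul_comm, sq, mul_assoc]
    refine mul_le_mul_of_nonneg_left ?_ hd.le
    simp_rw [Finset.mul_sum]
    exact Finset.sum_le_sum fun i _ => Finset.sum_le_sum fun j _ => Finset.sum_le_sum fun o _ =>
      hle m j _

end Mixed

/-! ### The form with a multiplication operator in one argument. -/

section ErrorTerm

variable {F : Type} [NormedAddCommGroup F] [InnerProductSpace ℝ F] [FiniteDimensional ℝ F]
  [MeasurableSpace F] [BorelSpace F] {P : Params} {c : Coord F}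

theorem IsMul.mulOp_right {m D : F → ℝ} (hD : BddMeas D) {u w : L2 F} (h : IsMul m u w) :
    IsMul m (mulOp D u) (mulOp D w) := by
  filter_upwards [h, hD.isMul u, hD.isMul w] with x h1 h2 h3
  rw [← h2, ← h3, ← h1]
  ring

theorem isComp_mul {Ψ : L2 F} (hΨ : Ψ ∈ dom P c) {D : F → ℝ} {D' : Fin 3 → F → ℝ}
    (hD : BddMeas D) (hD' : ∀ k, BddMeas (D' k))
    (hd : ∀ k x, HasDerivAt (fun t : ℝ => D (x + t • c.e (unitVec k))) (D' k x) 0) :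
    (∀ k, IsComp P c (Sum.inl k) (mulOp D Ψ) (mulOp D (comp P c (Sum.inl k) Ψ) -
      Complex.I • mulOp (D' k) Ψ)) ∧
    ∀ j, IsComp P c (Sum.inr j) (mulOp D Ψ) (mulOp D (comp P c (Sum.inr j) Ψ)) := by
  refine ⟨fun k => IsP.mul (isComp_of_mem hΨ (Sum.inl k)) hD (hD' k) (hd k), fun j => ?_⟩
  rcases j with k | k
  · exact IsMul.mulOp_right hD (isComp_of_mem hΨ (Sum.inr (Sum.inl k)))
  · exact IsMul.mulOp_right hD (isComp_of_mem hΨ (Sum.inr (Sum.inr k)))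

theorem mem_dom_mul {Ψ : L2 F} (hΨ : Ψ ∈ dom P c) {D : F → ℝ} {D' : Fin 3 → F → ℝ}
    (hD : BddMeas D) (hD' : ∀ k, BddMeas (D' k))
    (hd : ∀ k x, HasDerivAt (fun t : ℝ => D (x + t • c.e (unitVec k))) (D' k x) 0) :
    mulOp D Ψ ∈ dom P c := by
  obtain ⟨h1, h2⟩ := isComp_mul hΨ hD hD' hd
  refine mem_formDomain_iff.2 fun j => ?_
  rcases j with k | j
  · rw [(h1 k).comp_eq]; exact h1 k
  · rw [(h2 j).comp_eq]; exact h2 j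

/-- A weighted Cauchy–Schwarz inequality. -/
theorem norm_inner_mulOp_le {D b : F → ℝ} (hD : BddMeas D) (hb : BddMeas b) (hb0 : ∀ x, 0 ≤ b x)
    {α β₁ β₂ : ℝ} (hα : 0 ≤ α) (h : ∀ x, |D x| ≤ α * b x) {u w : L2 F}
    (hu : ∫ x, b x * ‖u x‖ ^ 2 ≤ β₁) (hw : ∫ x, b x * ‖w x‖ ^ 2 ≤ β₂) :
    ‖inner ℂ (mulOp D u) w‖ ≤ α * (Real.sqrt β₁ * Real.sqrt β₂) := by
  have hs : BddMeas (fun x => Real.sqrt (b x)) := by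
    obtain ⟨h1, C, hC⟩ := hb
    refine ⟨Real.continuous_sqrt.comp_aestronglyMeasurable h1, Real.sqrt C, fun x => ?_⟩
    rw [abs_of_nonneg (Real.sqrt_nonneg _)]
    exact Real.sqrt_le_sqrt ((le_abs_self _).trans (hC x))
  -- Where b = 0 the quotient is 0 by convention, which is consistent because D vanishes there too.
  let g : F → ℝ := fun x => D x / b x
  have hgα : ∀ x, |g x| ≤ α := by
    intro x
    simp only [g, abs_div, abs_of_nonneg (hb0 x)]
    exact div_le_of_le_mul₀ (hb0 x) hα (h x)
  have hg : BddMeas g := ⟨hD.1.div₀ hb.1, α, hgα⟩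
  have hDg : ∀ x, D x = Real.sqrt (b x) * (g x * Real.sqrt (b x)) := by
    intro x
    rcases eq_or_ne (b x) 0 with h0 | h0
    · have := h x
      rw [h0, mul_zero] at this
      rw [abs_nonpos_iff.1 this, h0]
      simp
    · simp only [g]
      rw [mul_left_comm, Real.mul_self_sqrt (hb0 x), div_mul_cancel₀ _ h0]
  have hn : ∀ v : L2 F, ‖mulOp (fun x => Real.sqrt (b x)) v‖ =
      Real.sqrt (∫ x, b x * ‖v x‖ ^ 2) := by
    intro v
    rw [← Real.sqrt_sq (norm_nonneg (mulOp (fun x => Real.sqrt (b x)) v)), (hs.isMul v).norm_sq]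
    congr 2
    ext x
    rw [Real.sq_sqrt (hb0 x)]
  have e : inner ℂ (mulOp D u) w = inner ℂ (mulOp g (mulOp (fun x => Real.sqrt (b x)) u))
      (mulOp (fun x => Real.sqrt (b x)) w) := by
    rw [inner_eq_integral, inner_eq_integral]
    refine integral_congr_ae ?_
    filter_upwards [hD.isMul u, hs.isMul u, hs.isMul w,
      hg.isMul (mulOp (fun x => Real.sqrt (b x)) u)] with x h1 h2 h3 h4
    rw [← h1, ← h4, ← h3, ← h2, hDg x]
    simp only [map_mul, Complex.conj_ofReal]
    push_cast
    ring
  rw [e]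
  refine (norm_inner_le_norm _ _).trans ?_
  have h1 := norm_mulOp_le hg hgα (mulOp (fun x => Real.sqrt (b x)) u)
  rw [hn] at h1
  rw [hn w]
  calc _ ≤ α * Real.sqrt (∫ x, b x * ‖u x‖ ^ 2) * Real.sqrt (∫ x, b x * ‖w x‖ ^ 2) := by gcongr
    _ ≤ α * Real.sqrt β₁ * Real.sqrt β₂ := by gcongr
    _ = _ := by ring

/-- The constant in the bound of the localization error. -/
def errConst (P : Params) : ℝ := 19 + 4 * P.s ^ 2 + |kap P|

theorem errConst_pos (P : Params) : 0 < errConst P := by unfold errConst; positivity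

/-- In q(D Ψ, Ψ) at most one derivative falls on `D`, and then the corresponding Ψ carries none.
This is why a separate, better bound β₀ for the undifferentiated Ψ is kept next to β. -/
theorem norm_qT_mul_le {Ψ : L2 F} (hΨ : Ψ ∈ dom P c) {D b : F → ℝ} {D' : Fin 3 → F → ℝ}
    (hD : BddMeas D) (hD' : ∀ k, BddMeas (D' k))
    (hd : ∀ k x, HasDerivAt (fun t : ℝ => D (x + t • c.e (unitVec k))) (D' k x) 0)
    (hb : BddMeas b) (hb0 : ∀ x, 0 ≤ b x) {α α' β β₀ : ℝ} (hα : 0 ≤ α) (hα' : 0 ≤ α')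
    (h : ∀ x, |D x| ≤ α * b x) (h' : ∀ k x, |D' k x| ≤ α' * b x) (hβ : 0 ≤ β)
    (hg : ∀ o, ∫ x, b x * ‖gcomp P c o Ψ x‖ ^ 2 ≤ β)
    (hK : ∫ x, b x * ‖kOp P c Ψ x‖ ^ 2 ≤ (4 * P.s ^ 2) ^ 2 * β)
    (hβ₀ : ∫ x, b x * ‖Ψ x‖ ^ 2 ≤ β₀) :
    ‖qT P c (mulOp D Ψ) Ψ‖ ≤ errConst P * (α * β + α' * (Real.sqrt β₀ * Real.sqrt β)) := by
  obtain ⟨h1, h2⟩ := isComp_mul hΨ hD hD' hd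
  have hmem := mem_dom_mul hΨ hD hD' hd
  set Q := α * β + α' * (Real.sqrt β₀ * Real.sqrt β) with hQ
  have hQ1 : α * β ≤ Q := le_add_of_nonneg_right (by positivity)
  have hQ2 : α' * (Real.sqrt β₀ * Real.sqrt β) ≤ Q := le_add_of_nonneg_left (by positivity)
  have a1 : ∀ o o', ‖inner ℂ (mulOp D (gcomp P c o Ψ)) (gcomp P c o' Ψ)‖ ≤ Q := fun o o' => by
    refine (norm_inner_mulOp_le hD hb hb0 hα h (hg o) (hg o')).trans ?_
    rwa [Real.mul_self_sqrt hβ]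
  have a2 : ∀ k o, ‖inner ℂ (mulOp D (comp P c (Sum.inl k) Ψ) - Complex.I • mulOp (D' k) Ψ)
      (gcomp P c o Ψ)‖ ≤ 2 * Q := fun k o => by
    rw [inner_sub_left, inner_smul_left]
    refine (norm_sub_le _ _).trans ?_
    rw [norm_mul, RCLike.norm_conj, Complex.norm_I, one_mul]
    have b1 := a1 (some (Sum.inl k)) o
    have b2 := (norm_inner_mulOp_le (hD' k) hb hb0 hα' (h' k) hβ₀ (hg o)).trans hQ2
    change ‖inner ℂ (mulOp D (comp P c (Sum.inl k) Ψ)) (gcomp P c o Ψ)‖ ≤ Q at b1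
    linarith
  have a3 : ‖inner ℂ (mulOp D Ψ) (kOp P c Ψ)‖ ≤ 4 * P.s ^ 2 * Q := by
    refine (norm_inner_mulOp_le hD hb hb0 hα h (hg none) hK).trans ?_
    rw [Real.sqrt_mul (by positivity), Real.sqrt_sq (by positivity), mul_left_comm (Real.sqrt β),
      Real.mul_self_sqrt hβ, mul_left_comm]
    gcongr
  have hε := P.ε_pos
  have hε1 := P.ε_lt
  rw [qT, qLow_eq hmem hΨ]
  simp only [(h1 _).comp_eq, (h2 _).comp_eq]
  have n1 : ‖(P.ε : ℂ)‖ ≤ 1 := by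
    rw [Complex.norm_real, Real.norm_of_nonneg hε.le]; exact hε1.le
  have n2 : ‖((1 - P.ε : ℝ) : ℂ)‖ ≤ 1 := by
    rw [Complex.norm_real, Real.norm_of_nonneg (by linarith)]; linarith
  have t1 : ∀ k, ‖(P.ε : ℂ) * inner ℂ (mulOp D (comp P c (Sum.inl k) Ψ) -
        Complex.I • mulOp (D' k) Ψ) (comp P c (Sum.inl k) Ψ) +
      inner ℂ (mulOp D (comp P c (Sum.inl k) Ψ) - Complex.I • mulOp (D' k) Ψ)
        (comp P c (Sum.inr (Sum.inl k)) Ψ) +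
      inner ℂ (mulOp D (comp P c (Sum.inr (Sum.inl k)) Ψ)) (comp P c (Sum.inl k) Ψ) +
      inner ℂ (mulOp D (comp P c (Sum.inr (Sum.inl k)) Ψ))
        (comp P c (Sum.inr (Sum.inl k)) Ψ)‖ ≤ 6 * Q := by
    intro k
    have b1 := a2 k (some (Sum.inl k))
    have b2 := a2 k (some (Sum.inr (Sum.inl k)))
    have b3 := a1 (some (Sum.inr (Sum.inl k))) (some (Sum.inl k))
    have b4 := a1 (some (Sum.inr (Sum.inl k))) (some (Sum.inr (Sum.inl k)))
    have b0 : ‖(P.ε : ℂ) * inner ℂ (mulOp D (comp P c (Sum.inl k) Ψ) -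
        Complex.I • mulOp (D' k) Ψ) (comp P c (Sum.inl k) Ψ)‖ ≤ 2 * Q := by
      rw [norm_mul]
      exact (mul_le_of_le_one_left (norm_nonneg _) n1).trans b1
    refine (norm_add_le _ _).trans ?_
    refine (add_le_add_left (norm_add_le _ _) _).trans ?_
    refine (add_le_add_left (add_le_add_left (norm_add_le _ _) _) _).trans ?_
    simp only [gcomp] at b2 b3 b4
    linarith
  have t2 : ‖∑ k, ((P.ε : ℂ) * inner ℂ (mulOp D (comp P c (Sum.inl k) Ψ) -
        Complex.I • mulOp (D' k) Ψ) (comp P c (Sum.inl k) Ψ) +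
      inner ℂ (mulOp D (comp P c (Sum.inl k) Ψ) - Complex.I • mulOp (D' k) Ψ)
        (comp P c (Sum.inr (Sum.inl k)) Ψ) +
      inner ℂ (mulOp D (comp P c (Sum.inr (Sum.inl k)) Ψ)) (comp P c (Sum.inl k) Ψ) +
      inner ℂ (mulOp D (comp P c (Sum.inr (Sum.inl k)) Ψ))
        (comp P c (Sum.inr (Sum.inl k)) Ψ))‖ ≤ 18 * Q := by
    refine (norm_sum_le _ _).trans ((Finset.sum_le_sum fun k _ => t1 k).trans (le_of_eq ?_))
    rw [Finset.sum_const, Finset.card_univ, Fintype.card_fin, nsmul_eq_mul]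
    push_cast
    ring
  have t3 := a1 (some (Sum.inr (Sum.inr ()))) (some (Sum.inr (Sum.inr ())))
  have t4 : ‖((1 - P.ε : ℝ) : ℂ) * inner ℂ (mulOp D Ψ) (kOp P c Ψ)‖ ≤ 4 * P.s ^ 2 * Q := by
    rw [norm_mul]
    exact (mul_le_of_le_one_left (norm_nonneg _) n2).trans a3
  have t5 : ‖(kap P : ℂ) * inner ℂ (mulOp D Ψ) Ψ‖ ≤ |kap P| * Q := by
    rw [norm_mul, Complex.norm_real, Real.norm_eq_abs]
    gcongr
    exact a1 none none
  -- The constant collects 18 from the three directions (each 2 + 2 + 1 + 1, as the momentum of D Ψ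
  -- has two terms), 1 from V, 4s² from the low-momentum operator and |κ|.
  refine (norm_sub_le _ _).trans ?_
  refine (add_le_add_left (norm_add_le _ _) _).trans ?_
  refine (add_le_add_left (add_le_add_left (norm_add_le _ _) _) _).trans ?_
  simp only [gcomp] at t3
  unfold errConst
  linarith

theorem BddMeas.sqrt {b : F → ℝ} (hb : BddMeas b) : BddMeas (fun x => Real.sqrt (b x)) := by
  obtain ⟨h1, C, hC⟩ := hb
  refine ⟨Real.continuous_sqrt.comp_aestronglyMeasurable h1, Real.sqrt C, fun x => ?_⟩
  rw [abs_of_nonneg (Real.sqrt_nonneg _)]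
  exact Real.sqrt_le_sqrt ((le_abs_self _).trans (hC x))

/-- Multiplication by a function independent of the coordinate `c`. -/
theorem intertwines_mulCLM {G : F → ℝ} (hG : BddMeas G) (hinv : ∀ x a, G (x + c.e a) = G x) :
    Intertwines c.pr c.e c.pr c.e (mulCLM G hG) where
  map_tr a u := (tr_mulOp hG (fun x => hinv x a) u).symm
  map_mul _ hm u := mulOp_comm hG (hm.comp_pr c.isCoord) u

/-- As `G` does not depend on the coordinate `c`, its root commutes with h̃, so q(G Ψ, Ψ) = q(√G Ψ,
√G Ψ) and the gap applies. -/
theorem le_re_qT_mul {d : ℝ} (hgap : ∀ u ∈ dom P c, d * graphSq P c u ≤ (qT P c u u).re)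
    {Ψ : L2 F} (hΨ : Ψ ∈ dom P c) {G : F → ℝ} (hG : BddMeas G) (hG0 : ∀ x, 0 ≤ G x)
    (hinv : ∀ x a, G (x + c.e a) = G x) :
    mulOp G Ψ ∈ dom P c ∧
    d * ∑ o, ∫ x, G x * ‖gcomp P c o Ψ x‖ ^ 2 ≤ (qT P c (mulOp G Ψ) Ψ).re := by
  have hI := intertwines_mulCLM (c := c) hG.sqrt (fun x a => by rw [hinv])
  set S := mulCLM _ hG.sqrt with hS
  have hadj : ContinuousLinearMap.adjoint S = S := adjoint_mulCLM hG.sqrt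
  have hI' : Intertwines c.pr c.e c.pr c.e (ContinuousLinearMap.adjoint S) := by rwa [hadj]
  have hSΨ : S Ψ ∈ dom P c := mem_dom_map hI hΨ
  have hSS : S (S Ψ) = mulOp G Ψ := by
    symm
    rw [hS, mulCLM_apply, mulCLM_apply]
    apply IsMul.mulOp_eq
    filter_upwards [hG.sqrt.isMul Ψ, hG.sqrt.isMul (mulOp (fun x => Real.sqrt (G x)) Ψ)]
      with x h1 h2
    rw [← h2, ← h1, ← mul_assoc, ← Complex.ofReal_mul, Real.mul_self_sqrt (hG0 x)]
  refine ⟨hSS ▸ mem_dom_map hI hSΨ, ?_⟩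
  have e1 : qT P c (mulOp G Ψ) Ψ = qT P c (S Ψ) (S Ψ) := by
    rw [qT_map hI hI' hSΨ hΨ, hadj, hSS]
  rw [e1]
  refine le_trans (le_of_eq ?_) (hgap _ hSΨ)
  rw [graphSq_eq_sum]
  congr 1
  refine Finset.sum_congr rfl fun o _ => ?_
  rw [gcomp_map hI hΨ, hS, mulCLM_apply, (hG.sqrt.isMul _).norm_sq]
  congr 1
  ext x
  rw [Real.sq_sqrt (hG0 x)]

end ErrorTerm

/-! ### Particle coordinates and densities of close pairs. -/

section Config

variable {N : ℕ} {P : Params}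

/-- The configuration with `a` at the `j`-th place. -/
def sing (j : Fin N) (a : Space) : Config N := PiLp.single 2 (β := fun _ : Fin N => Space) j a

theorem sing_same (j : Fin N) (a : Space) : sing j a j = a :=
  PiLp.single_eq_same (β := fun _ : Fin N => Space) 2 j a

theorem sing_of_ne {i j : Fin N} (h : i ≠ j) (a : Space) : sing j a i = 0 :=
  PiLp.single_eq_of_ne (β := fun _ : Fin N => Space) 2 h a

/-- The position of the `j`-th particle as a coordinate. -/
def cj (j : Fin N) : Coord (Config N) where
  pr := fun x => x j
  e :=
    { toFun := sing j
      map_add' := fun a b => PiLp.single_add 2 j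
      map_smul' := fun r a => by
        ext i : 1
        by_cases h : i = j
        · subst h
          rw [sing_same, PiLp.smul_apply, sing_same]
          rfl
        · rw [sing_of_ne h, PiLp.smul_apply, sing_of_ne h, smul_zero]
      norm_map' := fun a => by
        rw [← sq_eq_sq₀ (norm_nonneg _) (norm_nonneg _)]
        change ‖sing j a‖ ^ 2 = _
        rw [PiLp.norm_sq_eq_of_L2, Finset.sum_eq_single j]
        · rw [sing_same]
        · intro i _ hi
          rw [sing_of_ne hi, norm_zero, zero_pow two_ne_zero]
        · simp }
  isCoord := fun a ξ => by
    change inner ℝ (sing j a) ξ = _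
    rw [PiLp.inner_apply, Finset.sum_eq_single j]
    · rw [sing_same]
    · intro i _ hi
      rw [sing_of_ne hi, inner_zero_left]
    · simp

theorem add_e_same (j : Fin N) (x : Config N) (a : Space) : (x + (cj j).e a) j = x j + a := by
  change x j + sing j a j = _
  rw [sing_same]

theorem add_e_of_ne {i j : Fin N} (h : i ≠ j) (x : Config N) (a : Space) :
    (x + (cj j).e a) i = x i := by
  change x i + sing j a i = _
  rw [sing_of_ne h, add_zero]

theorem indep_cj {i j : Fin N} (h : i ≠ j) : Indep (cj i) (cj j) := fun x a => add_e_of_ne h x a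

theorem sub_add_smul_e {j l : Fin N} (h : j ≠ l) (x : Config N) (k : Fin 3) (t : ℝ) :
    (x + t • (cj j).e (unitVec k)) j - (x + t • (cj j).e (unitVec k)) l =
      x j - x l + t • unitVec k := by
  rw [← map_smul, add_e_same, add_e_of_ne h.symm]
  abel

theorem continuous_coord (i : Fin N) : Continuous (fun x : Config N => x i) :=
  (cj i).isCoord.continuous

theorem continuous_sub_coord (i j : Fin N) : Continuous (fun x : Config N => x i - x j) :=
  (continuous_coord i).sub (continuous_coord j)

theorem near_pair_le {j l : Fin N} (h : j ≠ l) {r : ℝ} (hr : 0 < r) {u : L2 (Config N)}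
    (hu : u ∈ dom P (cj j)) :
    ∫ x, near r (x j - x l) * ‖u x‖ ^ 2 ≤
      8 * r ^ 2 * ∑ k, ‖comp P (cj j) (Sum.inl k) u‖ ^ 2 :=
  hardy_ball hr (continuous_sub_coord j l) (v := fun k => (cj j).e (unitVec k))
    (fun x k t => sub_add_smul_e h x k t) fun k => isComp_of_mem hu (Sum.inl k)

theorem sum_mom_le_graphSq {F : Type} [NormedAddCommGroup F] [InnerProductSpace ℝ F]
    [FiniteDimensional ℝ F] [MeasurableSpace F] [BorelSpace F] {c : Coord F} (u : L2 F) :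
    ∑ k, ‖comp P c (Sum.inl k) u‖ ^ 2 ≤ graphSq P c u := by
  rw [graphSq_eq]
  have h1 : 0 ≤ ∑ k, ‖comp P c (Sum.inr (Sum.inl k)) u‖ ^ 2 :=
    Finset.sum_nonneg fun _ _ => sq_nonneg _
  have h2 := sq_nonneg ‖u‖
  have h3 := sq_nonneg ‖comp P c (Sum.inr (Sum.inr ())) u‖
  linarith

/-- The mixed graph norm of the particles `l` and `j`. -/
def mix (P : Params) (Ψ : L2 (Config N)) (l j : Fin N) : ℝ :=
  ∑ o, graphSq P (cj j) (gcomp P (cj l) o Ψ)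

theorem mix_nonneg (Ψ : L2 (Config N)) (l j : Fin N) : 0 ≤ mix P Ψ l j :=
  Finset.sum_nonneg fun _ _ => graphSq_nonneg _

theorem graphSq_le_mix (Ψ : L2 (Config N)) (l j : Fin N) (o : Option CompIdx) :
    graphSq P (cj j) (gcomp P (cj l) o Ψ) ≤ mix P Ψ l j :=
  Finset.single_le_sum (f := fun o => graphSq P (cj j) (gcomp P (cj l) o Ψ))
    (fun _ _ => graphSq_nonneg _) (Finset.mem_univ o)

/-- The pair density at distance `r` is controlled by the mixed derivatives. -/
theorem near_pair_le_mix {j l : Fin N} (h : j ≠ l) {r : ℝ} (hr : 0 < r) {Ψ : L2 (Config N)}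
    (hl : Ψ ∈ dom P (cj l)) (hj : ∀ o, gcomp P (cj l) o Ψ ∈ dom P (cj j)) :
    ∫ x, near r (x j - x l) * ‖Ψ x‖ ^ 2 ≤ 24 * r ^ 3 * mix P Ψ l j := by
  have hΨj : Ψ ∈ dom P (cj j) := hj none
  have h1 := mixed_ball hr (continuous_sub_coord l j) (v := fun k => (cj l).e (unitVec k))
    (v' := fun k => (cj j).e (unitVec k)) (fun x k t => sub_add_smul_e h.symm x k t)
    (fun x k t => by rw [← neg_sub, sub_add_smul_e h x k t]; abel)
    (fun k => isComp_of_mem hl (Sum.inl k)) (fun k => isComp_of_mem hΨj (Sum.inl k))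
    (fun k m => isComp_of_mem (hj (some (Sum.inl k))) (Sum.inl m))
  have e : ∀ x : Config N, near r (x j - x l) = near r (x l - x j) := fun x => by
    rw [← near_neg, neg_sub]
  simp_rw [e]
  refine h1.trans (mul_le_mul_of_nonneg_left ?_ (by positivity))
  unfold mix
  rw [Fintype.sum_option, Fintype.sum_sum_type]
  refine add_le_add (sum_mom_le_graphSq _) ?_
  refine (Finset.sum_le_sum fun k _ => sum_mom_le_graphSq _).trans
    (le_add_of_nonneg_right (Finset.sum_nonneg fun _ _ => graphSq_nonneg _))

/-- The number of particles near the particle `l`. -/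
def crowd (R : ℝ) (l : Fin N) (x : Config N) : ℝ :=
  ∑ j ∈ Finset.univ.filter (fun j => j ≠ l), near (4 * R) (x j - x l)

theorem crowd_nonneg (R : ℝ) (l : Fin N) (x : Config N) : 0 ≤ crowd R l x :=
  Finset.sum_nonneg fun _ _ => near_nonneg _ _

theorem bddMeas_crowd (R : ℝ) (l : Fin N) : BddMeas (crowd R l) :=
  BddMeas.sum fun j _ => bddMeas_near (4 * R) (continuous_sub_coord j l)

theorem integral_crowd (R : ℝ) (l : Fin N) (u : L2 (Config N)) :
    ∫ x, crowd R l x * ‖u x‖ ^ 2 =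
      ∑ j ∈ Finset.univ.filter (fun j => j ≠ l), ∫ x, near (4 * R) (x j - x l) * ‖u x‖ ^ 2 := by
  rw [← integral_finsetSum _ fun j _ =>
    (bddMeas_near (4 * R) (continuous_sub_coord j l)).integrable u]
  congr 1
  ext x
  rw [crowd, Finset.sum_mul]

/-- The total mixed graph norm of the particle `l` with the others. -/
def mixAll (P : Params) (Ψ : L2 (Config N)) (l : Fin N) : ℝ :=
  ∑ j ∈ Finset.univ.filter (fun j => j ≠ l), mix P Ψ l j

theorem mixAll_nonneg (Ψ : L2 (Config N)) (l : Fin N) : 0 ≤ mixAll P Ψ l :=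
  Finset.sum_nonneg fun _ _ => mix_nonneg _ _ _

/-- The localization error for a function of the particle `l` living where `l` is near another
particle. -/
theorem norm_qT_mul_le_mixAll {R : ℝ} (hR : 0 < R) {l : Fin N} {Ψ : L2 (Config N)}
    (hl : Ψ ∈ dom P (cj l)) (hj : ∀ j, j ≠ l → ∀ o, gcomp P (cj l) o Ψ ∈ dom P (cj j))
    {D : Config N → ℝ} {D' : Fin 3 → Config N → ℝ} (hD : BddMeas D) (hD' : ∀ k, BddMeas (D' k))
    (hd : ∀ k x, HasDerivAt (fun t : ℝ => D (x + t • (cj l).e (unitVec k))) (D' k x) 0)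
    {K : ℝ} (hK : 0 ≤ K) (h : ∀ x, |D x| ≤ K * (R ^ 3)⁻¹ * crowd R l x)
    (h' : ∀ k x, |D' k x| ≤ K * (R ^ 4)⁻¹ * crowd R l x) :
    ‖qT P (cj l) (mulOp D Ψ) Ψ‖ ≤
      444 * errConst P * K * (R⁻¹ + Real.sqrt R / R ^ 2) * mixAll P Ψ l := by
  have hM := mixAll_nonneg (P := P) Ψ l
  set M := mixAll P Ψ l with hMdef
  -- Hardy's inequality in the variable x_j of the other particle, at radius 4R: 8 (4R)² = 128 R².
  -- The derivative in x_l is already contained in `gcomp`.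
  have hβ : ∀ o, ∫ x, crowd R l x * ‖gcomp P (cj l) o Ψ x‖ ^ 2 ≤ 128 * R ^ 2 * M := by
    intro o
    rw [integral_crowd, hMdef, mixAll, Finset.mul_sum]
    refine Finset.sum_le_sum fun j hjl => ?_
    have hjl' : j ≠ l := (Finset.mem_filter.1 hjl).2
    have h1 := near_pair_le hjl' (by positivity : (0 : ℝ) < 4 * R) (hj j hjl' o)
    have h2 := (sum_mom_le_graphSq (P := P) (c := cj j) (gcomp P (cj l) o Ψ)).trans
      (graphSq_le_mix Ψ l j o)
    have h3 : 8 * (4 * R) ^ 2 * ∑ k, ‖comp P (cj j) (Sum.inl k) (gcomp P (cj l) o Ψ)‖ ^ 2 ≤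
      8 * (4 * R) ^ 2 * mix P Ψ l j := by gcongr
    calc _ ≤ _ := h1.trans h3
      _ = _ := by ring
  -- Without a derivative on Ψ both particles are available and the full volume factor 24 (4R)³ is
  -- gained. With only R² here the error would be of order R⁻², which R N^(2/3) → ∞ does not
  -- control.
  have hβ₀ : ∫ x, crowd R l x * ‖Ψ x‖ ^ 2 ≤ 1536 * R ^ 3 * M := by
    rw [integral_crowd, hMdef, mixAll, Finset.mul_sum]
    refine Finset.sum_le_sum fun j hjl => ?_
    have hjl' : j ≠ l := (Finset.mem_filter.1 hjl).2
    have h1 := near_pair_le_mix hjl' (by positivity : (0 : ℝ) < 4 * R) hl (hj j hjl')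
    refine h1.trans (le_of_eq ?_)
    ring
  -- The low-momentum operator of particle l is a Fourier multiplier and commutes with the momentum
  -- of particle j, so Hardy's inequality in x_j survives.
  have hβK : ∫ x, crowd R l x * ‖kOp P (cj l) Ψ x‖ ^ 2 ≤
      (4 * P.s ^ 2) ^ 2 * (128 * R ^ 2 * M) := by
    rw [integral_crowd, hMdef, mixAll, Finset.mul_sum, Finset.mul_sum]
    refine Finset.sum_le_sum fun j hjl => ?_
    have hjl' : j ≠ l := (Finset.mem_filter.1 hjl).2
    have hΨj : Ψ ∈ dom P (cj j) := hj j hjl' none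
    have h1 := hardy_ball (by positivity : (0 : ℝ) < 4 * R) (continuous_sub_coord j l)
      (v := fun k => (cj j).e (unitVec k)) (fun x k t => sub_add_smul_e hjl' x k t)
      (fun k => IsP.fmul (bddMeas_lowSym P.heav P.s_pos (cj l).isCoord)
        (isComp_of_mem hΨj (Sum.inl k)))
    have h2 : ∀ k, ‖kOp P (cj l) (comp P (cj j) (Sum.inl k) Ψ)‖ ^ 2 ≤
        (4 * P.s ^ 2) ^ 2 * ‖comp P (cj j) (Sum.inl k) Ψ‖ ^ 2 := fun k => by
      rw [← mul_pow]
      gcongr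
      exact norm_kOp_le _
    have h3 := (sum_mom_le_graphSq (P := P) (c := cj j) Ψ).trans (graphSq_le_mix Ψ l j none)
    calc _ ≤ 8 * (4 * R) ^ 2 * ∑ k, ‖kOp P (cj l) (comp P (cj j) (Sum.inl k) Ψ)‖ ^ 2 := h1
      _ ≤ 8 * (4 * R) ^ 2 * ∑ k, (4 * P.s ^ 2) ^ 2 * ‖comp P (cj j) (Sum.inl k) Ψ‖ ^ 2 := by
        gcongr with k
        exact h2 k
      _ = 8 * (4 * R) ^ 2 * ((4 * P.s ^ 2) ^ 2 * ∑ k, ‖comp P (cj j) (Sum.inl k) Ψ‖ ^ 2) := by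
        rw [Finset.mul_sum _ _ ((4 * P.s ^ 2) ^ 2)]
      _ ≤ 8 * (4 * R) ^ 2 * ((4 * P.s ^ 2) ^ 2 * mix P Ψ l j) := by gcongr
      _ = _ := by ring
  refine (norm_qT_mul_le hl hD hD' hd (bddMeas_crowd R l) (crowd_nonneg R l)
    (by positivity) (by positivity) h h' (by positivity) hβ hβK hβ₀).trans ?_
  have hC := errConst_pos P
  -- Here 444² = 197136 exceeds 1536 · 128 = 196608, and R^(5/2) is written R² √R; divided by R⁴ it
  -- yields √R / R².
  have hs : Real.sqrt (1536 * R ^ 3 * M) * Real.sqrt (128 * R ^ 2 * M) ≤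
      444 * (R ^ 2 * Real.sqrt R * M) := by
    rw [← Real.sqrt_mul (by positivity)]
    refine Real.sqrt_le_iff.2 ⟨by positivity, ?_⟩
    have : (444 * (R ^ 2 * Real.sqrt R * M)) ^ 2 = 197136 * (R ^ 5 * M ^ 2) := by
      have := Real.sq_sqrt hR.le
      calc _ = 197136 * (R ^ 4 * Real.sqrt R ^ 2 * M ^ 2) := by ring
        _ = _ := by rw [this]; ring
    rw [this]
    have : 1536 * R ^ 3 * M * (128 * R ^ 2 * M) = 196608 * (R ^ 5 * M ^ 2) := by ring
    rw [this]
    have : 0 ≤ R ^ 5 * M ^ 2 := by positivity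
    linarith
  calc _ ≤ errConst P * (K * (R ^ 3)⁻¹ * (444 * R ^ 2 * M) + K * (R ^ 4)⁻¹ *
        (444 * (R ^ 2 * Real.sqrt R * M))) := by
        gcongr
        norm_num
    _ = _ := by
      field_simp

end Config

/-! ### Pair potentials and cut-offs -/

/-- A pair potential `u` and a cut-off `t` living on the length scale `R`, with their partial
derivatives `u'` and `t'`. -/
structure PairData (R K : ℝ) (u t : Space → ℝ) (u' t' : Fin 3 → Space → ℝ) : Prop where
  R_pos : 0 < R
  K_nonneg : 0 ≤ K
  cont_u : Continuous u
  cont_t : Continuous t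
  cont_u' : ∀ k, Continuous (u' k)
  cont_t' : ∀ k, Continuous (t' k)
  deriv_u : ∀ k z, HasDerivAt (fun r : ℝ => u (z + r • unitVec k)) (u' k z) 0
  deriv_t : ∀ k z, HasDerivAt (fun r : ℝ => t (z + r • unitVec k)) (t' k z) 0
  u_nonneg : ∀ z, 0 ≤ u z
  t_nonneg : ∀ z, 0 ≤ t z
  t_le_one : ∀ z, t z ≤ 1
  u_le : ∀ z, u z ≤ K * (R ^ 3)⁻¹ * near (4 * R) z
  one_sub_t_le : ∀ z, 1 - t z ≤ near (4 * R) z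
  u'_le : ∀ k z, |u' k z| ≤ K * (R ^ 4)⁻¹ * near (4 * R) z
  t'_le : ∀ k z, |t' k z| ≤ K * R⁻¹ * near (4 * R) z
  disjoint : ∀ z, u z ≠ 0 → t z = 0
  u_neg : ∀ z, u (-z) = u z
  t_neg : ∀ z, t (-z) = t z

theorem exists_near_bound {g : Space → ℝ} (hg : ContDiff ℝ ∞ g) {r : ℝ}
    (h0 : ∀ z, r < ‖z‖ → g z = 0) :
    ∃ K : ℝ, 0 ≤ K ∧ (∀ z, |g z| ≤ K * near r z) ∧
      ∀ k z, |fderiv ℝ g z (unitVec k)| ≤ K * near r z := by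
  have hts : tsupport g ⊆ Metric.closedBall 0 r := by
    refine closure_minimal (fun z hz => ?_) Metric.isClosed_closedBall
    rw [mem_closedBall_zero_iff]
    by_contra h
    exact hz (h0 z (not_le.1 h))
  have hc : HasCompactSupport g :=
    (isCompact_closedBall (0 : Space) r).of_isClosed_subset (isClosed_tsupport g) hts
  obtain ⟨C₁, h₁⟩ := hc.exists_bound_of_continuous hg.continuous
  obtain ⟨C₂, h₂⟩ := (hc.fderiv (𝕜 := ℝ)).exists_bound_of_continuous
    (hg.continuous_fderiv (by simp))
  refine ⟨max C₁ C₂, ((norm_nonneg _).trans (h₁ 0)).trans (le_max_left _ _), fun z => ?_,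
    fun k z => ?_⟩
  · unfold near
    split_ifs with h
    · rw [mul_one]; exact (h₁ z).trans (le_max_left _ _)
    · rw [h0 z (not_le.1 h)]; simp
  · unfold near
    split_ifs with h
    · rw [mul_one, ← Real.norm_eq_abs]
      refine (ContinuousLinearMap.le_opNorm _ _).trans ?_
      rw [PiLp.norm_single, norm_one, mul_one]
      exact (h₂ z).trans (le_max_right _ _)
    · have : fderiv ℝ g z = 0 := by
        by_contra hne
        exact h (mem_closedBall_zero_iff.1 (hts (support_fderiv_subset ℝ hne)))
      rw [this]; simp

theorem hasDerivAt_scaled {g : Space → ℝ} (hg : ContDiff ℝ ∞ g) (b : ℝ) (k : Fin 3) (z : Space) :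
    HasDerivAt (fun r : ℝ => g (b • (z + r • unitVec k)))
      (b * fderiv ℝ g (b • z) (unitVec k)) 0 := by
  have h1 : HasDerivAt (fun r : ℝ => b • (z + r • unitVec k)) (b • unitVec k) 0 := by
    have := ((hasDerivAt_id (0 : ℝ)).smul_const (unitVec k)).const_add z |>.fun_const_smul b
    simpa only [id, one_smul] using this
  have h2 : HasFDerivAt g (fderiv ℝ g (b • z)) (b • (z + (0 : ℝ) • unitVec k)) := by
    rw [zero_smul, add_zero]
    exact (hg.differentiable (by simp)).differentiableAt.hasFDerivAt
  have := h2.comp_hasDerivAt 0 h1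
  rwa [map_smul, smul_eq_mul] at this

theorem near_smul {r b : ℝ} (hb : 0 < b) (z : Space) : near r (b⁻¹ • z) = near (r * b) z := by
  unfold near
  have : ‖b⁻¹ • z‖ ≤ r ↔ ‖z‖ ≤ r * b := by
    rw [norm_smul, norm_inv, Real.norm_of_nonneg hb.le, inv_mul_le_iff₀ hb, mul_comm]
  simp only [this]

theorem near_mono {r r' : ℝ} (h : r ≤ r') (z : Space) : near r z ≤ near r' z := by
  unfold near
  split_ifs with h1 h2
  · exact le_rfl
  · exact absurd (h1.trans h) h2
  · exact zero_le_one
  · exact le_rfl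

/-- One K serves all R: values and gradients of U and 1 - θ are compared with indicators at unit
scale and then rescaled. As 1 - θ lives on radius 2, its version at scale 2R lives on radius 4R. -/
theorem exists_pairData {θ U : Space → ℝ} {a : ℝ} (hθ : IsSmoothHeaviside θ)
    (hU : IsSoftPotential a U) : ∃ K : ℝ, 0 ≤ K ∧ ∀ R : ℝ, 0 < R → ∃ u' t' : Fin 3 → Space → ℝ,
      PairData R K (scaledU U R) (scaledθ θ (2 * R)) u' t' := by
  obtain ⟨K₁, hK₁, h1, h1'⟩ := exists_near_bound hU.smooth (r := 1) fun z hz => by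
    by_contra h
    exact absurd (hU.support z h).2 (not_le.2 hz)
  obtain ⟨K₂, hK₂, h2, h2'⟩ := exists_near_bound (contDiff_const.sub hθ.smooth) (g := fun z => 1 - θ z)
    (r := 2) fun z hz => by rw [hθ.eq_one z hz.le, sub_self]
  have h2'' : ∀ k z, |fderiv ℝ θ z (unitVec k)| ≤ K₂ * near 2 z := fun k z => by
    have := h2' k z
    rwa [fderiv_const_sub, neg_apply, abs_neg] at this
  refine ⟨max K₁ K₂, hK₁.trans (le_max_left _ _), fun R hR => ?_⟩
  have hU1 : ∀ {z}, near 1 (R⁻¹ • z) ≤ near (4 * R) z := fun {z} => by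
    rw [near_smul hR]; exact near_mono (by linarith) z
  have ht1 : ∀ {z}, near 2 ((2 * R)⁻¹ • z) = near (4 * R) z := fun {z} => by
    rw [near_smul (by positivity)]; congr 1; ring
  have cd : ∀ {g : Space → ℝ}, ContDiff ℝ ∞ g → ∀ (b : ℝ) k,
      Continuous fun z => fderiv ℝ g (b • z) (unitVec k) := fun hg b k =>
    ((hg.continuous_fderiv (by simp)).comp (continuous_const_smul b)).clm_apply continuous_const
  refine ⟨fun k z => (R ^ 3)⁻¹ * (R⁻¹ * fderiv ℝ U (R⁻¹ • z) (unitVec k)),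
    fun k z => (2 * R)⁻¹ * fderiv ℝ θ ((2 * R)⁻¹ • z) (unitVec k), ?_⟩
  constructor
  · exact hR
  · exact hK₁.trans (le_max_left _ _)
  · exact continuous_const.mul (hU.smooth.continuous.comp (continuous_const_smul _))
  · exact hθ.smooth.continuous.comp (continuous_const_smul _)
  · exact fun k => continuous_const.mul (continuous_const.mul (cd hU.smooth _ k))
  · exact fun k => continuous_const.mul (cd hθ.smooth _ k)
  · exact fun k z => (hasDerivAt_scaled hU.smooth _ k z).const_mul _
  · exact fun k z => hasDerivAt_scaled hθ.smooth _ k z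
  · exact fun z => mul_nonneg (by positivity) (hU.nonneg _)
  · exact fun z => hθ.nonneg _
  · exact fun z => hθ.le_one _
  · intro z
    unfold scaledU
    rw [mul_comm _ (R ^ 3)⁻¹, mul_assoc]
    refine mul_le_mul_of_nonneg_left (((le_abs_self _).trans (h1 _)).trans ?_) (by positivity)
    exact mul_le_mul (le_max_left _ _) hU1 (near_nonneg _ _) (hK₁.trans (le_max_left _ _))
  · intro z
    rw [← ht1]
    unfold scaledθ
    by_cases h : ‖(2 * R)⁻¹ • z‖ ≤ 2
    · rw [near, if_pos h]; linarith [hθ.nonneg ((2 * R)⁻¹ • z)]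
    · rw [near, if_neg h, hθ.eq_one _ (not_le.1 h).le, sub_self]
  · intro k z
    rw [abs_mul, abs_mul, abs_of_pos (by positivity : 0 < (R ^ 3)⁻¹),
      abs_of_pos (by positivity : 0 < R⁻¹), mul_comm _ (R ^ 4)⁻¹, mul_assoc,
      ← mul_assoc, ← mul_inv, ← pow_succ]
    refine mul_le_mul_of_nonneg_left ((h1' k _).trans ?_) (by positivity)
    exact mul_le_mul (le_max_left _ _) hU1 (near_nonneg _ _) (hK₁.trans (le_max_left _ _))
  · intro k z
    rw [abs_mul, abs_of_pos (by positivity : 0 < (2 * R)⁻¹), mul_comm _ R⁻¹, mul_assoc]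
    refine mul_le_mul (inv_anti₀ hR (by linarith)) ((h2'' k _).trans ?_) (abs_nonneg _)
      (by positivity)
    rw [ht1]
    exact mul_le_mul_of_nonneg_right (le_max_right _ _) (near_nonneg _ _)
  · intro z hz
    have hz' : U (R⁻¹ • z) ≠ 0 := fun h => hz (by rw [scaledU, h, mul_zero])
    refine hθ.eq_zero _ ?_
    have := (hU.support _ hz').2
    rw [norm_smul, norm_inv, Real.norm_of_nonneg hR.le] at this
    rw [norm_smul, norm_inv, Real.norm_of_nonneg (by positivity)]
    refine le_trans (mul_le_mul_of_nonneg_right (inv_anti₀ hR (by linarith)) (norm_nonneg _)) this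
  · intro z
    unfold scaledU
    rw [hU.radial (R⁻¹ • -z) (R⁻¹ • z) (by rw [smul_neg, norm_neg])]
  · intro z
    exact hθ.radial _ _ (by rw [smul_neg, norm_neg])

/-! ### Exactly one close particle -/

section OneSum

variable {ι : Type*} [DecidableEq ι] {u t : Space → ℝ} {B : ℝ} {T : Finset ι} {f : ι → Space}

/-- The sum over `i` of `u(f i)` over the configurations in which no other point is close. -/
def oneSum (u t : Space → ℝ) (T : Finset ι) (f : ι → Space) : ℝ :=
  ∑ i ∈ T, u (f i) * ∏ k ∈ T.erase i, t (f k)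

theorem oneSum_nonneg (hu : ∀ z, 0 ≤ u z) (ht : ∀ z, 0 ≤ t z) : 0 ≤ oneSum u t T f :=
  Finset.sum_nonneg fun _ _ => mul_nonneg (hu _) (Finset.prod_nonneg fun _ _ => ht _)

/-- If u(f i) ≠ 0 then t(f i) = 0, and this factor occurs in all the other summands. At most one
summand survives, so the bound is independent of the number of particles. -/
theorem oneSum_le (hB : 0 ≤ B) (huB : ∀ z, u z ≤ B) (ht : ∀ z, 0 ≤ t z)
    (ht1 : ∀ z, t z ≤ 1) (hd : ∀ z, u z ≠ 0 → t z = 0) : oneSum u t T f ≤ B := by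
  by_cases h : ∃ i ∈ T, u (f i) ≠ 0
  · obtain ⟨i, hi, hne⟩ := h
    rw [oneSum, Finset.sum_eq_single_of_mem i hi fun j _ hj => ?_]
    · have h0 : 0 ≤ ∏ k ∈ T.erase i, t (f k) := Finset.prod_nonneg fun _ _ => ht _
      have h1 : ∏ k ∈ T.erase i, t (f k) ≤ 1 :=
        Finset.prod_le_one (fun _ _ => ht _) fun _ _ => ht1 _
      calc u (f i) * ∏ k ∈ T.erase i, t (f k) ≤ B * 1 :=
            mul_le_mul (huB _) h1 h0 hB
        _ = B := mul_one B
    · rw [Finset.prod_eq_zero (Finset.mem_erase.2 ⟨hj.symm, hi⟩) (hd _ hne), mul_zero]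
  · push Not at h
    rw [oneSum, Finset.sum_eq_zero fun i hi => by rw [h i hi, zero_mul]]
    exact hB

theorem oneSum_insert {l : ι} (hl : l ∉ T) :
    oneSum u t (insert l T) f = u (f l) * ∏ k ∈ T, t (f k) + t (f l) * oneSum u t T f := by
  rw [oneSum, Finset.sum_insert hl, Finset.erase_insert hl, oneSum, Finset.mul_sum]
  congr 1
  refine Finset.sum_congr rfl fun i hi => ?_
  have hne : l ≠ i := fun h => hl (h ▸ hi)
  rw [Finset.erase_insert_of_ne hne,
    Finset.prod_insert fun h => hl (Finset.mem_of_mem_erase h)]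
  ring

/-- The derivative of `oneSum` under a common translation. -/
def oneSumDeriv (u t u' t' : Space → ℝ) (T : Finset ι) (f : ι → Space) : ℝ :=
  ∑ i ∈ T, (u' (f i) * ∏ k ∈ T.erase i, t (f k) +
    u (f i) * ∑ m ∈ T.erase i, (∏ k ∈ (T.erase i).erase m, t (f k)) * t' (f m))

theorem hasDerivAt_oneSum {u' t' : Space → ℝ} {v : Space}
    (hu : ∀ z, HasDerivAt (fun r : ℝ => u (z + r • v)) (u' z) 0)
    (ht : ∀ z, HasDerivAt (fun r : ℝ => t (z + r • v)) (t' z) 0) :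
    HasDerivAt (fun r : ℝ => oneSum u t T fun i => f i + r • v) (oneSumDeriv u t u' t' T f) 0 := by
  unfold oneSum oneSumDeriv
  refine HasDerivAt.fun_sum fun i _ => ?_
  have h1 := HasDerivAt.fun_finsetProd (u := T.erase i) fun k _ => ht (f k)
  have := (hu (f i)).fun_mul h1
  simpa only [zero_smul, add_zero, smul_eq_mul] using this

/-- The derivatives of the cut-offs are regrouped by the differentiated index m: the remaining sum
over i is the same expression with m removed, hence again at most `B`, and only a single sum over
neighbours is left. -/
theorem abs_oneSumDeriv_le {u' t' : Space → ℝ} (hB : 0 ≤ B) (hu : ∀ z, 0 ≤ u z)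
    (huB : ∀ z, u z ≤ B) (ht : ∀ z, 0 ≤ t z) (ht1 : ∀ z, t z ≤ 1) (hd : ∀ z, u z ≠ 0 → t z = 0) :
    |oneSumDeriv u t u' t' T f| ≤ ∑ m ∈ T, (|u' (f m)| + B * |t' (f m)|) := by
  have hp : ∀ S : Finset ι, |∏ k ∈ S, t (f k)| = ∏ k ∈ S, t (f k) := fun S =>
    abs_of_nonneg (Finset.prod_nonneg fun _ _ => ht _)
  calc |oneSumDeriv u t u' t' T f|
      ≤ ∑ i ∈ T, (|u' (f i)| +
        ∑ m ∈ T.erase i, u (f i) * ((∏ k ∈ (T.erase i).erase m, t (f k)) * |t' (f m)|)) := by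
        refine (Finset.abs_sum_le_sum_abs _ _).trans (Finset.sum_le_sum fun i _ => ?_)
        refine (abs_add_le _ _).trans (add_le_add ?_ ?_)
        · rw [abs_mul, hp]
          exact mul_le_of_le_one_right (abs_nonneg _)
            (Finset.prod_le_one (fun _ _ => ht _) fun _ _ => ht1 _)
        · rw [abs_mul, abs_of_nonneg (hu _), ← Finset.mul_sum]
          refine mul_le_mul_of_nonneg_left ?_ (hu _)
          refine (Finset.abs_sum_le_sum_abs _ _).trans (Finset.sum_le_sum fun m _ => ?_)
          rw [abs_mul, hp]
    _ = ∑ m ∈ T, (|u' (f m)| + oneSum u t (T.erase m) f * |t' (f m)|) := by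
        rw [Finset.sum_add_distrib, Finset.sum_add_distrib]
        congr 1
        rw [Finset.sum_comm' (t' := T) (s' := fun m => T.erase m)]
        · refine Finset.sum_congr rfl fun m _ => ?_
          rw [oneSum, Finset.sum_mul]
          refine Finset.sum_congr rfl fun i _ => ?_
          rw [Finset.erase_right_comm]
          ring
        · intro i m
          simp only [Finset.mem_erase]
          tauto
    _ ≤ _ := Finset.sum_le_sum fun m _ => by
        gcongr
        exact oneSum_le hB huB ht ht1 hd

end OneSum

/-! ### Separating one particle from the potentials. -/

section Splitting

variable {P : Params} {N : ℕ}

/-- A decomposition `W = G + D`, where `G` does not depend on the particle `l` and `D` lives where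
`l` is close to another particle. -/
structure IsSplit (R K : ℝ) (l : Fin N) (W G D : Config N → ℝ) (D' : Fin 3 → Config N → ℝ) :
    Prop where
  bddG : BddMeas G
  bddD : BddMeas D
  bddD' : ∀ k, BddMeas (D' k)
  eq : ∀ x, W x = G x + D x
  nonneg : ∀ x, 0 ≤ G x
  inv : ∀ x a, G (x + (cj l).e a) = G x
  deriv : ∀ k x, HasDerivAt (fun r : ℝ => D (x + r • (cj l).e (unitVec k))) (D' k x) 0
  le : ∀ x, |D x| ≤ K * (R ^ 3)⁻¹ * crowd R l x
  le' : ∀ k x, |D' k x| ≤ K * (R ^ 4)⁻¹ * crowd R l x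

theorem mulOp_add {F : Type} [NormedAddCommGroup F] [InnerProductSpace ℝ F]
    [FiniteDimensional ℝ F] [MeasurableSpace F] [BorelSpace F] {W G D : F → ℝ} (hG : BddMeas G)
    (hD : BddMeas D) (h : ∀ x, W x = G x + D x) (u : L2 F) :
    mulOp W u = mulOp G u + mulOp D u := by
  apply IsMul.mulOp_eq
  filter_upwards [hG.isMul u, hD.isMul u, Lp.coeFn_add (mulOp G u) (mulOp D u)] with x h1 h2 h3
  rw [h3, Pi.add_apply, ← h1, ← h2, h x]
  push_cast
  ring

theorem IsSplit.le_re_qT {R K d : ℝ} {l : Fin N} {W G D : Config N → ℝ}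
    {D' : Fin 3 → Config N → ℝ} (h : IsSplit R K l W G D D') (hR : 0 < R) (hK : 0 ≤ K)
    (hgap : ∀ u ∈ dom P (cj l), d * graphSq P (cj l) u ≤ (qT P (cj l) u u).re)
    {Ψ : L2 (Config N)} (hl : Ψ ∈ dom P (cj l))
    (hj : ∀ j, j ≠ l → ∀ o, gcomp P (cj l) o Ψ ∈ dom P (cj j)) :
    mulOp W Ψ ∈ dom P (cj l) ∧
      d * (∑ o, ∫ x, G x * ‖gcomp P (cj l) o Ψ x‖ ^ 2) -
        444 * errConst P * K * (R⁻¹ + Real.sqrt R / R ^ 2) * mixAll P Ψ l ≤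
        (qT P (cj l) (mulOp W Ψ) Ψ).re := by
  obtain ⟨h1, h2⟩ := le_re_qT_mul hgap hl h.bddG h.nonneg h.inv
  have h3 := mem_dom_mul hl h.bddD h.bddD' h.deriv
  have h4 := norm_qT_mul_le_mixAll hR hl hj h.bddD h.bddD' h.deriv hK h.le h.le'
  rw [mulOp_add h.bddG h.bddD h.eq]
  refine ⟨add_mem h1 h3, ?_⟩
  rw [qT_add_left h1 h3 hl, Complex.add_re]
  have h5 := (abs_le.1 ((Complex.abs_re_le_norm _).trans h4)).1
  linarith

theorem crowd_eq (R : ℝ) (l : Fin N) (x : Config N) :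
    crowd R l x = ∑ j ∈ Finset.univ.erase l, near (4 * R) (x l - x j) := by
  rw [crowd, Finset.filter_ne']
  exact Finset.sum_congr rfl fun j _ => by rw [← near_neg, neg_sub]

theorem BddMeas.prod {F : Type} [NormedAddCommGroup F] [InnerProductSpace ℝ F]
    [FiniteDimensional ℝ F] [MeasurableSpace F] [BorelSpace F] {ι : Type*} {s : Finset ι}
    {m : ι → F → ℝ} (h : ∀ i ∈ s, BddMeas (m i)) : BddMeas (fun x => ∏ i ∈ s, m i x) := by
  classical
  induction s using Finset.induction_on with
  | empty => simpa using BddMeas.const (F := F) 1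
  | insert a s ha ih =>
    simp only [Finset.prod_insert ha]
    exact (h a (Finset.mem_insert_self a s)).mul
      (ih fun i hi => h i (Finset.mem_insert_of_mem hi))

theorem oneSum_congr {ι : Type*} [DecidableEq ι] {u t : Space → ℝ} {T : Finset ι}
    {f g : ι → Space} (h : ∀ i ∈ T, f i = g i) : oneSum u t T f = oneSum u t T g := by
  refine Finset.sum_congr rfl fun i hi => ?_
  rw [h i hi, Finset.prod_congr rfl fun k hk => by rw [h k (Finset.mem_of_mem_erase hk)]]

section Pair

variable {R K : ℝ} {u t : Space → ℝ} {u' t' : Fin 3 → Space → ℝ}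

namespace PairData

theorem bound_nonneg (h : PairData R K u t u' t') : 0 ≤ K * (R ^ 3)⁻¹ := by
  have := h.R_pos
  have := h.K_nonneg
  positivity

theorem u_le_const (h : PairData R K u t u' t') (z : Space) : u z ≤ K * (R ^ 3)⁻¹ :=
  (h.u_le z).trans (mul_le_of_le_one_right h.bound_nonneg (near_le_one _ _))

theorem bdd_u (h : PairData R K u t u' t') (i j : Fin N) :
    BddMeas fun x : Config N => u (x i - x j) :=
  BddMeas.of_continuous (h.cont_u.comp (continuous_sub_coord i j)) (C := K * (R ^ 3)⁻¹) fun x => by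
    rw [abs_of_nonneg (h.u_nonneg _)]; exact h.u_le_const _

theorem bdd_t (h : PairData R K u t u' t') (i j : Fin N) :
    BddMeas fun x : Config N => t (x i - x j) :=
  BddMeas.of_continuous (h.cont_t.comp (continuous_sub_coord i j)) (C := 1) fun x => by
    rw [abs_of_nonneg (h.t_nonneg _)]; exact h.t_le_one _

theorem bdd_u' (h : PairData R K u t u' t') (k : Fin 3) (i j : Fin N) :
    BddMeas fun x : Config N => u' k (x i - x j) :=
  BddMeas.of_continuous ((h.cont_u' k).comp (continuous_sub_coord i j)) (C := K * (R ^ 4)⁻¹)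
    fun _ => (h.u'_le k _).trans (mul_le_of_le_one_right
      (mul_nonneg h.K_nonneg (inv_nonneg.2 (pow_nonneg h.R_pos.le 4))) (near_le_one _ _))

theorem bdd_t' (h : PairData R K u t u' t') (k : Fin 3) (i j : Fin N) :
    BddMeas fun x : Config N => t' k (x i - x j) :=
  BddMeas.of_continuous ((h.cont_t' k).comp (continuous_sub_coord i j)) (C := K * R⁻¹)
    fun _ => (h.t'_le k _).trans (mul_le_of_le_one_right
      (mul_nonneg h.K_nonneg (inv_nonneg.2 h.R_pos.le)) (near_le_one _ _))

theorem bdd_prod (h : PairData R K u t u' t') (j : Fin N) (T : Finset (Fin N)) :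
    BddMeas fun x : Config N => ∏ k ∈ T, t (x j - x k) := BddMeas.prod fun k _ => h.bdd_t j k

theorem bdd_oneSum (h : PairData R K u t u' t') (j : Fin N) (T : Finset (Fin N)) :
    BddMeas fun x : Config N => oneSum u t T fun k => x j - x k :=
  BddMeas.sum fun i _ => (h.bdd_u j i).mul (h.bdd_prod j _)

theorem bdd_oneSumDeriv (h : PairData R K u t u' t') (k : Fin 3) (j : Fin N)
    (T : Finset (Fin N)) :
    BddMeas fun x : Config N => oneSumDeriv u t (u' k) (t' k) T fun k => x j - x k :=
  BddMeas.sum fun i _ => ((h.bdd_u' k j i).mul (h.bdd_prod j _)).add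
    ((h.bdd_u j i).mul (BddMeas.sum fun m _ => (h.bdd_prod j _).mul (h.bdd_t' k j m)))

end PairData

/-- The potential felt by all particles having exactly one close neighbour. -/
def dysonSum (u t : Space → ℝ) (x : Config N) : ℝ :=
  ∑ j, oneSum u t (Finset.univ.erase j) fun k => x j - x k

/-- The sum of a pair potential over all ordered pairs. -/
def pairSum (u : Space → ℝ) (x : Config N) : ℝ :=
  ∑ i, ∑ j ∈ Finset.univ.erase i, u (x i - x j)

/-- The interaction of the particles other than `l`. -/
def pairSumOff (u : Space → ℝ) (l : Fin N) (x : Config N) : ℝ :=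
  ∑ i ∈ Finset.univ.erase l, ∑ j ∈ (Finset.univ.erase i).erase l, u (x i - x j)

theorem add_smul_e_of_ne {i l : Fin N} (hi : i ≠ l) (x : Config N) (r : ℝ) (k : Fin 3) :
    (x + r • (cj l).e (unitVec k)) i = x i := by
  rw [← map_smul, add_e_of_ne hi]

theorem insert_erase_erase {j l : Fin N} (h : j ≠ l) :
    insert l ((Finset.univ.erase j).erase l) = (Finset.univ.erase j : Finset (Fin N)) :=
  Finset.insert_erase (Finset.mem_erase.2 ⟨h.symm, Finset.mem_univ l⟩)

/-- For j ≠ l, `oneSum_insert` isolates particle l in the term of j; putting t(x_l - x_j) = 1 and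
dropping its interaction leaves `G`. The error contains u or 1 - t evaluated at x_l - x_j, and the
term of the particle l itself; all of them vanish unless l has a neighbour within 4R. -/
theorem PairData.split_dysonSum (h : PairData R K u t u' t') (l : Fin N) :
    ∃ G D D', IsSplit R (3 * (K + K ^ 2)) l (dysonSum u t) G D D' := by
  have hK := h.K_nonneg
  have hR := h.R_pos
  have hB := h.bound_nonneg
  have hY0 : ∀ (T : Finset (Fin N)) f, 0 ≤ oneSum u t T f := fun T f =>
    oneSum_nonneg h.u_nonneg h.t_nonneg
  have hYB : ∀ (T : Finset (Fin N)) f, oneSum u t T f ≤ K * (R ^ 3)⁻¹ := fun T f =>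
    oneSum_le hB h.u_le_const h.t_nonneg h.t_le_one h.disjoint
  have hp0 : ∀ (T : Finset (Fin N)) (f : Fin N → Space), 0 ≤ ∏ k ∈ T, t (f k) := fun T f =>
    Finset.prod_nonneg fun _ _ => h.t_nonneg _
  have hp1 : ∀ (T : Finset (Fin N)) (f : Fin N → Space), ∏ k ∈ T, t (f k) ≤ 1 := fun T f =>
    Finset.prod_le_one (fun _ _ => h.t_nonneg _) fun _ _ => h.t_le_one _
  let T : Fin N → Finset (Fin N) := fun j => (Finset.univ.erase j).erase l
  let E : Finset (Fin N) := Finset.univ.erase l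
  have hT : ∀ {j k}, k ∈ T j → k ≠ l := fun hk => (Finset.mem_erase.1 hk).1
  have hE : ∀ {j}, j ∈ E → j ≠ l := fun hj => (Finset.mem_erase.1 hj).1
  refine ⟨fun x => ∑ j ∈ E, oneSum u t (T j) fun k => x j - x k,
    fun x => ∑ j ∈ E, (u (x l - x j) * ∏ k ∈ T j, t (x j - x k) +
      (t (x l - x j) - 1) * oneSum u t (T j) fun k => x j - x k) +
      oneSum u t E fun k => x l - x k,
    fun k x => ∑ j ∈ E, (u' k (x l - x j) * ∏ k ∈ T j, t (x j - x k) +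
      t' k (x l - x j) * oneSum u t (T j) fun k => x j - x k) +
      oneSumDeriv u t (u' k) (t' k) E fun k => x l - x k, ?_⟩
  constructor
  · exact BddMeas.sum fun j _ => h.bdd_oneSum j _
  · exact (BddMeas.sum fun j _ => ((h.bdd_u l j).mul (h.bdd_prod j _)).add
      (((h.bdd_t l j).sub (BddMeas.const 1)).mul (h.bdd_oneSum j _))).add (h.bdd_oneSum l _)
  · exact fun k => (BddMeas.sum fun j _ => ((h.bdd_u' k l j).mul (h.bdd_prod j _)).add
      ((h.bdd_t' k l j).mul (h.bdd_oneSum j _))).add (h.bdd_oneSumDeriv k l _)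
  · intro x
    rw [dysonSum, ← Finset.sum_erase_add _ _ (Finset.mem_univ l), ← add_assoc,
      ← Finset.sum_add_distrib]
    congr 1
    refine Finset.sum_congr rfl fun j hj => ?_
    rw [← insert_erase_erase (hE hj), oneSum_insert (Finset.notMem_erase l _),
      ← h.u_neg (x j - x l), ← h.t_neg (x j - x l), neg_sub]
    ring
  · exact fun x => Finset.sum_nonneg fun j _ => hY0 _ _
  · intro x a
    refine Finset.sum_congr rfl fun j hj => oneSum_congr fun k hk => ?_
    rw [add_e_of_ne (hE hj), add_e_of_ne (hT hk)]
  · intro k x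
    have e1 : ∀ r : ℝ, ∀ j ∈ E, (x + r • (cj l).e (unitVec k)) l -
        (x + r • (cj l).e (unitVec k)) j = x l - x j + r • unitVec k := fun r j hj =>
      sub_add_smul_e (hE hj).symm x k r
    have e2 : ∀ r : ℝ, ∀ j ∈ E, ∀ m ∈ T j, (x + r • (cj l).e (unitVec k)) j -
        (x + r • (cj l).e (unitVec k)) m = x j - x m := fun r j hj m hm => by
      rw [add_smul_e_of_ne (hE hj), add_smul_e_of_ne (hT hm)]
    have e3 : (fun r : ℝ => ∑ j ∈ E, (u ((x + r • (cj l).e (unitVec k)) l -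
        (x + r • (cj l).e (unitVec k)) j) * ∏ m ∈ T j, t ((x + r • (cj l).e (unitVec k)) j -
        (x + r • (cj l).e (unitVec k)) m) + (t ((x + r • (cj l).e (unitVec k)) l -
        (x + r • (cj l).e (unitVec k)) j) - 1) * oneSum u t (T j) fun m =>
          (x + r • (cj l).e (unitVec k)) j - (x + r • (cj l).e (unitVec k)) m) +
        oneSum u t E fun m => (x + r • (cj l).e (unitVec k)) l -
          (x + r • (cj l).e (unitVec k)) m) =
        fun r : ℝ => ∑ j ∈ E, (u (x l - x j + r • unitVec k) * ∏ m ∈ T j, t (x j - x m) +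
          (t (x l - x j + r • unitVec k) - 1) * oneSum u t (T j) fun m => x j - x m) +
          oneSum u t E fun m => x l - x m + r • unitVec k := by
      funext r
      congr 1
      · refine Finset.sum_congr rfl fun j hj => ?_
        rw [e1 r j hj, oneSum_congr (e2 r j hj),
          Finset.prod_congr rfl fun m hm => by rw [e2 r j hj m hm]]
      · exact oneSum_congr (e1 r)
    rw [e3]
    exact (HasDerivAt.fun_sum fun j _ => ((h.deriv_u k _).mul_const _).fun_add
      (((h.deriv_t k _).sub_const 1).mul_const _)).fun_add
      (hasDerivAt_oneSum (h.deriv_u k) (h.deriv_t k))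
  · intro x
    -- Three contributions per neighbour, each at most K R⁻³: its interaction with l, the removed
    -- cut-off, and its share in the term of the particle l.
    have key : ∀ j ∈ E, |u (x l - x j) * ∏ k ∈ T j, t (x j - x k) +
        (t (x l - x j) - 1) * oneSum u t (T j) fun k => x j - x k| + u (x l - x j) ≤
        3 * (K + K ^ 2) * (R ^ 3)⁻¹ * near (4 * R) (x l - x j) := by
      intro j _
      have a1 := h.u_le (x l - x j)
      have a2 : |u (x l - x j) * ∏ k ∈ T j, t (x j - x k)| ≤ u (x l - x j) := by
        rw [abs_of_nonneg (mul_nonneg (h.u_nonneg _) (hp0 _ _))]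
        exact mul_le_of_le_one_right (h.u_nonneg _) (hp1 _ _)
      have a3 : |(t (x l - x j) - 1) * oneSum u t (T j) fun k => x j - x k| ≤
          near (4 * R) (x l - x j) * (K * (R ^ 3)⁻¹) := by
        rw [abs_mul, abs_of_nonneg (hY0 _ _), abs_sub_comm,
          abs_of_nonneg (sub_nonneg.2 (h.t_le_one _))]
        exact mul_le_mul (h.one_sub_t_le _) (hYB _ _) (hY0 _ _) (near_nonneg _ _)
      have a4 := abs_add_le (u (x l - x j) * ∏ k ∈ T j, t (x j - x k))
        ((t (x l - x j) - 1) * oneSum u t (T j) fun k => x j - x k)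
      have a5 : 0 ≤ K ^ 2 * (R ^ 3)⁻¹ * near (4 * R) (x l - x j) :=
        mul_nonneg (by positivity) (near_nonneg _ _)
      linarith
    have key2 : (oneSum u t E fun k => x l - x k) ≤ ∑ j ∈ E, u (x l - x j) :=
      Finset.sum_le_sum fun j _ => mul_le_of_le_one_right (h.u_nonneg _) (hp1 _ _)
    rw [crowd_eq, Finset.mul_sum]
    refine le_trans ?_ (Finset.sum_le_sum key)
    refine le_trans ?_ Finset.sum_add_distrib.ge
    refine (abs_add_le _ _).trans (add_le_add (Finset.abs_sum_le_sum_abs _ _) ?_)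
    rw [abs_of_nonneg (hY0 _ _)]
    exact key2
  · intro k x
    -- The K² arises here: the derivative of a cut-off, K R⁻¹, multiplies a one-neighbour sum of
    -- size K R⁻³.
    have b1 : ∀ z, |u' k z| + K * (R ^ 3)⁻¹ * |t' k z| ≤
        (K + K ^ 2) * (R ^ 4)⁻¹ * near (4 * R) z := fun z => by
      have a1 := h.u'_le k z
      have a2 := mul_le_mul_of_nonneg_left (h.t'_le k z) hB
      have a3 : K * (R ^ 3)⁻¹ * (K * R⁻¹ * near (4 * R) z) =
          K ^ 2 * (R ^ 4)⁻¹ * near (4 * R) z := by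
        field_simp
      linarith
    have key : ∀ j ∈ E, |u' k (x l - x j) * ∏ k ∈ T j, t (x j - x k) +
        t' k (x l - x j) * oneSum u t (T j) fun k => x j - x k| +
        (|u' k (x l - x j)| + K * (R ^ 3)⁻¹ * |t' k (x l - x j)|) ≤
        3 * (K + K ^ 2) * (R ^ 4)⁻¹ * near (4 * R) (x l - x j) := by
      intro j _
      have a1 := b1 (x l - x j)
      have a2 : |u' k (x l - x j) * ∏ k ∈ T j, t (x j - x k)| ≤ |u' k (x l - x j)| := by
        rw [abs_mul, abs_of_nonneg (hp0 _ _)]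
        exact mul_le_of_le_one_right (abs_nonneg _) (hp1 _ _)
      have a3 : |t' k (x l - x j) * oneSum u t (T j) fun k => x j - x k| ≤
          K * (R ^ 3)⁻¹ * |t' k (x l - x j)| := by
        rw [abs_mul, abs_of_nonneg (hY0 _ _), mul_comm]
        exact mul_le_mul_of_nonneg_right (hYB _ _) (abs_nonneg _)
      have a4 := abs_add_le (u' k (x l - x j) * ∏ k ∈ T j, t (x j - x k))
        (t' k (x l - x j) * oneSum u t (T j) fun k => x j - x k)
      have a5 : 0 ≤ (K + K ^ 2) * (R ^ 4)⁻¹ * near (4 * R) (x l - x j) :=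
        mul_nonneg (by positivity) (near_nonneg _ _)
      linarith
    rw [crowd_eq, Finset.mul_sum]
    refine le_trans ?_ (Finset.sum_le_sum key)
    refine le_trans ?_ Finset.sum_add_distrib.ge
    refine (abs_add_le _ _).trans (add_le_add (Finset.abs_sum_le_sum_abs _ _) ?_)
    exact abs_oneSumDeriv_le hB h.u_nonneg h.u_le_const h.t_nonneg h.t_le_one h.disjoint

/-- Each pair containing l occurs in both orders, hence the factor 2 in `D`; no cut-offs depend on
x_l. -/
theorem PairData.split_pairSum (h : PairData R K u t u' t') (l : Fin N) :
    ∃ D D', IsSplit R (3 * (K + K ^ 2)) l (pairSum u) (pairSumOff u l) D D' := by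
  have hK := h.K_nonneg
  have hR := h.R_pos
  have hE : ∀ {j}, j ∈ Finset.univ.erase l → j ≠ l := fun hj => (Finset.mem_erase.1 hj).1
  refine ⟨fun x => ∑ j ∈ Finset.univ.erase l, 2 * u (x l - x j),
    fun k x => ∑ j ∈ Finset.univ.erase l, 2 * u' k (x l - x j), ?_⟩
  constructor
  · exact BddMeas.sum fun i _ => BddMeas.sum fun j _ => h.bdd_u i j
  · exact BddMeas.sum fun j _ => (BddMeas.const 2).mul (h.bdd_u l j)
  · exact fun k => BddMeas.sum fun j _ => (BddMeas.const 2).mul (h.bdd_u' k l j)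
  · intro x
    rw [pairSum, pairSumOff, ← Finset.sum_erase_add _ _ (Finset.mem_univ l),
      ← Finset.sum_add_distrib, ← Finset.sum_add_distrib]
    refine Finset.sum_congr rfl fun j hj => ?_
    rw [← insert_erase_erase (hE hj), Finset.sum_insert (Finset.notMem_erase l _),
      insert_erase_erase (hE hj), ← h.u_neg (x j - x l), neg_sub]
    ring
  · exact fun x => Finset.sum_nonneg fun i _ => Finset.sum_nonneg fun j _ => h.u_nonneg _
  · intro x a
    refine Finset.sum_congr rfl fun i hi => Finset.sum_congr rfl fun j hj => ?_
    rw [add_e_of_ne (hE hi), add_e_of_ne (Finset.mem_erase.1 hj).1]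
  · intro k x
    have e : (fun r : ℝ => ∑ j ∈ Finset.univ.erase l, 2 * u ((x + r • (cj l).e (unitVec k)) l -
        (x + r • (cj l).e (unitVec k)) j)) =
        fun r : ℝ => ∑ j ∈ Finset.univ.erase l, 2 * u (x l - x j + r • unitVec k) := by
      funext r
      exact Finset.sum_congr rfl fun j hj => by rw [sub_add_smul_e (hE hj).symm]
    rw [e]
    exact HasDerivAt.fun_sum fun j _ => (h.deriv_u k _).const_mul 2
  · intro x
    rw [crowd_eq, Finset.mul_sum]
    refine (Finset.abs_sum_le_sum_abs _ _).trans (Finset.sum_le_sum fun j _ => ?_)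
    have a1 := h.u_le (x l - x j)
    have a2 : 0 ≤ (K + 3 * K ^ 2) * (R ^ 3)⁻¹ * near (4 * R) (x l - x j) :=
      mul_nonneg (by positivity) (near_nonneg _ _)
    rw [abs_mul, abs_two, abs_of_nonneg (h.u_nonneg _)]
    linarith
  · intro k x
    rw [crowd_eq, Finset.mul_sum]
    refine (Finset.abs_sum_le_sum_abs _ _).trans (Finset.sum_le_sum fun j _ => ?_)
    have a1 := h.u'_le k (x l - x j)
    have a2 : 0 ≤ (K + 3 * K ^ 2) * (R ^ 4)⁻¹ * near (4 * R) (x l - x j) :=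
      mul_nonneg (by positivity) (near_nonneg _ _)
    rw [abs_mul, abs_two]
    linarith

end Pair

end Splitting

/-! ### The three-body estimate for weak solutions without symmetry. -/

section ManyBody

variable {P : Params} {N : ℕ}

/-- `∑_{i ≠ j} u(x_i - x_j) ∑_{k ≠ i, j} (1 - t(x_j - x_k))`. -/
def threeSum (u t : Space → ℝ) (x : Config N) : ℝ :=
  ∑ i, ∑ j ∈ Finset.univ.erase i, u (x i - x j) *
    ∑ k ∈ (Finset.univ.erase i).erase j, (1 - t (x j - x k))

theorem filter_ne_and_ne (i j : Fin N) :
    Finset.univ.filter (fun k => k ≠ i ∧ k ≠ j) = (Finset.univ.erase i).erase j := by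
  ext k
  simp [and_comm]

theorem twoBody_eq (U : Space → ℝ) (R : ℝ) (x : Config N) :
    twoBody U R x = pairSum (scaledU U R) x := by
  simp only [twoBody, pairSum, Finset.filter_ne']

theorem threeBody_eq (U θ : Space → ℝ) (R : ℝ) (x : Config N) :
    threeBody U θ R x = threeSum (scaledU U R) (scaledθ θ (2 * R)) x := by
  simp only [threeBody, threeSum, Finset.filter_ne', filter_ne_and_ne]

section Pair

variable {R K : ℝ} {u t : Space → ℝ} {u' t' : Fin 3 → Space → ℝ}

theorem dysonSum_eq (hu : ∀ z, u (-z) = u z) (x : Config N) :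
    dysonSum u t x = ∑ i, ∑ j ∈ Finset.univ.erase i, u (x i - x j) *
      ∏ k ∈ (Finset.univ.erase i).erase j, t (x j - x k) := by
  unfold dysonSum oneSum
  rw [Finset.sum_comm' (t' := Finset.univ) (s' := fun i => Finset.univ.erase i)]
  · refine Finset.sum_congr rfl fun i _ => Finset.sum_congr rfl fun j _ => ?_
    rw [← hu, neg_sub, Finset.erase_right_comm]
  · intro i j
    simp only [Finset.mem_erase, Finset.mem_univ, and_true, true_and]
    exact ne_comm

theorem one_sub_prod_le {ι : Type*} (T : Finset ι) {f : ι → ℝ} (h0 : ∀ i, 0 ≤ f i)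
    (h1 : ∀ i, f i ≤ 1) : 1 - ∏ i ∈ T, f i ≤ ∑ i ∈ T, (1 - f i) := by
  classical
  induction T using Finset.induction_on with
  | empty => simp
  | insert a s ha ih =>
    rw [Finset.prod_insert ha, Finset.sum_insert ha]
    have hp : ∏ i ∈ s, f i ≤ 1 := Finset.prod_le_one (fun i _ => h0 i) fun i _ => h1 i
    nlinarith [h0 a, h1 a]

/-- By ∏ t ≥ 1 - ∑ (1 - t), removing the cut-offs costs at most the three-body term. This turns the
first inequality of the theorem into the second. -/
theorem PairData.pairSum_sub_le (h : PairData R K u t u' t') (x : Config N) :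
    pairSum u x - threeSum u t x ≤ dysonSum u t x := by
  rw [dysonSum_eq h.u_neg, pairSum, threeSum, ← Finset.sum_sub_distrib]
  refine Finset.sum_le_sum fun i _ => ?_
  rw [← Finset.sum_sub_distrib]
  refine Finset.sum_le_sum fun j _ => ?_
  have := mul_le_mul_of_nonneg_left (one_sub_prod_le ((Finset.univ.erase i).erase j)
    (f := fun k => t (x j - x k)) (fun k => h.t_nonneg _) fun k => h.t_le_one _)
    (h.u_nonneg (x i - x j))
  linarith

theorem PairData.bdd_dysonSum (h : PairData R K u t u' t') :
    BddMeas (dysonSum u t : Config N → ℝ) := BddMeas.sum fun j _ => h.bdd_oneSum j _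

theorem PairData.bdd_pairSum (h : PairData R K u t u' t') :
    BddMeas (pairSum u : Config N → ℝ) := BddMeas.sum fun i _ => BddMeas.sum fun j _ => h.bdd_u i j

theorem PairData.bdd_threeSum (h : PairData R K u t u' t') :
    BddMeas (threeSum u t : Config N → ℝ) :=
  BddMeas.sum fun i _ => BddMeas.sum fun j _ => (h.bdd_u i j).mul
    (BddMeas.sum fun k _ => (BddMeas.const 1).sub (h.bdd_t j k))

theorem PairData.dysonSum_nonneg (h : PairData R K u t u' t') (x : Config N) :
    0 ≤ dysonSum u t x :=
  Finset.sum_nonneg fun _ _ => oneSum_nonneg h.u_nonneg h.t_nonneg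

theorem PairData.pairSum_nonneg (h : PairData R K u t u' t') (x : Config N) : 0 ≤ pairSum u x :=
  Finset.sum_nonneg fun _ _ => Finset.sum_nonneg fun _ _ => h.u_nonneg _

theorem integral_mul_norm_sq_mono {F : Type} [NormedAddCommGroup F] [InnerProductSpace ℝ F]
    [FiniteDimensional ℝ F] [MeasurableSpace F] [BorelSpace F] {m m' : F → ℝ} (hm : BddMeas m)
    (hm' : BddMeas m') (h : ∀ x, m x ≤ m' x) (u : L2 F) :
    ∫ x, m x * ‖u x‖ ^ 2 ≤ ∫ x, m' x * ‖u x‖ ^ 2 :=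
  integral_mono (hm.integrable u) (hm'.integrable u) fun x =>
    mul_le_mul_of_nonneg_right (h x) (sq_nonneg _)

theorem integral_sum_mul_norm_sq {F : Type} [NormedAddCommGroup F] [InnerProductSpace ℝ F]
    [FiniteDimensional ℝ F] [MeasurableSpace F] [BorelSpace F] {ι : Type*} {s : Finset ι}
    {m : ι → F → ℝ} (hm : ∀ i ∈ s, BddMeas (m i)) (u : L2 F) :
    ∫ x, (∑ i ∈ s, m i x) * ‖u x‖ ^ 2 = ∑ i ∈ s, ∫ x, m i x * ‖u x‖ ^ 2 := by
  rw [← integral_finsetSum _ fun i hi => (hm i hi).integrable u]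
  simp only [Finset.sum_mul]

theorem PairData.integral_pairSum_le (h : PairData R K u t u' t') {Ψ : L2 (Config N)}
    (hΨ : ∀ l, Ψ ∈ dom P (cj l))
    (hm : ∀ l j, j ≠ l → ∀ o, gcomp P (cj l) o Ψ ∈ dom P (cj j)) :
    ∫ x, pairSum u x * ‖Ψ x‖ ^ 2 ≤ 1536 * K * ∑ l, mixAll P Ψ l := by
  have hR := h.R_pos
  unfold pairSum
  rw [integral_sum_mul_norm_sq fun i _ => BddMeas.sum fun j _ => h.bdd_u i j, Finset.mul_sum]
  refine Finset.sum_le_sum fun l _ => ?_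
  rw [integral_sum_mul_norm_sq fun j _ => h.bdd_u l j, mixAll, Finset.filter_ne', Finset.mul_sum]
  refine Finset.sum_le_sum fun j hj => ?_
  have hjl : j ≠ l := (Finset.mem_erase.1 hj).1
  have hb := (BddMeas.const (K * (R ^ 3)⁻¹)).mul
    (bddMeas_near (4 * R) (continuous_sub_coord j l))
  calc ∫ x, u (x l - x j) * ‖Ψ x‖ ^ 2
      ≤ ∫ x, (K * (R ^ 3)⁻¹ * near (4 * R) (x j - x l)) * ‖Ψ x‖ ^ 2 :=
        integral_mul_norm_sq_mono (h.bdd_u l j) hb (fun x => by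
          rw [← h.u_neg, neg_sub]; exact h.u_le _) Ψ
    _ = K * (R ^ 3)⁻¹ * ∫ x, near (4 * R) (x j - x l) * ‖Ψ x‖ ^ 2 := by
        rw [← integral_const_mul]
        simp only [mul_assoc]
    _ ≤ K * (R ^ 3)⁻¹ * (24 * (4 * R) ^ 3 * mix P Ψ l j) :=
        mul_le_mul_of_nonneg_left
          (near_pair_le_mix hjl (by positivity) (hΨ l) (hm l j hjl)) h.bound_nonneg
    _ = 1536 * K * mix P Ψ l j := by field_simp; ring

/-- Hardy's inequality for the third particle. -/
theorem PairData.near_mul_le (h : PairData R K u t u' t') {i j k : Fin N} (hik : i ≠ k)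
    (hjk : j ≠ k) {Ψ : L2 (Config N)} (hΨ : Ψ ∈ dom P (cj k)) :
    ∫ x, (u (x i - x j) * near (4 * R) (x k - x j)) * ‖Ψ x‖ ^ 2 ≤
      128 * R ^ 2 * ∑ o, ∫ x, u (x i - x j) * ‖gcomp P (cj k) o Ψ x‖ ^ 2 := by
  have hR := h.R_pos
  -- The pair potential of i and j does not involve x_k, so its root commutes with the operators of
  -- particle k and can be absorbed into Ψ before Hardy's inequality is used.
  have hinv : ∀ (x : Config N) a, Real.sqrt (u ((x + (cj k).e a) i - (x + (cj k).e a) j)) =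
      Real.sqrt (u (x i - x j)) := fun x a => by
    rw [add_e_of_ne hik, add_e_of_ne hjk]
  have hb := (h.bdd_u i j (N := N)).sqrt
  have hI := intertwines_mulCLM (c := cj k) hb hinv
  have hsq : ∀ w : L2 (Config N), ‖mulOp (fun x : Config N => Real.sqrt (u (x i - x j))) w‖ ^ 2 =
      ∫ x, u (x i - x j) * ‖w x‖ ^ 2 := fun w => by
    rw [(hb.isMul w).norm_sq]
    simp only [Real.sq_sqrt (h.u_nonneg _)]
  have h1 := near_pair_le hjk.symm (r := 4 * R) (by positivity) (mem_dom_map hI hΨ)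
  have h2 : ∫ x, near (4 * R) (x k - x j) * ‖mulCLM _ hb Ψ x‖ ^ 2 =
      ∫ x, (u (x i - x j) * near (4 * R) (x k - x j)) * ‖Ψ x‖ ^ 2 := by
    refine integral_congr_ae ?_
    filter_upwards [hb.isMul Ψ] with x hx
    rw [mulCLM_apply, ← hx, norm_mul, mul_pow, Complex.norm_real, Real.norm_eq_abs, sq_abs,
      Real.sq_sqrt (h.u_nonneg _)]
    ring
  rw [← h2]
  refine (h1.trans (mul_le_mul_of_nonneg_left (sum_mom_le_graphSq _) (by positivity))).trans
    (le_of_eq ?_)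
  rw [graphSq_eq_sum]
  have h3 : ∀ o, ‖gcomp P (cj k) o (mulCLM _ hb Ψ)‖ ^ 2 =
      ∫ x, u (x i - x j) * ‖gcomp P (cj k) o Ψ x‖ ^ 2 := fun o => by
    rw [gcomp_map hI hΨ, mulCLM_apply, hsq]
  simp only [h3]
  ring

/-- The third particle k, on which the cut-off acts, is made the outer summation index: Hardy's
inequality in x_k trades the cut-off for R², and what remains is the pair potential of all particles
but k. -/
theorem PairData.integral_threeSum_le (h : PairData R K u t u' t') {Ψ : L2 (Config N)}
    (hΨ : ∀ l, Ψ ∈ dom P (cj l)) :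
    ∫ x, threeSum u t x * ‖Ψ x‖ ^ 2 ≤
      128 * R ^ 2 * ∑ l, ∑ o, ∫ x, pairSumOff u l x * ‖gcomp P (cj l) o Ψ x‖ ^ 2 := by
  have hb : ∀ i j k : Fin N, BddMeas fun x : Config N =>
      u (x i - x j) * near (4 * R) (x k - x j) := fun i j k =>
    (h.bdd_u i j).mul (bddMeas_near _ (continuous_sub_coord k j))
  have hle : ∀ x : Config N, threeSum u t x ≤ ∑ k, ∑ i ∈ Finset.univ.erase k,
      ∑ j ∈ (Finset.univ.erase i).erase k, u (x i - x j) * near (4 * R) (x k - x j) := by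
    intro x
    calc threeSum u t x ≤ ∑ i, ∑ j ∈ Finset.univ.erase i,
          ∑ k ∈ (Finset.univ.erase i).erase j, u (x i - x j) * near (4 * R) (x k - x j) := by
          refine Finset.sum_le_sum fun i _ => Finset.sum_le_sum fun j _ => ?_
          rw [Finset.mul_sum]
          refine Finset.sum_le_sum fun k _ => mul_le_mul_of_nonneg_left ?_ (h.u_nonneg _)
          rw [← near_neg, neg_sub]
          exact h.one_sub_t_le _
      _ = ∑ i, ∑ k ∈ Finset.univ.erase i,
          ∑ j ∈ (Finset.univ.erase i).erase k, u (x i - x j) * near (4 * R) (x k - x j) := by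
          refine Finset.sum_congr rfl fun i _ => Finset.sum_comm' fun j k => ?_
          simp only [Finset.mem_erase, Finset.mem_univ, and_true]
          tauto
      _ = _ := by
          refine Finset.sum_comm' fun i k => ?_
          simp only [Finset.mem_erase, Finset.mem_univ, and_true, true_and]
          exact ne_comm
  refine (integral_mul_norm_sq_mono h.bdd_threeSum (BddMeas.sum fun k _ => BddMeas.sum fun i _ =>
    BddMeas.sum fun j _ => hb i j k) hle Ψ).trans ?_
  rw [integral_sum_mul_norm_sq fun k _ => BddMeas.sum fun i _ => BddMeas.sum fun j _ => hb i j k,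
    Finset.mul_sum]
  refine Finset.sum_le_sum fun k _ => ?_
  have e : ∀ o, ∫ x, pairSumOff u k x * ‖gcomp P (cj k) o Ψ x‖ ^ 2 = ∑ i ∈ Finset.univ.erase k,
      ∑ j ∈ (Finset.univ.erase i).erase k, ∫ x, u (x i - x j) * ‖gcomp P (cj k) o Ψ x‖ ^ 2 := by
    intro o
    unfold pairSumOff
    rw [integral_sum_mul_norm_sq fun i _ => BddMeas.sum fun j _ => h.bdd_u i j]
    exact Finset.sum_congr rfl fun i _ => integral_sum_mul_norm_sq (fun j _ => h.bdd_u i j) _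
  simp only [e]
  rw [integral_sum_mul_norm_sq fun i _ => BddMeas.sum fun j _ => hb i j k, Finset.sum_comm,
    Finset.mul_sum]
  refine Finset.sum_le_sum fun i hi => ?_
  rw [integral_sum_mul_norm_sq fun j _ => hb i j k, Finset.sum_comm, Finset.mul_sum]
  refine Finset.sum_le_sum fun j hj => ?_
  exact h.near_mul_le (Finset.mem_erase.1 hi).1 (Finset.mem_erase.1 hj).1 (hΨ k)

/-- `(∑_l h̃_l + μ W) Ψ = Φ` in the weak sense. -/
structure IsWeak (P : Params) (μ : ℝ) (W : Config N → ℝ) (Ψ Φ : L2 (Config N)) : Prop where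
  mem : ∀ l, Ψ ∈ dom P (cj l)
  eq : ∀ v, (∀ l, v ∈ dom P (cj l)) →
    ∑ l, qT P (cj l) v Ψ + (μ : ℂ) * inner ℂ v (mulOp W Ψ) = inner ℂ v Φ

/-- The size of the localization errors. -/
def errSize (P : Params) (K R : ℝ) : ℝ :=
  444 * errConst P * (3 * (K + K ^ 2)) * (R⁻¹ + Real.sqrt R / R ^ 2)

variable {d μ : ℝ} {Ψ Φ Ξ : L2 (Config N)}

/-- With Θ = ∑ h̃_l Ψ, expand ‖Φ‖² = ‖Θ + μ W Ψ‖². The cross term is bounded below by -2μ times the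
localization error, at most half of d² M ≤ ‖Θ‖² by `hsmall`; the other half survives. -/
theorem IsWeak.mixed (hw : IsWeak P μ (dysonSum u t) Ψ Φ) (h : PairData R K u t u' t')
    (hd : 0 < d) (hμ : 0 ≤ μ)
    (hgap : ∀ l : Fin N, ∀ u ∈ dom P (cj l), d * graphSq P (cj l) u ≤ (qT P (cj l) u u).re)
    (hsmall : μ * errSize P K R ≤ d ^ 2 / 4) :
    (∀ l j, j ≠ l → ∀ o, gcomp P (cj l) o Ψ ∈ dom P (cj j)) ∧
      d ^ 2 * ∑ l, mixAll P Ψ l ≤ 2 * ‖Φ‖ ^ 2 := by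
  set W : Config N → ℝ := dysonSum u t with hW
  set Θ := Φ - (μ : ℂ) • mulOp W Ψ with hΘ
  have heq : ∀ v, (∀ l, v ∈ dom P (cj l)) → ∑ l, qT P (cj l) v Ψ = inner ℂ v Θ := fun v hv => by
    rw [hΘ, inner_sub_right, inner_smul_right, ← hw.eq v hv, add_sub_cancel_right]
  obtain ⟨h1, h2⟩ := mixed_bound hd hgap (fun i j hij => indep_cj hij) hw.mem heq
  refine ⟨h1, ?_⟩
  change d ^ 2 * ∑ l, mixAll P Ψ l ≤ ‖Θ‖ ^ 2 at h2
  set M := ∑ l, mixAll P Ψ l with hM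
  have hM0 : 0 ≤ M := Finset.sum_nonneg fun l _ => mixAll_nonneg _ _
  have hsplit : ∀ l : Fin N, mulOp W Ψ ∈ dom P (cj l) ∧
      -(errSize P K R * mixAll P Ψ l) ≤ (qT P (cj l) (mulOp W Ψ) Ψ).re := fun l => by
    obtain ⟨G, D, D', hs⟩ := h.split_dysonSum l
    have hK := h.K_nonneg
    obtain ⟨a1, a2⟩ := hs.le_re_qT h.R_pos (by positivity) (hgap l) (hw.mem l) (h1 l)
    refine ⟨a1, le_trans ?_ a2⟩
    have : 0 ≤ d * ∑ o, ∫ x, G x * ‖gcomp P (cj l) o Ψ x‖ ^ 2 :=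
      mul_nonneg hd.le (Finset.sum_nonneg fun o _ => integral_nonneg fun x =>
        mul_nonneg (hs.nonneg x) (sq_nonneg _))
    unfold errSize
    linarith
  have h3 : -(errSize P K R * M) ≤ (inner ℂ (mulOp W Ψ) Θ).re := by
    rw [← heq _ fun l => (hsplit l).1, Complex.re_sum, hM, Finset.mul_sum,
      ← Finset.sum_neg_distrib]
    exact Finset.sum_le_sum fun l _ => (hsplit l).2
  have h4 : ‖Φ‖ ^ 2 = ‖Θ‖ ^ 2 + 2 * (μ * (inner ℂ (mulOp W Ψ) Θ).re) +
      ‖(μ : ℂ) • mulOp W Ψ‖ ^ 2 := by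
    have : Φ = Θ + (μ : ℂ) • mulOp W Ψ := by rw [hΘ, sub_add_cancel]
    rw [this, norm_add_sq (𝕜 := ℂ), inner_smul_right]
    congr 3
    change ((μ : ℂ) * inner ℂ Θ (mulOp W Ψ)).re = _
    rw [Complex.re_ofReal_mul, ← inner_conj_symm, Complex.conj_re]
  have h5 := mul_le_mul_of_nonneg_left h3 hμ
  have h6 := mul_le_mul_of_nonneg_right hsmall hM0
  have h7 := sq_nonneg ‖(μ : ℂ) • mulOp W Ψ‖
  linarith

theorem IsWeak.norm_le {W : Config N → ℝ} (hw : IsWeak P μ W Φ Ξ) (hb : BddMeas W)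
    (hW0 : ∀ x, 0 ≤ W x) (hμ : 0 ≤ μ) (hd : 0 < d)
    (hgap : ∀ l : Fin N, ∀ u ∈ dom P (cj l), d * graphSq P (cj l) u ≤ (qT P (cj l) u u).re) :
    d * N * ‖Φ‖ ≤ ‖Ξ‖ := by
  have h1 : d * N * ‖Φ‖ ^ 2 ≤ (inner ℂ Φ Ξ).re := by
    rw [← hw.eq Φ hw.mem, Complex.add_re, Complex.re_sum, Complex.re_ofReal_mul, hb.re_inner,
      Complex.ofReal_re]
    have a1 : 0 ≤ μ * ∫ x, W x * ‖Φ x‖ ^ 2 :=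
      mul_nonneg hμ (integral_nonneg fun x => mul_nonneg (hW0 x) (sq_nonneg _))
    have a2 : ∑ _l : Fin N, d * ‖Φ‖ ^ 2 ≤ ∑ l : Fin N, (qT P (cj l) Φ Φ).re :=
      Finset.sum_le_sum fun l _ => (mul_le_mul_of_nonneg_left (norm_sq_le_graphSq (P := P)
        (c := cj l) Φ) hd.le).trans (hgap l Φ (hw.mem l))
    rw [Finset.sum_const, Finset.card_univ, Fintype.card_fin, nsmul_eq_mul] at a2
    linarith
  have h2 : (inner ℂ Φ Ξ).re ≤ ‖Φ‖ * ‖Ξ‖ := (Complex.re_le_norm _).trans (norm_inner_le_norm _ _)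
  rcases (norm_nonneg Φ).eq_or_lt with h0 | h0
  · rw [← h0, mul_zero]; exact norm_nonneg _
  · refine le_of_mul_le_mul_left ?_ h0
    calc ‖Φ‖ * (d * N * ‖Φ‖) = d * N * ‖Φ‖ ^ 2 := by ring
      _ ≤ _ := h1.trans h2

/-- The power of n: M is of order φ² ≤ ξ²/(d n)² and M' of order ξ², so √(M M') is of order ξ²/n;
and the error e, allowed to be as large as n, also gives e M of order ξ²/n. -/
theorem energy_arith {d n K e M M' φ ξ S : ℝ} (hd : 0 < d) (hn : 0 < n) (hK : 0 ≤ K)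
    (hM : 0 ≤ M) (hM' : 0 ≤ M') (hφ : 0 ≤ φ) (m2 : d ^ 2 * M ≤ 2 * φ ^ 2)
    (m2' : d ^ 2 * M' ≤ 2 * ξ ^ 2) (hnorm : d * n * φ ≤ ξ) (hsmall : e ≤ d ^ 2 / 4 * n)
    (h : d * S - e * M ≤ 1 * (Real.sqrt (1536 * K * M) * Real.sqrt (1536 * K * M'))) :
    S ≤ (1 / (2 * d ^ 3) + 3072 * K / d ^ 4) / n * ξ ^ 2 := by
  have hΦ : φ ≤ ξ / (d * n) := by rw [le_div_iff₀ (by positivity)]; linarith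
  have b1 : M ≤ 2 * (ξ / (d * n)) ^ 2 / d ^ 2 := by
    rw [le_div_iff₀ (by positivity), mul_comm]
    exact m2.trans (by gcongr)
  have b2 : M' ≤ 2 * ξ ^ 2 / d ^ 2 := by
    rw [le_div_iff₀ (by positivity), mul_comm]; exact m2'
  have b3 : Real.sqrt (1536 * K * M) * Real.sqrt (1536 * K * M') ≤
      3072 * K * ξ ^ 2 / (d ^ 3 * n) := by
    rw [← Real.sqrt_mul (by positivity)]
    refine Real.sqrt_le_iff.2 ⟨by positivity, ?_⟩
    calc 1536 * K * M * (1536 * K * M')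
        ≤ 1536 * K * (2 * (ξ / (d * n)) ^ 2 / d ^ 2) *
          (1536 * K * (2 * ξ ^ 2 / d ^ 2)) := by gcongr
      _ = _ := by field_simp; ring
  have b4 : e * M ≤ ξ ^ 2 / (2 * d ^ 2 * n) := by
    calc e * M ≤ d ^ 2 / 4 * n * (2 * (ξ / (d * n)) ^ 2 / d ^ 2) := by gcongr
      _ = _ := by field_simp; ring
  have b5 : d * S ≤ ξ ^ 2 / (2 * d ^ 2 * n) + 3072 * K * ξ ^ 2 / (d ^ 3 * n) := by
    linarith
  refine le_of_mul_le_mul_left (b5.trans (le_of_eq ?_)) hd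
  field_simp

/-- The three-body estimate in the absence of symmetry. -/
theorem IsWeak.integral_threeSum_le (hw : IsWeak P μ (dysonSum u t) Ψ Φ)
    (hw' : IsWeak P μ (dysonSum u t) Φ Ξ) (h : PairData R K u t u' t')
    (hd : 0 < d) (hμ : 0 ≤ μ) (hN : 0 < N)
    (hgap : ∀ l : Fin N, ∀ u ∈ dom P (cj l), d * graphSq P (cj l) u ≤ (qT P (cj l) u u).re)
    (hμN : μ * N ≤ 1) (hsmall : errSize P K R ≤ d ^ 2 / 4 * N) :
    ∫ x, threeSum u t x * ‖Ψ x‖ ^ 2 ≤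
      128 * (1 / (2 * d ^ 3) + 3072 * K / d ^ 4) * (R ^ 2 / N) * ‖Ξ‖ ^ 2 := by
  have hK := h.K_nonneg
  have hR := h.R_pos
  have hN' : (0 : ℝ) < N := Nat.cast_pos.2 hN
  have hs : μ * errSize P K R ≤ d ^ 2 / 4 := by
    calc μ * errSize P K R ≤ μ * (d ^ 2 / 4 * N) := mul_le_mul_of_nonneg_left hsmall hμ
      _ = d ^ 2 / 4 * (μ * N) := by ring
      _ ≤ d ^ 2 / 4 * 1 := mul_le_mul_of_nonneg_left hμN (by positivity)
      _ = _ := mul_one _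
  obtain ⟨m1, m2⟩ := hw.mixed h hd hμ hgap hs
  obtain ⟨m1', m2'⟩ := hw'.mixed h hd hμ hgap hs
  have hnorm := hw'.norm_le h.bdd_dysonSum h.dysonSum_nonneg hμ hd hgap
  set M := ∑ l, mixAll P Ψ l with hM
  set M' := ∑ l, mixAll P Φ l with hM'
  have hM0 : 0 ≤ M := Finset.sum_nonneg fun l _ => mixAll_nonneg _ _
  have hM0' : 0 ≤ M' := Finset.sum_nonneg fun l _ => mixAll_nonneg _ _
  set S := ∑ l, ∑ o, ∫ x, pairSumOff u l x * ‖gcomp P (cj l) o Ψ x‖ ^ 2 with hS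
  have hsplit : ∀ l : Fin N, mulOp (pairSum u) Ψ ∈ dom P (cj l) ∧
      d * (∑ o, ∫ x, pairSumOff u l x * ‖gcomp P (cj l) o Ψ x‖ ^ 2) -
        errSize P K R * mixAll P Ψ l ≤ (qT P (cj l) (mulOp (pairSum u) Ψ) Ψ).re := fun l => by
    obtain ⟨D, D', hs⟩ := h.split_pairSum l
    exact hs.le_re_qT h.R_pos (by positivity) (hgap l) (hw.mem l) (m1 l)
  -- The weak equation is tested with the full pair potential times Ψ, which lies in every form
  -- domain by the splitting.
  have h1 : d * S - errSize P K R * M ≤ (inner ℂ (mulOp (pairSum u) Ψ) Φ).re := by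
    rw [← hw.eq _ fun l => (hsplit l).1, Complex.add_re, Complex.re_sum, hM, hS, Finset.mul_sum,
      Finset.mul_sum, ← Finset.sum_sub_distrib]
    refine (Finset.sum_le_sum fun l _ => (hsplit l).2).trans (le_add_of_nonneg_right ?_)
    -- The contribution of μ W is the integral of a product of two nonnegative potentials against
    -- |Ψ|² and may be dropped.
    rw [Complex.re_ofReal_mul, (h.bdd_pairSum.isMul Ψ).inner_comm
      (h.bdd_pairSum.isMul (mulOp (dysonSum u t) Ψ)), ((h.bdd_pairSum.mul h.bdd_dysonSum).isMul
        Ψ).unique (mulOp_mulOp (h.bdd_dysonSum.isMul Ψ) (h.bdd_pairSum.isMul _)) |>.symm,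
      (h.bdd_pairSum.mul h.bdd_dysonSum).re_inner, Complex.ofReal_re]
    exact mul_nonneg hμ (integral_nonneg fun x =>
      mul_nonneg (mul_nonneg (h.pairSum_nonneg x) (h.dysonSum_nonneg x)) (sq_nonneg _))
  have h2 : ‖inner ℂ (mulOp (pairSum u) Ψ) Φ‖ ≤
      1 * (Real.sqrt (1536 * K * M) * Real.sqrt (1536 * K * M')) :=
    norm_inner_mulOp_le h.bdd_pairSum h.bdd_pairSum h.pairSum_nonneg zero_le_one
      (fun x => by rw [one_mul, abs_of_nonneg (h.pairSum_nonneg x)])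
      (h.integral_pairSum_le hw.mem m1) (h.integral_pairSum_le hw'.mem m1')
  have b6 := energy_arith hd hN' hK hM0 hM0' (norm_nonneg Φ)
    m2 m2' hnorm hsmall (h1.trans ((Complex.re_le_norm _).trans h2))
  refine (h.integral_threeSum_le hw.mem).trans ?_
  calc 128 * R ^ 2 * S
      ≤ 128 * R ^ 2 * ((1 / (2 * d ^ 3) + 3072 * K / d ^ 4) / N * ‖Ξ‖ ^ 2) := by gcongr
    _ = _ := by ring

end Pair

end ManyBody

/-! ### Permutations of the particles and the bosonic subspace. -/

section Symmetry

variable {P : Params} {N : ℕ}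

theorem permConfig_apply (σ : Equiv.Perm (Fin N)) (x : Config N) (i : Fin N) :
    permConfig σ x i = x (σ.symm i) := rfl

/-- The action of a permutation on `L²((ℝ³)^N)`. -/
def permOp (σ : Equiv.Perm (Fin N)) : L2 (Config N) →L[ℂ] L2 (Config N) :=
  (Lp.compMeasurePreservingₗᵢ ℂ (permConfig σ)
    (permConfig σ).measurePreserving).toContinuousLinearMap

theorem coeFn_permOp (σ : Equiv.Perm (Fin N)) (u : L2 (Config N)) :
    permOp σ u =ᵐ[volume] fun x => u (permConfig σ x) :=
  Lp.coeFn_compMeasurePreserving u (permConfig σ).measurePreserving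

theorem ae_permConfig (σ : Equiv.Perm (Fin N)) {p : Config N → Prop} (h : ∀ᵐ x, p x) :
    ∀ᵐ x, p (permConfig σ x) :=
  (permConfig σ).measurePreserving.quasiMeasurePreserving.ae h

theorem inner_permOp (σ : Equiv.Perm (Fin N)) (v u : L2 (Config N)) :
    inner ℂ (permOp σ v) (permOp σ u) = inner ℂ v u :=
  LinearIsometry.inner_map_map _ v u

theorem adjoint_permOp (σ : Equiv.Perm (Fin N)) (u : L2 (Config N)) :
    ContinuousLinearMap.adjoint (permOp σ) (permOp σ u) = u :=
  ext_inner_left ℂ fun v => by rw [ContinuousLinearMap.adjoint_inner_right, inner_permOp]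

theorem permOp_permOp (σ τ : Equiv.Perm (Fin N)) (u : L2 (Config N)) :
    permOp τ (permOp σ u) = permOp (σ * τ) u := by
  apply Lp.ext
  filter_upwards [coeFn_permOp τ (permOp σ u), coeFn_permOp (σ * τ) u,
    ae_permConfig τ (coeFn_permOp σ u)] with x h1 h2 h3
  rw [h1, h2, h3]
  rfl

theorem permConfig_add_e (σ : Equiv.Perm (Fin N)) (j : Fin N) (x : Config N) (a : Space) :
    permConfig σ (x + (cj (σ.symm j)).e a) = permConfig σ x + (cj j).e a := by
  ext i : 1
  rw [permConfig_apply]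
  by_cases h : i = j
  · subst h
    rw [add_e_same, add_e_same, permConfig_apply]
  · rw [add_e_of_ne h, add_e_of_ne (fun h' => h (σ.symm.injective h')), permConfig_apply]

theorem permOp_mulOp (σ : Equiv.Perm (Fin N)) {m : Config N → ℝ} (hm : BddMeas m)
    {m' : Config N → ℝ} (h : ∀ x, m (permConfig σ x) = m' x) (u : L2 (Config N)) :
    permOp σ (mulOp m u) = mulOp m' (permOp σ u) := by
  symm
  apply IsMul.mulOp_eq
  filter_upwards [coeFn_permOp σ u, coeFn_permOp σ (mulOp m u),
    ae_permConfig σ (hm.isMul u)] with x h1 h2 h3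
  rw [h1, h2, ← h3, h x]

theorem intertwines_permOp (σ : Equiv.Perm (Fin N)) (j : Fin N) :
    Intertwines (cj j).pr (cj j).e (cj (σ.symm j)).pr (cj (σ.symm j)).e (permOp σ) where
  map_tr a u := by
    apply Lp.ext
    filter_upwards [coeFn_permOp σ (tr ((cj j).e a) u), ae_permConfig σ (coeFn_tr ((cj j).e a) u),
      coeFn_tr ((cj (σ.symm j)).e a) (permOp σ u),
      ae_add ((cj (σ.symm j)).e a) (coeFn_permOp σ u)] with x h1 h2 h3 h4
    rw [h1, h2, h3, h4, permConfig_add_e]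
  map_mul m hm u := permOp_mulOp σ (hm.comp_pr (cj j).isCoord) (fun x => rfl) u

theorem mem_bosonSpace_iff {u : L2 (Config N)} : u ∈ bosonSpace N ↔ ∀ σ, permOp σ u = u := by
  simp only [bosonSpace, Submodule.mem_iInf]
  rfl

theorem permOp_mem_dom (σ : Equiv.Perm (Fin N)) {u : L2 (Config N)}
    (hu : ∀ l, u ∈ dom P (cj l)) (l : Fin N) : permOp σ u ∈ dom P (cj l) := by
  have := mem_dom_map (intertwines_permOp σ (σ l)) (hu (σ l))
  rwa [Equiv.symm_apply_apply] at this

theorem sum_qT_permOp (σ : Equiv.Perm (Fin N)) {v u : L2 (Config N)}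
    (hv : ∀ l, v ∈ dom P (cj l)) (hu : ∀ l, u ∈ dom P (cj l)) :
    ∑ l, qT P (cj l) (permOp σ v) (permOp σ u) = ∑ l, qT P (cj l) v u := by
  rw [← Equiv.sum_comp σ.symm fun l => qT P (cj l) (permOp σ v) (permOp σ u)]
  refine Finset.sum_congr rfl fun l _ => ?_
  have hI := intertwines_permOp σ l
  rw [qT_map hI (hI.adjoint (cj l).isCoord (cj (σ.symm l)).isCoord)
    (permOp_mem_dom σ hv _) (hu l), adjoint_permOp]

theorem qT_sum_left {F : Type} [NormedAddCommGroup F] [InnerProductSpace ℝ F]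
    [FiniteDimensional ℝ F] [MeasurableSpace F] [BorelSpace F] {c : Coord F} {ι : Type*}
    (s : Finset ι) {v : ι → L2 F} {u : L2 F} (hv : ∀ i, v i ∈ dom P c) (hu : u ∈ dom P c) :
    qT P c (∑ i ∈ s, v i) u = ∑ i ∈ s, qT P c (v i) u := by
  classical
  induction s using Finset.induction_on with
  | empty =>
    have := qT_smul_left (zero_mem (dom P c)) hu 0
    simpa using this
  | insert a s ha ih =>
    rw [Finset.sum_insert ha, Finset.sum_insert ha,
      qT_add_left (hv a) (sum_mem fun i _ => hv i) hu, ih]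

theorem sum_permOp_mem (v : L2 (Config N)) :
    ∑ σ : Equiv.Perm (Fin N), permOp σ v ∈ bosonSpace N := by
  refine mem_bosonSpace_iff.2 fun τ => ?_
  rw [map_sum, ← Equiv.sum_comp (Equiv.mulRight τ) fun σ => permOp σ v]
  exact Finset.sum_congr rfl fun σ _ => permOp_permOp σ τ v

/-- An arbitrary test function is replaced by the sum of its permutations, which is symmetric; by
invariance of Ψ, Φ and W every term of the equation is just multiplied by the number of
permutations. Nonsymmetric test vectors, such as those built from a single h̃_l, become admissible.
-/
theorem IsWeak.of_symmetric {μ : ℝ} {W : Config N → ℝ} (hW : BddMeas W)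
    (hsymm : ∀ σ x, W (permConfig σ x) = W x) {Ψ Φ : L2 (Config N)} (hΨ : Ψ ∈ bosonSpace N)
    (hΦ : Φ ∈ bosonSpace N) (hmem : ∀ l, Ψ ∈ dom P (cj l))
    (h : ∀ v ∈ bosonSpace N, (∀ l, v ∈ dom P (cj l)) →
      ∑ l, qT P (cj l) v Ψ + (μ : ℂ) * inner ℂ v (mulOp W Ψ) = inner ℂ v Φ) :
    IsWeak P μ W Ψ Φ := by
  refine ⟨hmem, fun v hv => ?_⟩
  have hinv : ∀ σ, permOp σ (mulOp W Ψ) = mulOp W Ψ := fun σ => by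
    rw [permOp_mulOp σ hW (hsymm σ), mem_bosonSpace_iff.1 hΨ]
  have h1 : ∀ σ w, permOp σ w = w → inner ℂ (permOp σ v) w = inner ℂ v w := fun σ w hw => by
    nth_rewrite 1 [← hw]
    exact inner_permOp σ v w
  have h2 : ∀ σ, ∑ l, qT P (cj l) (permOp σ v) Ψ = ∑ l, qT P (cj l) v Ψ := fun σ => by
    conv_lhs => rw [← mem_bosonSpace_iff.1 hΨ σ]
    exact sum_qT_permOp σ hv hmem
  have h3 := h _ (sum_permOp_mem v) fun l => sum_mem fun σ _ => permOp_mem_dom σ hv l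
  have h4 : ∑ l, qT P (cj l) (∑ σ : Equiv.Perm (Fin N), permOp σ v) Ψ =
      ∑ _σ : Equiv.Perm (Fin N), ∑ l, qT P (cj l) v Ψ := by
    rw [← Finset.sum_congr rfl fun σ _ => h2 σ, Finset.sum_comm]
    exact Finset.sum_congr rfl fun l _ =>
      qT_sum_left _ (fun σ => permOp_mem_dom σ hv l) (hmem l)
  rw [h4, sum_inner, sum_inner, Finset.sum_congr rfl fun σ _ => h1 σ _ (hinv σ),
    Finset.sum_congr rfl fun σ _ => h1 σ _ (mem_bosonSpace_iff.1 hΦ σ), Finset.mul_sum,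
    ← Finset.sum_add_distrib, Finset.sum_const, Finset.sum_const] at h3
  rw [nsmul_eq_mul, nsmul_eq_mul] at h3
  refine mul_left_cancel₀ (Nat.cast_ne_zero.2 ?_) h3
  rw [Finset.card_univ]
  exact Fintype.card_ne_zero

theorem oneSum_map {ι κ : Type*} [DecidableEq ι] [DecidableEq κ] (u t : Space → ℝ) (τ : ι ↪ κ)
    (T : Finset ι) (f : κ → Space) :
    oneSum u t (T.map τ) f = oneSum u t T fun i => f (τ i) := by
  rw [oneSum, Finset.sum_map, oneSum]
  refine Finset.sum_congr rfl fun i _ => ?_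
  rw [← Finset.map_erase, Finset.prod_map]

theorem dysonSum_permConfig (u t : Space → ℝ) (σ : Equiv.Perm (Fin N)) (x : Config N) :
    dysonSum u t (permConfig σ x) = dysonSum u t x := by
  unfold dysonSum
  rw [← Equiv.sum_comp σ]
  refine Finset.sum_congr rfl fun j _ => ?_
  have : Finset.univ.erase (σ j) = (Finset.univ.erase j).map σ.toEmbedding := by
    rw [Finset.map_erase, Finset.map_univ_equiv]
    rfl
  rw [this, oneSum_map]
  simp only [permConfig_apply, Equiv.coe_toEmbedding, Equiv.symm_apply_apply]

end Symmetry

/-! ### The scaling of R and the conclusion. -/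

section Main

variable {P : Params} {N : ℕ}

theorem potForm_eq {W : Config N → ℝ} (hW : BddMeas W) (v u : L2 (Config N)) :
    potForm W v u = inner ℂ v (mulOp W u) := ((hW.isMul u).inner_eq v).symm

theorem re_potForm {W : Config N → ℝ} (hW : BddMeas W) (u : L2 (Config N)) :
    (potForm W u u).re = ∫ x, W x * ‖u x‖ ^ 2 := by
  rw [potForm_eq hW, hW.re_inner, Complex.ofReal_re]

theorem kineticForm_eq (v u : L2 (Config N)) :
    kineticForm P.A P.V P.θ P.ε P.s v u = ∑ l, qT P (cj l) v u := rfl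

variable {R K : ℝ} {U : Space → ℝ} {u' t' : Fin 3 → Space → ℝ}

theorem dysonW_eq (h : PairData R K (scaledU U R) (scaledθ P.θ (2 * R)) u' t') :
    (dysonW U P.θ R : Config N → ℝ) = dysonSum (scaledU U R) (scaledθ P.θ (2 * R)) := by
  funext x
  rw [dysonSum_eq h.u_neg]
  simp only [dysonW, Finset.filter_ne', filter_ne_and_ne]

theorem isWeak_of_mem (h : PairData R K (scaledU U R) (scaledθ P.θ (2 * R)) u' t')
    {Ψ Φ : bosonSpace N} (hmem : (Ψ, Φ) ∈ effHamiltonian P.A P.V P.θ U P.ε P.s R N) :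
    IsWeak P ((1 - P.ε) ^ 2 / N) (dysonSum (scaledU U R) (scaledθ P.θ (2 * R)))
      (Ψ : L2 (Config N)) Φ := by
  refine IsWeak.of_symmetric h.bdd_dysonSum (dysonSum_permConfig _ _) Ψ.2 Φ.2 hmem.1
    fun v hv hvd => ?_
  have := hmem.2 ⟨v, hv⟩ hvd
  rw [dysonW_eq h] at this
  rw [← potForm_eq h.bdd_dysonSum]
  exact this

/-- The hypothesis reads A ≤ R y with y = n^(2/3) ≤ n. The first bound follows at once; cubing gives
A² ≤ A³ ≤ R³ n², which is the second. The exponent 2/3 is what R^(-3/2) ≪ n requires. -/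
theorem scale_bounds {R A n : ℝ} (hR : 0 < R) (hA : 1 ≤ A) (hn : 1 ≤ n)
    (h : A ≤ R / n ^ (-(2 / 3) : ℝ)) : R⁻¹ ≤ n / A ∧ Real.sqrt R / R ^ 2 ≤ n / A := by
  have hn0 : 0 < n := by linarith
  have hA0 : 0 < A := by linarith
  set y := n ^ (2 / 3 : ℝ) with hy
  have hy0 : 0 < y := Real.rpow_pos_of_pos hn0 _
  have hy1 : y ≤ n := by
    calc y ≤ n ^ (1 : ℝ) := Real.rpow_le_rpow_of_exponent_le hn (by norm_num)
      _ = n := Real.rpow_one n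
  have hy3 : y ^ 3 = n ^ 2 := by
    rw [hy, ← Real.rpow_natCast, ← Real.rpow_mul hn0.le, ← Real.rpow_natCast]
    norm_num
  have hRy : A ≤ R * y := by
    rwa [Real.rpow_neg hn0.le, div_inv_eq_mul] at h
  constructor
  · rw [inv_le_iff_one_le_mul₀ hR, div_mul_eq_mul_div, le_div_iff₀ hA0]
    nlinarith
  · rw [div_le_div_iff₀ (by positivity) hA0]
    have h1 : A ^ 2 ≤ R ^ 3 * n ^ 2 := by
      calc A ^ 2 ≤ A ^ 3 := pow_le_pow_right₀ hA (by norm_num)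
        _ ≤ (R * y) ^ 3 := pow_le_pow_left₀ hA0.le hRy 3
        _ = R ^ 3 * n ^ 2 := by rw [mul_pow, hy3]
    refine abs_le_of_sq_le_sq' ?_ (by positivity) |>.2
    rw [mul_pow, Real.sq_sqrt hR.le]
    calc R * A ^ 2 ≤ R * (R ^ 3 * n ^ 2) := by gcongr
      _ = _ := by ring

theorem eventually_errSize_le (P : Params) {K d : ℝ} (hK : 0 ≤ K) (hd : 0 < d) {R : ℕ → ℝ}
    (hR : Tendsto (fun N : ℕ => R N / (N : ℝ) ^ (-(2 / 3) : ℝ)) atTop atTop) :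
    ∀ᶠ N : ℕ in atTop, 0 < N ∧ 0 < R N ∧ errSize P K (R N) ≤ d ^ 2 / 4 * N := by
  set c := 444 * errConst P * (3 * (K + K ^ 2)) with hc
  have hc0 : 0 ≤ c := by
    have := errConst_pos P
    positivity
  -- The two scale bounds give c · 2N/A, which is at most d² N/4 as soon as A ≥ 8c/d².
  set A := max 1 (8 * c / d ^ 2) with hA
  have hA1 : 1 ≤ A := le_max_left _ _
  have hA2 : 8 * c / d ^ 2 ≤ A := le_max_right _ _
  filter_upwards [hR.eventually_ge_atTop A, eventually_gt_atTop 0] with N h1 hN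
  have hN1 : (1 : ℝ) ≤ N := Nat.one_le_cast.2 hN
  have hRN : 0 < R N := by
    have hp : (0 : ℝ) < (N : ℝ) ^ (-(2 / 3) : ℝ) := Real.rpow_pos_of_pos (by linarith) _
    exact (div_pos_iff_of_pos_right hp).1 (by linarith)
  refine ⟨hN, hRN, ?_⟩
  obtain ⟨b1, b2⟩ := scale_bounds hRN hA1 hN1 h1
  have hA0 : 0 < A := by linarith
  calc errSize P K (R N) = c * ((R N)⁻¹ + Real.sqrt (R N) / R N ^ 2) := rfl
    _ ≤ c * (N / A + N / A) := by gcongr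
    _ = 2 * c * N / A := by ring
    _ ≤ d ^ 2 / 4 * N := by
      rw [div_le_iff₀ hA0]
      rw [div_le_iff₀ (by positivity)] at hA2
      nlinarith

theorem aestronglyMeasurable_of_memLp_compact {A : Space → Space}
    (h : ∀ K : Set Space, IsCompact K → MemLp A 3 (volume.restrict K)) :
    AEStronglyMeasurable A volume := by
  have : AEStronglyMeasurable A (volume.restrict (⋃ n : ℕ, Metric.closedBall (0 : Space) n)) :=
    aestronglyMeasurable_iUnion_iff.2 fun n => (h _ (isCompact_closedBall 0 _)).1
  rwa [Metric.iUnion_closedBall_nat, Measure.restrict_univ] at this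

theorem Growth.three_body (hP : Growth P) {a : ℝ} (hU : IsSoftPotential a U) :
    ∃ C : ℝ, 0 < C ∧ ∀ R : ℕ → ℝ,
      Tendsto (fun N : ℕ => R N / (N : ℝ) ^ (-(2 / 3) : ℝ)) atTop atTop →
      ∀ᶠ N : ℕ in atTop, ∀ Ψ Φ Ξ : bosonSpace N,
        (Ψ, Φ) ∈ effHamiltonian P.A P.V P.θ U P.ε P.s (R N) N →
        (Ψ, Ξ) ∈ opSq (effHamiltonian P.A P.V P.θ U P.ε P.s (R N) N) →
        (potForm (threeBody U P.θ (R N)) (Ψ : L2 (Config N)) Ψ).re ≤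
            C * (R N ^ 2 / N) * ‖Ξ‖ ^ 2 ∧
        (kineticForm P.A P.V P.θ P.ε P.s (Ψ : L2 (Config N)) Ψ).re +
            (1 - P.ε) ^ 2 / N * (potForm (twoBody U (R N)) (Ψ : L2 (Config N)) Ψ).re -
            C * (R N ^ 2 / (N : ℝ) ^ 2) * ‖Ξ‖ ^ 2 ≤
          (inner ℂ Ψ Φ).re := by
  obtain ⟨d, hd, hgap⟩ := hP.exists_gap_coord
  obtain ⟨K, hK, hpair⟩ := exists_pairData P.heav hU
  refine ⟨128 * (1 / (2 * d ^ 3) + 3072 * K / d ^ 4), by positivity, fun R hR => ?_⟩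
  filter_upwards [eventually_errSize_le P hK hd hR] with N hN Ψ Φ Ξ hΨΦ hΨΞ
  obtain ⟨hN0, hRN, herr⟩ := hN
  obtain ⟨u', t', h⟩ := hpair (R N) hRN
  -- The intermediate vector of the square is used as it comes; its equality with Φ is not needed,
  -- as Φ enters only through the energy identity `hin`.
  obtain ⟨Φ', h1, h2⟩ := hΨΞ
  have hN' : (0 : ℝ) < N := Nat.cast_pos.2 hN0
  have hε0 : 0 ≤ (1 - P.ε) ^ 2 := sq_nonneg _
  have hε1 : (1 - P.ε) ^ 2 ≤ 1 := pow_le_one₀ (by linarith [P.ε_lt]) (by linarith [P.ε_pos])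
  have hgap' : ∀ l : Fin N, ∀ u ∈ dom P (cj l), d * graphSq P (cj l) u ≤ (qT P (cj l) u u).re :=
    fun l u hu => by rw [re_qT_self]; exact hgap (cj l) u hu
  have e2 : (twoBody U (R N) : Config N → ℝ) = pairSum (scaledU U (R N)) :=
    funext (twoBody_eq U (R N))
  have e3 : (threeBody U P.θ (R N) : Config N → ℝ) =
      threeSum (scaledU U (R N)) (scaledθ P.θ (2 * R N)) := funext (threeBody_eq U P.θ (R N))
  have hμ : 0 ≤ (1 - P.ε) ^ 2 / N := by positivity
  have hμ1 : (1 - P.ε) ^ 2 / N * N ≤ 1 := by rwa [div_mul_cancel₀ _ hN'.ne']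
  have key := (isWeak_of_mem h h1).integral_threeSum_le (isWeak_of_mem h h2) h hd hμ hN0 hgap'
    hμ1 herr
  rw [e2, e3, re_potForm h.bdd_threeSum, re_potForm h.bdd_pairSum, kineticForm_eq]
  refine ⟨key, ?_⟩
  have hw := isWeak_of_mem h hΨΦ
  have hin : (inner ℂ Ψ Φ).re = (∑ l, qT P (cj l) (Ψ : L2 (Config N)) Ψ).re +
      (1 - P.ε) ^ 2 / N * ∫ x, dysonSum (scaledU U (R N)) (scaledθ P.θ (2 * R N)) x *
        ‖(Ψ : L2 (Config N)) x‖ ^ 2 := by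
    rw [Submodule.coe_inner, ← hw.eq _ hw.mem, Complex.add_re, Complex.re_ofReal_mul,
      h.bdd_dysonSum.re_inner, Complex.ofReal_re]
  rw [hin]
  have hle := integral_mul_norm_sq_mono (h.bdd_pairSum.sub h.bdd_threeSum) h.bdd_dysonSum
    h.pairSum_sub_le (Ψ : L2 (Config N))
  simp only [sub_mul] at hle
  rw [integral_sub (h.bdd_pairSum.integrable _) (h.bdd_threeSum.integrable _)] at hle
  have hle' := mul_le_mul_of_nonneg_left hle hμ
  set T := ∫ x, threeSum (scaledU U (R N)) (scaledθ P.θ (2 * R N)) x *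
    ‖(Ψ : L2 (Config N)) x‖ ^ 2 with hT
  have hμ2 : (1 - P.ε) ^ 2 / N ≤ 1 / N := by gcongr
  have hfin : (1 - P.ε) ^ 2 / N * T ≤
      128 * (1 / (2 * d ^ 3) + 3072 * K / d ^ 4) * (R N ^ 2 / (N : ℝ) ^ 2) * ‖Ξ‖ ^ 2 := by
    refine (mul_le_mul_of_nonneg_left key hμ).trans ((mul_le_mul_of_nonneg_right hμ2
      (by positivity)).trans (le_of_eq ?_))
    rw [Submodule.coe_norm]
    field_simp
  linarith

end Main

end

end DysonGas

/-- For a nonnegative self-adjoint `T`, the form domain of `T⁴` is `D(T²)`, and there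
`⟨Ψ, T⁴ Ψ⟩ = ‖T² Ψ‖²`; the two operator inequalities are stated for all `Ψ` in this domain, with
`Φ = H̃_N Ψ` and `Ξ = (H̃_N)² Ψ`. -/
theorem lemma3p4
    (A : Space → Space) (V : Space → ℝ)
    (hA_loc : ∀ K : Set Space, IsCompact K → MemLp A 3 (volume.restrict K))
    (hA_growth : ∃ b : ℝ, 0 < b ∧
      Tendsto (fun x => ‖A x‖ * Real.exp (-b * ‖x‖)) (cocompact Space) (𝓝 0))
    (hV_nonneg : ∀ x, 0 ≤ V x)
    (hV_loc : LocallyIntegrable V volume)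
    (hV_growth : Tendsto V (cocompact Space) atTop)
    (hAV : Tendsto (fun x => ‖A x‖ ^ 2 / V x) (cocompact Space) (𝓝 0))
    (θ U : Space → ℝ) (a : ℝ)
    (hθ : IsSmoothHeaviside θ) (hU : IsSoftPotential a U)
    (ε s : ℝ) (hε : 0 < ε) (hε1 : ε < 1) (hs : 0 < s) :
    ∃ C : ℝ, 0 < C ∧ ∀ R : ℕ → ℝ,
      Tendsto (fun N : ℕ => R N / (N : ℝ) ^ (-(2 / 3) : ℝ)) atTop atTop →
      ∀ᶠ N : ℕ in atTop, ∀ Ψ Φ Ξ : bosonSpace N,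
        (Ψ, Φ) ∈ effHamiltonian A V θ U ε s (R N) N →
        (Ψ, Ξ) ∈ opSq (effHamiltonian A V θ U ε s (R N) N) →
        (potForm (threeBody U θ (R N)) (Ψ : L2 (Config N)) Ψ).re ≤
            C * (R N ^ 2 / N) * ‖Ξ‖ ^ 2 ∧
        (kineticForm A V θ ε s (Ψ : L2 (Config N)) Ψ).re +
            (1 - ε) ^ 2 / N * (potForm (twoBody U (R N)) (Ψ : L2 (Config N)) Ψ).re -
            C * (R N ^ 2 / (N : ℝ) ^ 2) * ‖Ξ‖ ^ 2 ≤
          (inner ℂ Ψ Φ).re := by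
  let P : Params :=
    { A := A
      V := V
      θ := θ
      ε := ε
      s := s
      measA := fun k => (EuclideanSpace.proj (𝕜 := ℝ) k).continuous.comp_aestronglyMeasurable
        (aestronglyMeasurable_of_memLp_compact hA_loc)
      measV := hV_loc.aestronglyMeasurable
      V_nonneg := hV_nonneg
      heav := hθ
      s_pos := hs
      ε_pos := hε
      ε_lt := hε1 }
  exact Growth.three_body (P := P) ⟨hA_loc, hV_growth, hAV⟩ hU
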